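/- **Setting.** Let $X\subset\mathbb R^d$ be nonempty, closed and convex with $\|x\|_2\le D$ for all $x\in X$. An oblivious adversary fixes loss functions $\ell_1,\dots,\ell_T$ that are twice differentiable at the points of $X$ and convex on $X$, and that satisfy, for all $t$ and all $x\in X$: $0\le \ell_t(x)\le B$, $\|\nabla \ell_t(x)\|_2\le\beta$, $\lambda_{\max}(\nabla^2\ell_t(x))\le\gamma$ and $\operatorname{rank}\nabla^2\ell_t(x)\le 1$, where $\beta>0$ and $\gamma\ge 0$. Write $L_T^*=\min_{x\in X}\sum_{t=1}^T\ell_t(x)$. **Algorithm (objective perturbation, parameters $\varepsilon,\delta,\beta,\gamma$).** In each round $t=1,\dots,T$ draw a fresh independent vector $b_t\in\mathbb R^d$, either from the *Gamma perturbation*, with density proportional to $\exp(-\varepsilon\|b\|_2/(2\beta))$, or from the *Gaussian perturbation* $\mathcal N\big(0,\frac{\beta^2\log(2/\delta)+4\varepsilon}{\varepsilon^2}I\big)$, and play $$x_t\in\arg\min_{x\in X}\ \sum_{s=1}^{t-1}\ell_s(x)+\frac{\gamma}{\varepsilon}\|x\|_2^2+\langle b_t,x\rangle .$$ The expected regret is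 $R_T=\mathbb E\big[\sum_{t=1}^T\ell_t(x_t)\big]-L_T^*$. **Theorem (first-order regret in OCO).** There is a universal constant $C$ with the following properties. 1. *(Gamma.)* Let $A=\gamma D^2+\beta dD$. There is a choice of $\varepsilon>0$, depending only on $d,D,\beta,\gamma,L_T^*$, for which $R_T\le C\big(\sqrt{L_T^*A}+A\big)$ for all such $X$ and losses, and, if $L_T^*\ge A$, $$R_T\le C\sqrt{L_T^*\,(\gamma D^2+\beta dD)} .$$ 2. *(Gaussian.)* Suppose $BT\ge 2$ and $\delta=1/(BT)$. Let $A'=\gamma D^2+D\sqrt{d(\beta^2\log(BT)+1)}$. There is a choice of $\varepsilon>0$, depending only on $d,T,D,B,\beta,\gamma,L_T^*$, for which $R_T\le C\big(\sqrt{L_T^*A'}+A'+1\big)$ for all such $X$ and losses, and, if $\beta\ge1$, $B\ge 1$ and $L_T^*\ge \gamma D^2+D\sqrt{d\,\beta^2\log(BT)}$, $$R_T\le C\sqrt{L_T^*\big(\gamma D^2+D\sqrt{d\,\beta^2\log(BT)}\big)} .$$ -/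

import Mathlib

/-- The action space `ℝ^d` with its Euclidean norm. -/
abbrev Vec (d : ℕ) : Type := EuclideanSpace ℝ (Fin d)

/-- The Hessian of `f` at `x`, as a linear operator: the derivative of the gradient. -/
noncomputable def hessian {d : ℕ} (f : Vec d → ℝ) (x : Vec d) : Vec d →ₗ[ℝ] Vec d :=
  (fderiv ℝ (gradient f) x).toLinearMap

/-- `f` is twice differentiable at `x`. -/
def TwiceDifferentiableAt {d : ℕ} (f : Vec d → ℝ) (x : Vec d) : Prop :=
  (∀ᶠ y in nhds x, DifferentiableAt ℝ f y) ∧ DifferentiableAt ℝ (gradient f) x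

/-- A nonempty closed convex action set of Euclidean norm at most `D`. -/
structure IsActionSet {d : ℕ} (X : Set (Vec d)) (D : ℝ) : Prop where
  nonempty : X.Nonempty
  closed : IsClosed X
  convex : Convex ℝ X
  norm_le : ∀ x ∈ X, ‖x‖ ≤ D

/-- The loss-only online convex optimization setting: convex losses with values in `[0, B]`,
gradients of norm at most `β`, and Hessians of largest eigenvalue at most `γ` and rank at most
one, all of this on `X`. -/
structure IsLossSequence {d T : ℕ} (X : Set (Vec d)) (loss : Fin T → Vec d → ℝ)
    (B β γ : ℝ) : Prop where
  convexOn : ∀ t, ConvexOn ℝ X (loss t)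
  nonneg : ∀ t, ∀ x ∈ X, 0 ≤ loss t x
  le_bound : ∀ t, ∀ x ∈ X, loss t x ≤ B
  twiceDifferentiable : ∀ t, ∀ x ∈ X, TwiceDifferentiableAt (loss t) x
  norm_gradient_le : ∀ t, ∀ x ∈ X, ‖gradient (loss t) x‖ ≤ β
  eigenvalue_le : ∀ t, ∀ x ∈ X, ∀ μ : ℝ,
    Module.End.HasEigenvalue (hessian (loss t) x) μ → μ ≤ γ
  rank_le_one : ∀ t, ∀ x ∈ X, Module.finrank ℝ (LinearMap.range (hessian (loss t) x)) ≤ 1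

/-- `L` is the cumulative loss of the best fixed action in hindsight,
`L = min_{x ∈ X} ∑ t, loss t x`. -/
def IsBestLoss {d T : ℕ} (X : Set (Vec d)) (loss : Fin T → Vec d → ℝ) (L : ℝ) : Prop :=
  IsLeast ((fun x => ∑ t, loss t x) '' X) L

/-- The Gamma perturbation: the probability distribution on `ℝ^d` with density proportional to
`exp (-(ε ‖b‖) / (2 β))`. -/
noncomputable def gammaNoise (d : ℕ) (ε β : ℝ) : MeasureTheory.Measure (Vec d) :=
  let m : MeasureTheory.Measure (Vec d) := MeasureTheory.volume.withDensity
    (fun b => ENNReal.ofReal (Real.exp (-(ε * ‖b‖) / (2 * β))))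
  (m Set.univ)⁻¹ • m

/-- The Gaussian perturbation: the centred normal distribution on `ℝ^d` with covariance matrix
`((β² log (2/δ) + 4 ε) / ε²) I`. -/
noncomputable def gaussianNoise (d : ℕ) (ε δ β : ℝ) : MeasureTheory.Measure (Vec d) :=
  ProbabilityTheory.multivariateGaussian 0
    (((β ^ 2 * Real.log (2 / δ) + 4 * ε) / ε ^ 2) • (1 : Matrix (Fin d) (Fin d) ℝ))

/-- The perturbed and regularized objective that is minimized in round `t`, when the noise vector
of that round is `b`. -/
noncomputable def perturbedObjective {d T : ℕ} (loss : Fin T → Vec d → ℝ) (γ ε : ℝ)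
    (t : Fin T) (b x : Vec d) : ℝ :=
  ∑ s ∈ Finset.Iio t, loss s x + γ / ε * ‖x‖ ^ 2 + inner ℝ b x

/-- `x` is the (random) sequence of moves of online objective perturbation on the probability
space `(Ω, P)`: in every round `t` a fresh noise vector `b t` with distribution `ν` is drawn, and
`x t` is a minimizer over `X` of the perturbed objective. -/
structure IsObjPertRun {d T : ℕ} {Ω : Type*} [MeasurableSpace Ω] (P : MeasureTheory.Measure Ω)
    (X : Set (Vec d)) (loss : Fin T → Vec d → ℝ) (γ ε : ℝ)
    (ν : MeasureTheory.Measure (Vec d)) (b x : Fin T → Ω → Vec d) : Prop where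
  measurable_noise : ∀ t, Measurable (b t)
  noise_law : ∀ t, P.map (b t) = ν
  noise_indep : ProbabilityTheory.iIndepFun b P
  measurable_move : ∀ t, Measurable (x t)
  move_mem : ∀ t ω, x t ω ∈ X
  move_isMin : ∀ t ω, IsMinOn (perturbedObjective loss γ ε t (b t ω)) X (x t ω)

/-- The expected regret of the random moves `x`, when the best action in hindsight has cumulative
loss `L`. -/
noncomputable def expectedRegret {d T : ℕ} {Ω : Type*} [MeasurableSpace Ω]
    (P : MeasureTheory.Measure Ω) (loss : Fin T → Vec d → ℝ) (x : Fin T → Ω → Vec d)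
    (L : ℝ) : ℝ :=
  (∫ ω, ∑ t, loss t (x t ω) ∂P) - L

/-!
First-order regret of online objective perturbation.

**Reduction to stability.** Let `F n` be the sum of the first `n` losses and let `φ n b` be the
minimum over `X` of `F n x + (γ/ε) ‖x‖² + ⟨b, x⟩` (`potential`). The increments
`ψ t = φ (t+1) - φ t` telescope, and `φ T - φ 0 ≤ L + γ D²/ε + 2 D ‖b‖`. Since all rounds use the
same noise distribution, the regret is controlled as soon as `E ℓ_t(x_t) ≤ (1 + O(ε)) E ψ_t` in
every round: playing before the loss is seen must cost only a factor `1 + O(ε)`. The parameter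
`ε` is then chosen to balance `ε L` against `A / ε`.

**Gamma noise.** If `x` minimizes the objective of round `t` for the noise `b`, it minimizes the
one of round `t + 1` for `Φ b = b - ∇ℓ_t(x)`, so `ℓ_t(x) ≤ ψ_t(Φ b)` (`loss_le_potential_sub`).
As `b ↦ x` is antitone and the Hessian of the loss is positive in the directions that matter and has
rank at most one, `Φ` is injective with Jacobian determinant at least `1`
(`one_le_det_fderiv_shift`). Hence `Φ` transports Lebesgue measure to something no larger, and
since `‖Φ b - b‖ ≤ β`, it changes the density `exp (-ε ‖b‖ / (2 β))` by at most a factor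
`exp (ε / 2)`. Without curvature (`γ = 0`), the gradient is constant on `X` and `Φ` is a
translation.

**Gaussian noise.** Here the density ratio is `exp r` with `r = -⟨b, ∇ℓ⟩/v`, roughly, where `v` is
the variance; `r` depends on the noise through the minimizer, and it cannot be bounded pointwise.
Write `h = ℓ/ε` and follow the minimizer `x_s` of the objective with `s h` added, with
`G_s = ∇h(x_s)` and `h_s = h(x_s)`; then `x_s(b) = x_0(b + s G_s(b))` (`pathPoint_shift`). It
suffices to show `E e ≤ O(1) E h_0` for the slope `e = ⟨G_0, x_0 - x_ε⟩/ε`, up to an exponentially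
small term. Two facts about volume are used:

* `b ↦ b - t G_s(b)` does not decrease volume, so `G_s` has nonpositive divergence, and
  integration by parts gives `E w ⟨b, G_s⟩ ≤ v E ⟨∇w, G_s⟩` for weights `w ≥ 0`
  (`integral_mul_inner_pathGradient_le`).
* `b ↦ b + s G_s(b)` contracts volume at most by the factor `1 + s`. This change of variables
  turns `x_s` into `x_0` and gains `exp (-4 s)` on the event `-⟨b, G_s⟩/v ≥ 6`
  (`integral_mul_max_le`).

The average increment `χ` of the potential along the first `ε` of the path (`averageIncrement`) has
gradient `(x_ε - x_0)/ε`, so `e = -⟨∇χ, G_0⟩`. The function `χ` is split into nonnegative weights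
`w_1, …, w_S`, with `w_i ≤ 4^i h_i` for `i < S`, each tested against `G_i` instead of `G_0`. By the
first fact, `-E ⟨∇w_i, G_i⟩` is at most the mean of `w_i` times the log density ratio, which by the
second fact is `O(E w_i)` up to `4^i exp (-4 i) E h_0`; for the last index, `S ≈ log (2 B T)`, the
crude bound on the loss is good enough. The price of testing against
different `G_i` is controlled pointwise, by strong convexity, because the losses `h_i` decrease
along the path and the residual weights stop once `∑ 4^i h_i` exceeds a multiple of `h_0`
(`inner_pathGradient_zero_le`). Without curvature, being one round behind is a translation of the
noise by a fixed vector, which is short relative to the standard deviation, and a tail bound for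
`r` suffices (`integral_gaussian_comp_sub_le`).
-/

open MeasureTheory Filter Topology Set
open scoped ENNReal NNReal

/-! ### First-order conditions on a convex set -/

/-- The gradient inequality for a function that is convex only on `X`; the gradient is the full
one, which exists at `x` although `X` may have empty interior. -/
lemma ConvexOn.add_inner_gradient_le {d : ℕ} {X : Set (Vec d)} {f : Vec d → ℝ} {g x y : Vec d}
    (hf : ConvexOn ℝ X f) (hx : x ∈ X) (hy : y ∈ X) (hg : HasGradientAt f g x) :
    f x + inner ℝ g (y - x) ≤ f y := by
  have hline : HasDerivAt (fun t : ℝ => x + t • (y - x)) (y - x) 0 := by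
    simpa using ((hasDerivAt_id (0 : ℝ)).smul_const (y - x)).const_add x
  have hder : HasDerivAt (fun t : ℝ => f (x + t • (y - x))) (inner ℝ g (y - x)) 0 := by
    have hg' : HasFDerivAt f (InnerProductSpace.toDual ℝ (Vec d) g) (x + (0 : ℝ) • (y - x)) := by
      simpa using hg.hasFDerivAt
    have h := hg'.comp_hasDerivAt (0 : ℝ) hline
    rwa [InnerProductSpace.toDual_apply_apply] at h
  have hslope := hder.tendsto_slope_zero_right
  have hbound : ∀ᶠ t : ℝ in 𝓝[>] 0, t⁻¹ • (f (x + (0 + t) • (y - x))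
      - f (x + (0 : ℝ) • (y - x))) ≤ f y - f x := by
    filter_upwards [Ioo_mem_nhdsGT (zero_lt_one (α := ℝ))] with t ht
    have hc := hf.2 hx hy (sub_nonneg.2 ht.2.le) ht.1.le (by ring)
    have he : x + (0 + t) • (y - x) = (1 - t) • x + t • y := by module
    rw [he, zero_smul, add_zero, smul_eq_mul, inv_mul_le_iff₀ ht.1]
    simp only [smul_eq_mul] at hc
    linarith
  linarith [le_of_tendsto hslope hbound]

/-- The regularized and perturbed objective `f x + c ‖x‖² + ⟨b, x⟩`. -/
noncomputable def tilted {d : ℕ} (f : Vec d → ℝ) (c : ℝ) (b x : Vec d) : ℝ :=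
  f x + c * ‖x‖ ^ 2 + inner ℝ b x

lemma hasGradientAt_tilted {d : ℕ} {f : Vec d → ℝ} {g x : Vec d} (c : ℝ) (b : Vec d)
    (hg : HasGradientAt f g x) :
    HasGradientAt (tilted f c b) (g + (2 * c) • x + b) x := by
  rw [hasGradientAt_iff_hasFDerivAt] at hg ⊢
  have h1 : HasFDerivAt (fun y : Vec d => ‖y‖ ^ 2) (2 • innerSL ℝ x) x :=
    (hasStrictFDerivAt_norm_sq x).hasFDerivAt
  have h2 : HasFDerivAt (fun y : Vec d => (inner ℝ b y : ℝ)) (innerSL ℝ b) x :=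
    (innerSL ℝ b).hasFDerivAt
  refine ((hg.add (h1.const_mul c)).add h2).congr_fderiv ?_
  ext v
  simp
  ring

lemma convexOn_tilted {d : ℕ} {X : Set (Vec d)} {f : Vec d → ℝ} {c : ℝ} (hf : ConvexOn ℝ X f)
    (hc : 0 ≤ c) (b : Vec d) : ConvexOn ℝ X (tilted f c b) := by
  have h1 : ConvexOn ℝ X (fun y : Vec d => ‖y‖ ^ 2) :=
    ((convexOn_norm (convex_univ (𝕜 := ℝ))).pow (fun _ _ => norm_nonneg _) 2).subset
      (subset_univ _) hf.1
  have h2 : ConvexOn ℝ X (fun y : Vec d => (inner ℝ b y : ℝ)) :=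
    (innerSL ℝ b).toLinearMap.convexOn hf.1
  exact (hf.add (h1.smul hc)).add h2

/-- Minimizers of a tilted objective are the solutions of a variational inequality. -/
lemma isMinOn_tilted_iff {d : ℕ} {X : Set (Vec d)} {f : Vec d → ℝ} {c : ℝ} {b g x : Vec d}
    (hf : ConvexOn ℝ X f) (hc : 0 ≤ c) (hx : x ∈ X) (hg : HasGradientAt f g x) :
    IsMinOn (tilted f c b) X x ↔ ∀ y ∈ X, 0 ≤ inner ℝ (g + (2 * c) • x + b) (y - x) := by
  have hgt := hasGradientAt_tilted c b hg
  constructor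
  · intro h y hy
    have := h.localize.hasFDerivWithinAt_nonneg hgt.hasFDerivAt.hasFDerivWithinAt
      (sub_mem_posTangentConeAt_of_segment_subset (hf.1.segment_subset hx hy))
    rwa [InnerProductSpace.toDual_apply_apply] at this
  · intro h y hy
    have := (convexOn_tilted hf hc b).add_inner_gradient_le hx hy hgt
    exact (le_add_of_nonneg_right (h y hy)).trans this

/-- The gradients of a convex function form a monotone map. -/
lemma ConvexOn.inner_gradient_sub_nonneg {d : ℕ} {X : Set (Vec d)} {f : Vec d → ℝ}
    {g h x y : Vec d} (hf : ConvexOn ℝ X f) (hx : x ∈ X) (hy : y ∈ X) (hg : HasGradientAt f g x)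
    (hh : HasGradientAt f h y) : 0 ≤ inner ℝ (h - g) (y - x) := by
  have h1 := hf.add_inner_gradient_le hx hy hg
  have h2 := hf.add_inner_gradient_le hy hx hh
  rw [← neg_sub y x, inner_neg_right] at h2
  rw [inner_sub_left]
  linarith

/-- Two minimizers of tilted objectives with different noise: the minimizer moves against the
change of the noise, with a strength governed by the regularizer. -/
lemma two_mul_norm_sub_sq_le_inner {d : ℕ} {X : Set (Vec d)} {f : Vec d → ℝ} {c : ℝ}
    {b b' x x' : Vec d}
    (hf : ConvexOn ℝ X f) (hd : ∀ y ∈ X, DifferentiableAt ℝ f y) (hc : 0 ≤ c)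
    (hx : x ∈ X) (hx' : x' ∈ X) (hm : IsMinOn (tilted f c b) X x)
    (hm' : IsMinOn (tilted f c b') X x') :
    2 * c * ‖x - x'‖ ^ 2 ≤ inner ℝ (b' - b) (x - x') := by
  have hg := (hd x hx).hasGradientAt
  have hg' := (hd x' hx').hasGradientAt
  have h1 := (isMinOn_tilted_iff hf hc hx hg).1 hm x' hx'
  have h2 := (isMinOn_tilted_iff hf hc hx' hg').1 hm' x hx
  have h3 := hf.inner_gradient_sub_nonneg hx' hx hg' hg
  rw [← neg_sub x x', inner_neg_right] at h1
  rw [← real_inner_self_eq_norm_sq]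
  simp only [inner_add_left, inner_sub_left, real_inner_smul_left] at *
  have h4 : (inner ℝ (x - x') (x - x') : ℝ) = inner ℝ x (x - x') - inner ℝ x' (x - x') :=
    inner_sub_left _ _ _
  simp only [inner_sub_left] at h4 ⊢
  nlinarith

/-- Adding a loss `ℓ` to the objective and subtracting its gradient at the minimizer from the
noise leaves the minimizer in place. -/
lemma isMinOn_tilted_add {d : ℕ} {X : Set (Vec d)} {f l : Vec d → ℝ} {c : ℝ} {b x : Vec d}
    (hf : ConvexOn ℝ X f) (hl : ConvexOn ℝ X l) (hc : 0 ≤ c) (hx : x ∈ X)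
    (hfd : DifferentiableAt ℝ f x) (hld : DifferentiableAt ℝ l x)
    (hm : IsMinOn (tilted f c b) X x) :
    IsMinOn (tilted (f + l) c (b - gradient l x)) X x := by
  have hsum : HasGradientAt (f + l) (gradient f x + gradient l x) x := by
    rw [hasGradientAt_iff_hasFDerivAt, map_add]
    exact hfd.hasGradientAt.hasFDerivAt.add hld.hasGradientAt.hasFDerivAt
  rw [isMinOn_tilted_iff (hf.add hl) hc hx hsum]
  rw [isMinOn_tilted_iff hf hc hx hfd.hasGradientAt] at hm
  convert hm using 4
  abel

/-! ### The perturbed potential -/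

/-- The optimal value of the tilted objective over `X`, as a function of the noise `b`. -/
noncomputable def potential {d : ℕ} (X : Set (Vec d)) (f : Vec d → ℝ) (c : ℝ) (b : Vec d) : ℝ :=
  sInf (tilted f c b '' X)

lemma potential_eq_of_isMinOn {d : ℕ} {X : Set (Vec d)} {f : Vec d → ℝ} {c : ℝ} {b x : Vec d}
    (hx : x ∈ X) (hm : IsMinOn (tilted f c b) X x) : potential X f c b = tilted f c b x :=
  IsLeast.csInf_eq ⟨mem_image_of_mem _ hx, by rintro _ ⟨y, hy, rfl⟩; exact hm hy⟩

lemma exists_isMinOn_tilted {d : ℕ} {X : Set (Vec d)} {f : Vec d → ℝ} {D : ℝ}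
    (hX : IsActionSet X D) (hf : ∀ y ∈ X, DifferentiableAt ℝ f y) (c : ℝ) (b : Vec d) :
    ∃ x ∈ X, IsMinOn (tilted f c b) X x := by
  have hcomp : IsCompact X := Metric.isCompact_of_isClosed_isBounded hX.closed
    ((Metric.isBounded_closedBall (x := (0 : Vec d)) (r := D)).subset
      fun x hx => by simpa using hX.norm_le x hx)
  exact hcomp.exists_isMinOn hX.nonempty fun y hy =>
    (hasGradientAt_tilted c b (hf y hy).hasGradientAt).differentiableAt.continuousAt
      |>.continuousWithinAt

lemma potential_le {d : ℕ} {X : Set (Vec d)} {f : Vec d → ℝ} {D : ℝ} (hX : IsActionSet X D)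
    (hf : ∀ y ∈ X, DifferentiableAt ℝ f y) (c : ℝ) (b : Vec d) {y : Vec d} (hy : y ∈ X) :
    potential X f c b ≤ tilted f c b y := by
  obtain ⟨x, hx, hm⟩ := exists_isMinOn_tilted hX hf c b
  rw [potential_eq_of_isMinOn hx hm]
  exact hm hy

lemma continuous_potential {d : ℕ} {X : Set (Vec d)} {f : Vec d → ℝ} {D : ℝ}
    (hX : IsActionSet X D) (hf : ∀ y ∈ X, DifferentiableAt ℝ f y) (c : ℝ) :
    Continuous (potential X f c) := by
  have key : ∀ b b', potential X f c b ≤ potential X f c b' + D * dist b b' := by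
    intro b b'
    obtain ⟨x, hx, hm⟩ := exists_isMinOn_tilted hX hf c b'
    have h1 := potential_le hX hf c b hx
    rw [potential_eq_of_isMinOn hx hm]
    have h2 : (inner ℝ (b - b') x : ℝ) ≤ ‖b - b'‖ * D :=
      (real_inner_le_norm _ _).trans
        (mul_le_mul_of_nonneg_left (hX.norm_le x hx) (norm_nonneg _))
    rw [inner_sub_left] at h2
    rw [dist_eq_norm]
    simp only [tilted] at *
    linarith
  have hD : 0 ≤ D := by
    obtain ⟨x, hx⟩ := hX.nonempty
    exact (norm_nonneg x).trans (hX.norm_le x hx)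
  exact (LipschitzWith.of_le_add_mul ⟨D, hD⟩ key).continuous

/-- The loss suffered by the minimizer is at most the increment of the potential, evaluated at
the noise shifted by the gradient of the loss. -/
lemma loss_le_potential_sub {d : ℕ} {X : Set (Vec d)} {f l : Vec d → ℝ} {c D : ℝ} {b x : Vec d}
    (hX : IsActionSet X D) (hf : ConvexOn ℝ X f) (hl : ConvexOn ℝ X l) (hc : 0 ≤ c) (hx : x ∈ X)
    (hfd : ∀ y ∈ X, DifferentiableAt ℝ f y) (hld : DifferentiableAt ℝ l x)
    (hm : IsMinOn (tilted f c b) X x) :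
    l x ≤ potential X (f + l) c (b - gradient l x) - potential X f c (b - gradient l x) := by
  rw [potential_eq_of_isMinOn hx (isMinOn_tilted_add hf hl hc hx (hfd x hx) hld hm)]
  have := potential_le hX hfd c (b - gradient l x) hx
  simp only [tilted, Pi.add_apply] at *
  linarith

lemma potential_add_mem_Icc {d : ℕ} {X : Set (Vec d)} {f l : Vec d → ℝ} {c D B : ℝ}
    (hX : IsActionSet X D) (hfd : ∀ y ∈ X, DifferentiableAt ℝ f y)
    (hld : ∀ y ∈ X, DifferentiableAt ℝ l y) (h0 : ∀ y ∈ X, 0 ≤ l y) (hB : ∀ y ∈ X, l y ≤ B)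
    (b : Vec d) : potential X (f + l) c b - potential X f c b ∈ Icc 0 B := by
  have hfld : ∀ y ∈ X, DifferentiableAt ℝ (f + l) y := fun y hy => (hfd y hy).add (hld y hy)
  obtain ⟨x, hx, hm⟩ := exists_isMinOn_tilted hX hfd c b
  obtain ⟨y, hy, hm'⟩ := exists_isMinOn_tilted hX hfld c b
  have h1 := potential_le hX hfd c b hy
  have h2 := potential_le hX hfld c b hx
  rw [potential_eq_of_isMinOn hx hm] at h1 ⊢
  rw [potential_eq_of_isMinOn hy hm'] at h2 ⊢
  have h3 := h0 y hy
  have h4 := hB x hx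
  simp only [tilted, Pi.add_apply] at *
  constructor <;> linarith

/-! ### Rank-one Hessians -/

lemma inner_hessian_comm {d : ℕ} {f : Vec d → ℝ} {x : Vec d} (hf : TwiceDifferentiableAt f x)
    (v w : Vec d) : (inner ℝ (hessian f x v) w : ℝ) = inner ℝ (hessian f x w) v := by
  have hgrad : HasFDerivAt (fun y => InnerProductSpace.toDual ℝ (Vec d) (gradient f y))
      ((InnerProductSpace.toDual ℝ (Vec d)).toContinuousLinearEquiv.toContinuousLinearMap.comp
        (fderiv ℝ (gradient f) x)) x :=
    (InnerProductSpace.toDual ℝ (Vec d)).toContinuousLinearEquiv.toContinuousLinearMap.hasFDerivAt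
      |>.comp x hf.2.hasFDerivAt
  have := second_derivative_symmetric_of_eventually
    (hf.1.mono fun y hy => hy.hasGradientAt.hasFDerivAt) hgrad v w
  simpa [hessian] using this

/-- A symmetric operator of rank at most one is `v ↦ μ ⟨c, v⟩ c`. -/
lemma exists_hessian_eq {d : ℕ} {f : Vec d → ℝ} {x : Vec d} (hf : TwiceDifferentiableAt f x)
    (hrank : Module.finrank ℝ (LinearMap.range (hessian f x)) ≤ 1) :
    ∃ (μ : ℝ) (c : Vec d), ∀ v, hessian f x v = (μ * inner ℝ c v) • c := by
  obtain ⟨⟨c, hc⟩, hspan⟩ := finrank_le_one_iff.1 hrank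
  have hφ : ∀ v, ∃ r : ℝ, r • c = hessian f x v := fun v => by
    obtain ⟨r, hr⟩ := hspan ⟨hessian f x v, LinearMap.mem_range_self _ _⟩
    exact ⟨r, congrArg Subtype.val hr⟩
  choose φ hφ using hφ
  by_cases h0 : c = 0
  · exact ⟨0, 0, fun v => by simp [← hφ v, h0]⟩
  refine ⟨φ c / ‖c‖ ^ 2, c, fun v => ?_⟩
  have hn : ‖c‖ ^ 2 ≠ 0 := by simpa using h0
  have h := inner_hessian_comm hf v c
  rw [← hφ v, ← hφ c, real_inner_smul_left, real_inner_smul_left, real_inner_self_eq_norm_sq] at h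
  rw [← hφ v]
  congr 1
  field_simp
  linarith

/-- The Hessian of a function that is convex on `X` is nonnegative in the directions that point
into `X`. -/
lemma inner_hessian_nonneg {d : ℕ} {X : Set (Vec d)} {f : Vec d → ℝ} {x y : Vec d}
    (hf : ConvexOn ℝ X f) (hd : ∀ z ∈ X, DifferentiableAt ℝ f z)
    (h2 : DifferentiableAt ℝ (gradient f) x) (hx : x ∈ X) (hy : y ∈ X) :
    0 ≤ (inner ℝ (hessian f x (y - x)) (y - x) : ℝ) := by
  have hline : HasDerivAt (fun t : ℝ => x + t • (y - x)) (y - x) 0 := by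
    simpa using ((hasDerivAt_id (0 : ℝ)).smul_const (y - x)).const_add x
  have hder : HasDerivAt (fun t : ℝ => gradient f (x + t • (y - x))) (hessian f x (y - x)) 0 := by
    have hg' : HasFDerivAt (gradient f) (fderiv ℝ (gradient f) x) (x + (0 : ℝ) • (y - x)) := by
      simpa using h2.hasFDerivAt
    exact hg'.comp_hasDerivAt (0 : ℝ) hline
  have hslope := (hder.tendsto_slope_zero_right).inner (𝕜 := ℝ) (tendsto_const_nhds (x := y - x))
  refine ge_of_tendsto hslope ?_
  filter_upwards [Ioo_mem_nhdsGT (zero_lt_one (α := ℝ))] with t ht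
  have hmem : x + t • (y - x) ∈ X := hf.1.add_smul_sub_mem hx hy ⟨ht.1.le, ht.2.le⟩
  have h := hf.inner_gradient_sub_nonneg hx hmem (hd x hx).hasGradientAt
    (hd _ hmem).hasGradientAt
  rw [add_sub_cancel_left, real_inner_smul_right] at h
  have h' := nonneg_of_mul_nonneg_right h ht.1
  simp only [zero_add, zero_smul, add_zero]
  rw [real_inner_smul_left]
  exact mul_nonneg (inv_nonneg.2 ht.1.le) h'

/-- If the Hessians of a convex loss have rank at most one and no positive eigenvalue, then its
gradient is constant on `X`: the Hessian can be nonzero only in directions orthogonal to `X`. -/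
lemma gradient_eq_of_eigenvalue_nonpos {d : ℕ} {X : Set (Vec d)} {f : Vec d → ℝ}
    (hf : ConvexOn ℝ X f) (h2 : ∀ x ∈ X, TwiceDifferentiableAt f x)
    (heig : ∀ x ∈ X, ∀ μ : ℝ, Module.End.HasEigenvalue (hessian f x) μ → μ ≤ 0)
    (hrank : ∀ x ∈ X, Module.finrank ℝ (LinearMap.range (hessian f x)) ≤ 1)
    {x y : Vec d} (hx : x ∈ X) (hy : y ∈ X) : gradient f x = gradient f y := by
  have hd : ∀ z ∈ X, DifferentiableAt ℝ f z := fun z hz => (h2 z hz).1.self_of_nhds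
  have hzero : ∀ z ∈ X, ∀ w ∈ X, hessian f z (w - z) = 0 := by
    intro z hz w hw
    obtain ⟨μ, c, hμ⟩ := exists_hessian_eq (h2 z hz) (hrank z hz)
    by_cases hc : c = 0
    · simp [hμ, hc]
    have hn : 0 < ‖c‖ ^ 2 := by positivity
    have hle : μ * ‖c‖ ^ 2 ≤ 0 := by
      refine heig z hz _ (Module.End.hasEigenvalue_of_hasEigenvector (x := c) ⟨?_, hc⟩)
      rw [Module.End.mem_eigenspace_iff, hμ, real_inner_self_eq_norm_sq]
    have hμ0 : μ ≤ 0 := by nlinarith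
    have hnn := inner_hessian_nonneg hf hd (h2 z hz).2 hz hw
    rw [hμ, real_inner_smul_left] at hnn
    have : μ * inner ℝ c (w - z) = 0 := by
      have h3 : μ * (inner ℝ c (w - z) * inner ℝ c (w - z)) = 0 := by
        nlinarith [mul_self_nonneg (inner ℝ c (w - z) : ℝ)]
      rcases mul_eq_zero.1 h3 with h | h
      · simp [h]
      · simp [mul_self_eq_zero.1 h]
    rw [hμ, this, zero_smul]
  have hderiv : ∀ t ∈ Icc (0 : ℝ) 1,
      HasDerivWithinAt (fun t : ℝ => gradient f (x + t • (y - x))) 0 (Icc 0 1) t := by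
    intro t ht
    have hmem : x + t • (y - x) ∈ X := hf.1.add_smul_sub_mem hx hy ht
    have hline : HasDerivAt (fun t : ℝ => x + t • (y - x)) (y - x) t := by
      simpa using ((hasDerivAt_id t).smul_const (y - x)).const_add x
    have h := ((h2 _ hmem).2.hasFDerivAt.comp_hasDerivAt t hline).hasDerivWithinAt (s := Icc 0 1)
    -- `y - x` is the difference of the directions to `y` and to `x` from the current point.
    have hH : hessian f (x + t • (y - x)) (y - x) = 0 := by
      have e1 := hzero _ hmem y hy
      have e2 := hzero _ hmem x hx
      have e3 := congrArg₂ (· - ·) e1 e2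
      simp only [← map_sub, sub_sub_sub_cancel_right, sub_zero] at e3
      exact e3
    have hH' : fderiv ℝ (gradient f) (x + t • (y - x)) (y - x) = 0 := hH
    rwa [hH'] at h
  have hconst := constant_of_derivWithin_zero
    (f := fun t : ℝ => gradient f (x + t • (y - x))) (a := 0) (b := 1)
    (fun t ht => (hderiv t ht).differentiableWithinAt)
    (fun t ht => (hderiv t ⟨ht.1, ht.2.le⟩).derivWithin
      (uniqueDiffOn_Icc zero_lt_one t ⟨ht.1, ht.2.le⟩)) 1 (right_mem_Icc.2 zero_le_one)
  simpa using hconst.symm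

/-! ### The perturbed minimizer as a function of the noise -/

/-- A minimizer over `X` of the objective `f` tilted by the noise `b`. For
differentiable convex `f` it exists, and it is unique if `c > 0`. -/
noncomputable def minimizer {d : ℕ} (X : Set (Vec d)) (f : Vec d → ℝ) (c : ℝ) (b : Vec d) : Vec d :=
  Classical.epsilon fun x => x ∈ X ∧ IsMinOn (tilted f c b) X x

lemma minimizer_spec {d : ℕ} {X : Set (Vec d)} {f : Vec d → ℝ} {D : ℝ}
    (hX : IsActionSet X D) (hf : ∀ y ∈ X, DifferentiableAt ℝ f y) (c : ℝ) (b : Vec d) :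
    minimizer X f c b ∈ X ∧ IsMinOn (tilted f c b) X (minimizer X f c b) := by
  obtain ⟨x, hx, hm⟩ := exists_isMinOn_tilted hX hf c b
  exact Classical.epsilon_spec (p := fun x => x ∈ X ∧ IsMinOn (tilted f c b) X x) ⟨x, hx, hm⟩

/-- With a strictly convex regularizer, the minimizer is unique. -/
lemma eq_minimizer {d : ℕ} {X : Set (Vec d)} {f : Vec d → ℝ} {c D : ℝ}
    (hX : IsActionSet X D) (hf : ConvexOn ℝ X f) (hd : ∀ y ∈ X, DifferentiableAt ℝ f y)
    (hc : 0 < c) {b x : Vec d} (hx : x ∈ X) (hm : IsMinOn (tilted f c b) X x) :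
    x = minimizer X f c b := by
  obtain ⟨hx', hm'⟩ := minimizer_spec hX hd c b
  have h := two_mul_norm_sub_sq_le_inner hf hd hc.le hx hx' hm hm'
  rw [sub_self, inner_zero_left] at h
  have h0 : ‖x - minimizer X f c b‖ ^ 2 ≤ 0 := by nlinarith
  have h1 : ‖x - minimizer X f c b‖ = 0 := by nlinarith [norm_nonneg (x - minimizer X f c b)]
  exact sub_eq_zero.1 (norm_eq_zero.1 h1)

/-- With a strictly convex regularizer, the minimizer is a Lipschitz function of the noise. -/
lemma exists_lipschitzWith_minimizer {d : ℕ} {X : Set (Vec d)} {f : Vec d → ℝ} {c D : ℝ}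
    (hX : IsActionSet X D) (hf : ConvexOn ℝ X f) (hd : ∀ y ∈ X, DifferentiableAt ℝ f y)
    (hc : 0 < c) : ∃ K : ℝ≥0, LipschitzWith K (minimizer X f c) := by
  refine ⟨Real.toNNReal (2 * c)⁻¹, LipschitzWith.of_dist_le_mul fun b b' => ?_⟩
  obtain ⟨hx, hm⟩ := minimizer_spec hX hd c b
  obtain ⟨hx', hm'⟩ := minimizer_spec hX hd c b'
  rw [dist_eq_norm, dist_eq_norm, Real.coe_toNNReal _ (by positivity),
    le_inv_mul_iff₀ (by positivity)]
  have h := (two_mul_norm_sub_sq_le_inner hf hd hc.le hx hx' hm hm').trans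
    (real_inner_le_norm _ _)
  rw [norm_sub_rev b' b] at h
  rcases (norm_nonneg (minimizer X f c b - minimizer X f c b')).eq_or_lt with h0 | h0
  · rw [← h0, mul_zero]; exact norm_nonneg _
  · nlinarith

lemma inner_minimizer_sub_nonpos {d : ℕ} {X : Set (Vec d)} {f : Vec d → ℝ} {c D : ℝ}
    (hX : IsActionSet X D) (hf : ConvexOn ℝ X f) (hd : ∀ y ∈ X, DifferentiableAt ℝ f y)
    (hc : 0 ≤ c) (b b' : Vec d) :
    (inner ℝ (b' - b) (minimizer X f c b' - minimizer X f c b) : ℝ) ≤ 0 := by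
  obtain ⟨hx, hm⟩ := minimizer_spec hX hd c b
  obtain ⟨hx', hm'⟩ := minimizer_spec hX hd c b'
  have h := two_mul_norm_sub_sq_le_inner hf hd hc hx hx' hm hm'
  rw [← neg_sub (minimizer X f c b) (minimizer X f c b'), inner_neg_right]
  nlinarith [sq_nonneg ‖minimizer X f c b - minimizer X f c b'‖]

/-- The shift `b ↦ b - ∇ℓ(ξ b)` does not decrease volume: its derivative is `1 - H ∘ Dξ` with
`H = μ c cᵀ`, of determinant `1 - μ ⟨c, Dξ c⟩`. If `0 ≤ μ` this is at least one because `ξ` is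
antimonotone; if `μ < 0`, convexity makes `c` orthogonal to all directions in `X`. -/
lemma one_le_det_fderiv_shift {d : ℕ} {X : Set (Vec d)} {l : Vec d → ℝ} {ξ : Vec d → Vec d}
    (hl : ConvexOn ℝ X l) (h2 : ∀ x ∈ X, TwiceDifferentiableAt l x)
    (hrank : ∀ x ∈ X, Module.finrank ℝ (LinearMap.range (hessian l x)) ≤ 1)
    (hξX : ∀ b, ξ b ∈ X) (hanti : ∀ b b', (inner ℝ (b' - b) (ξ b' - ξ b) : ℝ) ≤ 0)
    {b : Vec d} (hξ : DifferentiableAt ℝ ξ b) :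
    1 ≤ (ContinuousLinearMap.id ℝ (Vec d)
      - (fderiv ℝ (gradient l) (ξ b)).comp (fderiv ℝ ξ b)).det := by
  obtain ⟨μ, c, hμ⟩ := exists_hessian_eq (h2 _ (hξX b)) (hrank _ (hξX b))
  set K := fderiv ℝ ξ b
  have hμ' : ∀ v, fderiv ℝ (gradient l) (ξ b) v = (μ * inner ℝ c v) • c := hμ
  have hd : ∀ z ∈ X, DifferentiableAt ℝ l z := fun z hz => (h2 z hz).1.self_of_nhds
  have hslope : Tendsto (fun t : ℝ => t⁻¹ • (ξ (b + t • c) - ξ b)) (𝓝[>] 0) (𝓝 (K c)) := by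
    have hline : HasDerivAt (fun t : ℝ => b + t • c) c 0 := by
      simpa using ((hasDerivAt_id (0 : ℝ)).smul_const c).const_add b
    have hξ' : HasFDerivAt ξ K (b + (0 : ℝ) • c) := by simpa using hξ.hasFDerivAt
    simpa using (hξ'.comp_hasDerivAt (0 : ℝ) hline).tendsto_slope_zero_right
  have hinner := (tendsto_const_nhds (x := c)).inner hslope (𝕜 := ℝ)
  have hle : μ * inner ℝ c (K c) ≤ 0 := by
    rcases le_or_gt 0 μ with hμ0 | hμ0
    · refine mul_nonpos_of_nonneg_of_nonpos hμ0 (le_of_tendsto hinner ?_)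
      filter_upwards [self_mem_nhdsWithin] with t ht
      have h := hanti b (b + t • c)
      rw [add_sub_cancel_left, real_inner_smul_left] at h
      rw [real_inner_smul_right]
      exact mul_nonpos_of_nonneg_of_nonpos (inv_nonneg.2 (mem_Ioi.1 ht).le)
        (nonpos_of_mul_nonpos_right h ht)
    · have horth : ∀ y ∈ X, (inner ℝ c (y - ξ b) : ℝ) = 0 := by
        intro y hy
        have h := inner_hessian_nonneg hl hd (h2 _ (hξX b)).2 (hξX b) hy
        rw [hμ, real_inner_smul_left] at h
        have : (inner ℝ c (y - ξ b) : ℝ) * inner ℝ c (y - ξ b) ≤ 0 := by nlinarith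
        nlinarith [mul_self_nonneg (inner ℝ c (y - ξ b) : ℝ), mul_self_eq_zero.1
          (le_antisymm this (mul_self_nonneg _))]
      have h0 : (inner ℝ c (K c) : ℝ) = 0 :=
        tendsto_nhds_unique hinner (tendsto_const_nhds.congr fun t => by
          rw [real_inner_smul_right, horth _ (hξX _), mul_zero])
      rw [h0, mul_zero]
  have heq : ((ContinuousLinearMap.id ℝ (Vec d) - (fderiv ℝ (gradient l) (ξ b)).comp K :
      Vec d →L[ℝ] Vec d) : Vec d →ₗ[ℝ] Vec d) =
      LinearMap.transvection (((-μ) • (innerSL ℝ c).comp K : Vec d →L[ℝ] ℝ) : Vec d →ₗ[ℝ] ℝ) c := by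
    ext1 v
    simp [LinearMap.transvection.apply, hμ', sub_eq_add_neg]
  rw [ContinuousLinearMap.det, heq, LinearMap.transvection.det]
  simp
  linarith

/-! ### Stability under a volume-nondecreasing shift of the noise -/

/-- A map that is injective and almost everywhere differentiable with determinant at least `K⁻¹`
increases Lebesgue integrals under composition at most by the factor `K`. -/
lemma lintegral_comp_le_of_one_le_mul_det {d : ℕ} {Φ : Vec d → Vec d}
    {Φ' : Vec d → Vec d →L[ℝ] Vec d} {s : Set (Vec d)} {K : ℝ} (hK : 0 ≤ K)
    (hs : MeasurableSet s) (hae : ∀ᵐ b, b ∈ s) (hinj : Function.Injective Φ)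
    (hΦ : ∀ b ∈ s, HasFDerivAt Φ (Φ' b) b) (hdet : ∀ b ∈ s, 1 ≤ K * (Φ' b).det)
    (u : Vec d → ℝ≥0∞) : ∫⁻ b, u (Φ b) ≤ ENNReal.ofReal K * ∫⁻ b, u b := by
  have hrestrict : (volume : Measure (Vec d)).restrict s = volume :=
    Measure.restrict_eq_self_of_ae_mem hae
  calc ∫⁻ b, u (Φ b) = ∫⁻ b in s, u (Φ b) := by rw [hrestrict]
    _ ≤ ∫⁻ b in s, ENNReal.ofReal K * (ENNReal.ofReal |(Φ' b).det| * u (Φ b)) := by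
        refine setLIntegral_mono' hs fun b hb => ?_
        rw [← mul_assoc, ← ENNReal.ofReal_mul hK]
        refine le_mul_of_one_le_left zero_le ?_
        rw [← ENNReal.ofReal_one]
        exact ENNReal.ofReal_le_ofReal
          ((hdet b hb).trans (mul_le_mul_of_nonneg_left (le_abs_self _) hK))
    _ = ENNReal.ofReal K * ∫⁻ b in s, ENNReal.ofReal |(Φ' b).det| * u (Φ b) :=
        lintegral_const_mul' _ _ ENNReal.ofReal_ne_top
    _ = ENNReal.ofReal K * ∫⁻ b in Φ '' s, u b := by
        rw [lintegral_image_eq_lintegral_abs_det_fderiv_mul volume hs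
          (fun b hb => (hΦ b hb).hasFDerivWithinAt) hinj.injOn u]
    _ ≤ ENNReal.ofReal K * ∫⁻ b, u b := mul_le_mul_right (setLIntegral_le_lintegral _ _) _

/-- Shifting the noise by the gradient of a loss of rank one, evaluated at the minimizer, does not
decrease volume. -/
lemma lintegral_comp_sub_gradient_le {d : ℕ} {X : Set (Vec d)} {f l : Vec d → ℝ} {c D : ℝ}
    (hX : IsActionSet X D) (hf : ConvexOn ℝ X f) (hfd : ∀ y ∈ X, DifferentiableAt ℝ f y)
    (hl : ConvexOn ℝ X l) (h2 : ∀ x ∈ X, TwiceDifferentiableAt l x)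
    (hrank : ∀ x ∈ X, Module.finrank ℝ (LinearMap.range (hessian l x)) ≤ 1) (hc : 0 < c)
    (u : Vec d → ℝ≥0∞) :
    ∫⁻ b, u (b - gradient l (minimizer X f c b)) ≤ ∫⁻ b, u b := by
  have hld : ∀ z ∈ X, DifferentiableAt ℝ l z := fun z hz => (h2 z hz).1.self_of_nhds
  have hξ := minimizer_spec hX hfd c
  obtain ⟨K, hK⟩ := exists_lipschitzWith_minimizer hX hf hfd hc
  have hinj : Function.Injective fun b => b - gradient l (minimizer X f c b) := by
    intro b b' hbb
    have hbb' : b - gradient l (minimizer X f c b) = b' - gradient l (minimizer X f c b') := hbb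
    have hm := isMinOn_tilted_add hf hl hc.le (hξ b).1 (hfd _ (hξ b).1) (hld _ (hξ b).1) (hξ b).2
    have hm' := isMinOn_tilted_add hf hl hc.le (hξ b').1 (hfd _ (hξ b').1) (hld _ (hξ b').1)
      (hξ b').2
    have huniq := fun {b x} => eq_minimizer (b := b) (x := x) hX (hf.add hl)
      (fun y hy => (hfd y hy).add (hld y hy)) hc
    rw [hbb'] at hm
    have : minimizer X f c b = minimizer X f c b' :=
      (huniq (hξ b).1 hm).trans (huniq (hξ b').1 hm').symm
    rwa [this, sub_left_inj] at hbb'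
  rw [← one_mul (∫⁻ b, u b), ← ENNReal.ofReal_one]
  refine lintegral_comp_le_of_one_le_mul_det zero_le_one
    (s := {b | DifferentiableAt ℝ (minimizer X f c) b})
    (measurableSet_of_differentiableAt ℝ _) hK.ae_differentiableAt hinj
    (Φ' := fun b => ContinuousLinearMap.id ℝ (Vec d)
      - (fderiv ℝ (gradient l) (minimizer X f c b)).comp (fderiv ℝ (minimizer X f c) b))
    (fun b hb => ?_)
    (fun b hb => by
      rw [one_mul]
      exact one_le_det_fderiv_shift hl h2 hrank (fun b => (hξ b).1)
        (inner_minimizer_sub_nonpos hX hf hfd hc.le) hb) u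
  exact (hasFDerivAt_id b).sub ((h2 _ (hξ b).1).2.hasFDerivAt.comp b hb.hasFDerivAt)

/-- The coupling behind stability: a shift `Φ` of the noise by at most `β` that does not decrease
volume, such that the loss of the move is at most the increment of the potential at the shifted
noise. Without a regularizer the minimizer need not be unique, but then `γ = 0`, the gradient of
the loss is constant on `X`, and `Φ` is a translation. -/
lemma exists_noise_shift {d : ℕ} {X : Set (Vec d)} {f l : Vec d → ℝ} {c D β : ℝ}
    (hX : IsActionSet X D) (hf : ConvexOn ℝ X f) (hfd : ∀ y ∈ X, DifferentiableAt ℝ f y)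
    (hl : ConvexOn ℝ X l) (h2 : ∀ x ∈ X, TwiceDifferentiableAt l x)
    (hrank : ∀ x ∈ X, Module.finrank ℝ (LinearMap.range (hessian l x)) ≤ 1)
    (hβ : ∀ x ∈ X, ‖gradient l x‖ ≤ β) (hc : 0 ≤ c)
    (heig : c = 0 → ∀ x ∈ X, ∀ μ : ℝ, Module.End.HasEigenvalue (hessian l x) μ → μ ≤ 0) :
    ∃ Φ : Vec d → Vec d, Measurable Φ ∧ (∀ b, ‖Φ b - b‖ ≤ β) ∧
      (∀ b, ∀ x ∈ X, IsMinOn (tilted f c b) X x →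
        l x ≤ potential X (f + l) c (Φ b) - potential X f c (Φ b)) ∧
      ∀ u : Vec d → ℝ≥0∞, ∫⁻ b, u (Φ b) ≤ ∫⁻ b, u b := by
  have hld : ∀ z ∈ X, DifferentiableAt ℝ l z := fun z hz => (h2 z hz).1.self_of_nhds
  rcases hc.eq_or_lt with hc0 | hc0
  · obtain ⟨x₀, hx₀⟩ := hX.nonempty
    refine ⟨fun b => b - gradient l x₀, measurable_id.sub_const _, fun b => ?_, fun b x hx hm => ?_,
      fun u => (lintegral_sub_right_eq_self u _).le⟩
    · simpa using hβ x₀ hx₀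
    · rw [gradient_eq_of_eigenvalue_nonpos hl h2 (heig hc0.symm) hrank hx₀ hx]
      exact loss_le_potential_sub hX hf hl hc hx hfd (hld x hx) hm
  · have hξ := minimizer_spec hX hfd c
    obtain ⟨K, hK⟩ := exists_lipschitzWith_minimizer hX hf hfd hc0
    have hcont : Continuous fun b => b - gradient l (minimizer X f c b) :=
      continuous_id.sub (continuous_iff_continuousAt.2 fun b =>
        ((h2 _ (hξ b).1).2.continuousAt.comp hK.continuous.continuousAt))
    refine ⟨fun b => b - gradient l (minimizer X f c b), hcont.measurable, fun b => ?_,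
      fun b x hx hm => ?_, lintegral_comp_sub_gradient_le hX hf hfd hl h2 hrank hc0⟩
    · simpa using hβ _ (hξ b).1
    · rw [eq_minimizer hX hf hfd hc0 hx hm]
      exact loss_le_potential_sub hX hf hl hc (hξ b).1 hfd (hld _ (hξ b).1) (hξ b).2

/-! ### The Gamma perturbation -/

lemma lintegral_gammaNoise {d : ℕ} (ε β : ℝ) (u : Vec d → ℝ≥0∞) :
    ∫⁻ b, u b ∂gammaNoise d ε β =
      (volume.withDensity (fun b : Vec d => ENNReal.ofReal (Real.exp (-(ε * ‖b‖) / (2 * β))))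
        univ)⁻¹ * ∫⁻ b, ENNReal.ofReal (Real.exp (-(ε * ‖b‖) / (2 * β))) * u b := by
  have hm : Measurable fun b : Vec d => ENNReal.ofReal (Real.exp (-(ε * ‖b‖) / (2 * β))) := by
    fun_prop
  rw [gammaNoise, lintegral_smul_measure, smul_eq_mul,
    lintegral_withDensity_eq_lintegral_mul_non_measurable _ hm (by simp)]
  rfl

/-- Shifting the noise by at most `β` changes the density of the Gamma perturbation by a factor
of at most `exp (ε / 2)`. -/
lemma lintegral_comp_gammaNoise_le {d : ℕ} {ε β : ℝ} (hε : 0 ≤ ε) (hβ : 0 < β)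
    {Φ : Vec d → Vec d} (hΦ : ∀ b, ‖Φ b - b‖ ≤ β)
    (hvol : ∀ u : Vec d → ℝ≥0∞, ∫⁻ b, u (Φ b) ≤ ∫⁻ b, u b) (u : Vec d → ℝ≥0∞) :
    ∫⁻ b, u (Φ b) ∂gammaNoise d ε β
      ≤ ENNReal.ofReal (Real.exp (ε / 2)) * ∫⁻ b, u b ∂gammaNoise d ε β := by
  rw [lintegral_gammaNoise, lintegral_gammaNoise, ← mul_assoc, mul_comm (ENNReal.ofReal _),
    mul_assoc]
  gcongr
  calc ∫⁻ b, ENNReal.ofReal (Real.exp (-(ε * ‖b‖) / (2 * β))) * u (Φ b)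
      ≤ ∫⁻ b, ENNReal.ofReal (Real.exp (ε / 2)) *
          (ENNReal.ofReal (Real.exp (-(ε * ‖Φ b‖) / (2 * β))) * u (Φ b)) := by
        refine lintegral_mono fun b => ?_
        rw [← mul_assoc, ← ENNReal.ofReal_mul (Real.exp_pos _).le, ← Real.exp_add]
        gcongr
        have h : ‖Φ b‖ ≤ ‖b‖ + β := by
          have := norm_add_le (Φ b - b) b
          rw [sub_add_cancel] at this
          linarith [hΦ b]
        rw [div_add_div _ _ two_ne_zero (by positivity), div_le_div_iff₀ (by positivity)
          (by positivity)]
        nlinarith [mul_le_mul_of_nonneg_left h hε]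
    _ = ENNReal.ofReal (Real.exp (ε / 2)) *
          ∫⁻ b, ENNReal.ofReal (Real.exp (-(ε * ‖Φ b‖) / (2 * β))) * u (Φ b) :=
        lintegral_const_mul' _ _ ENNReal.ofReal_ne_top
    _ ≤ _ := mul_le_mul_right
        (hvol fun b => ENNReal.ofReal (Real.exp (-(ε * ‖b‖) / (2 * β))) * u b) _

/-- Integrability and first moment of the radial density `exp (-a ‖b‖)`. -/
lemma integral_norm_mul_exp_neg_mul_norm {d : ℕ} (hd : 0 < d) {a : ℝ} (ha : 0 < a) :
    Integrable (fun b : Vec d => Real.exp (-(a * ‖b‖))) ∧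
    Integrable (fun b : Vec d => ‖b‖ * Real.exp (-(a * ‖b‖))) ∧
    ∫ b : Vec d, ‖b‖ * Real.exp (-(a * ‖b‖)) = d / a * ∫ b : Vec d, Real.exp (-(a * ‖b‖)) := by
  have : Nonempty (Fin d) := ⟨⟨0, hd⟩⟩
  have hrpow : ∀ n : ℕ, ∫ y in Ioi (0 : ℝ), y ^ n * Real.exp (-(a * y))
      = (1 / a) ^ (n + 1) * (n.factorial : ℝ) := by
    intro n
    have h := Real.integral_rpow_mul_exp_neg_mul_Ioi (a := n + 1) (r := a) (by positivity) ha
    rw [add_sub_cancel_right, Real.Gamma_nat_eq_factorial, ← Nat.cast_add_one,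
      Real.rpow_natCast] at h
    simpa only [Real.rpow_natCast] using h
  have hint : ∀ n : ℕ, IntegrableOn (fun y : ℝ => y ^ n * Real.exp (-(a * y))) (Ioi 0) := by
    intro n
    by_contra h
    have h0 := integral_undef h
    rw [hrpow n] at h0
    exact absurd h0 (by positivity)
  have hdim : Module.finrank ℝ (Vec d) = d := by simp
  have hshift : ∀ y : ℝ, y ^ (d - 1) • (y * Real.exp (-(a * y))) = y ^ d * Real.exp (-(a * y)) := by
    intro y
    rw [smul_eq_mul, ← mul_assoc, ← pow_succ, Nat.sub_add_cancel hd]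
  refine ⟨?_, ?_, ?_⟩
  · rw [integrable_fun_norm_addHaar volume (f := fun y : ℝ => Real.exp (-(a * y))), hdim]
    exact hint (d - 1)
  · rw [integrable_fun_norm_addHaar volume (f := fun y : ℝ => y * Real.exp (-(a * y))), hdim]
    simp only [hshift]
    exact hint d
  · rw [integral_fun_norm_addHaar volume (fun y : ℝ => y * Real.exp (-(a * y))),
      integral_fun_norm_addHaar volume (fun y : ℝ => Real.exp (-(a * y))), hdim]
    simp only [hshift, hrpow d]
    simp only [smul_eq_mul, hrpow (d - 1), nsmul_eq_mul]
    obtain ⟨k, rfl⟩ := Nat.exists_eq_add_of_lt hd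
    simp only [Nat.factorial_succ, zero_add, Nat.add_sub_cancel]
    push_cast
    rw [pow_succ (1 / a) (k + 1)]
    field_simp

lemma gammaNoise_moment {d : ℕ} (hd : 0 < d) {ε β : ℝ} (hε : 0 < ε) (hβ : 0 < β) :
    IsProbabilityMeasure (gammaNoise d ε β) ∧ Integrable (fun b => ‖b‖) (gammaNoise d ε β) ∧
      ∫ b, ‖b‖ ∂gammaNoise d ε β = 2 * β * d / ε := by
  have ha : 0 < ε / (2 * β) := by positivity
  obtain ⟨h0, h1, h2⟩ := integral_norm_mul_exp_neg_mul_norm hd ha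
  have hexp : ∀ b : Vec d, -(ε * ‖b‖) / (2 * β) = -(ε / (2 * β) * ‖b‖) := fun b => by ring
  have hpos : 0 < ∫ b : Vec d, Real.exp (-(ε / (2 * β) * ‖b‖)) := integral_exp_pos h0
  set Z := ∫ b : Vec d, Real.exp (-(ε / (2 * β) * ‖b‖)) with hZ
  set m : Measure (Vec d) := volume.withDensity
    (fun b => ENNReal.ofReal (Real.exp (-(ε / (2 * β) * ‖b‖)))) with hm
  have hgm : gammaNoise d ε β = (m univ)⁻¹ • m := by simp only [gammaNoise, hexp, hm]
  have huniv : m univ = ENNReal.ofReal Z := by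
    rw [hm, withDensity_apply _ MeasurableSet.univ, Measure.restrict_univ, hZ,
      ofReal_integral_eq_lintegral_ofReal h0 (ae_of_all _ fun b => (Real.exp_pos _).le)]
  have hne : (m univ)⁻¹ ≠ ∞ := by simp [huniv, hpos]
  have hmeas : Measurable fun b : Vec d => ENNReal.ofReal (Real.exp (-(ε / (2 * β) * ‖b‖))) := by
    fun_prop
  have hsmul : ∀ b : Vec d, (ENNReal.ofReal (Real.exp (-(ε / (2 * β) * ‖b‖)))).toReal • ‖b‖
      = ‖b‖ * Real.exp (-(ε / (2 * β) * ‖b‖)) := fun b => by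
    rw [ENNReal.toReal_ofReal (Real.exp_pos _).le, smul_eq_mul, mul_comm]
  refine ⟨⟨?_⟩, ?_, ?_⟩
  · rw [hgm, Measure.smul_apply, smul_eq_mul]
    exact ENNReal.inv_mul_cancel (by simp [huniv, hpos]) (by simp [huniv])
  · rw [hgm]
    refine Integrable.smul_measure ?_ hne
    rw [hm, integrable_withDensity_iff_integrable_smul' hmeas (by simp)]
    simpa only [hsmul] using h1
  · rw [hgm, integral_smul_measure, hm,
      integral_withDensity_eq_integral_toReal_smul hmeas (by simp), ← hm]
    simp only [hsmul]
    rw [h2, huniv, ENNReal.toReal_inv, ENNReal.toReal_ofReal hpos.le, smul_eq_mul]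
    field_simp

/-! ### From stability to regret -/

/-- The total loss of the rounds before round `n`. -/
noncomputable def lossBefore {d T : ℕ} (loss : Fin T → Vec d → ℝ) (n : ℕ) (x : Vec d) : ℝ :=
  ∑ s with s.val < n, loss s x

lemma perturbedObjective_eq_tilted {d T : ℕ} (loss : Fin T → Vec d → ℝ) (γ ε : ℝ)
    (t : Fin T) (b : Vec d) :
    perturbedObjective loss γ ε t b = tilted (lossBefore loss t) (γ / ε) b := by
  funext x
  have : Finset.Iio t = Finset.univ.filter (fun s : Fin T => s.val < t.val) := by
    ext s; simp
  simp only [perturbedObjective, tilted, lossBefore, this]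

lemma lossBefore_succ {d T : ℕ} (loss : Fin T → Vec d → ℝ) (t : Fin T) :
    lossBefore loss (t + 1) = lossBefore loss t + loss t := by
  funext x
  have : Finset.univ.filter (fun s : Fin T => s.val < t.val + 1)
      = insert t (Finset.univ.filter (fun s : Fin T => s.val < t.val)) := by
    ext s; simp [Fin.ext_iff]; omega
  simp only [lossBefore, this, Pi.add_apply]
  rw [Finset.sum_insert (by simp), add_comm]

lemma IsLossSequence.convexOn_lossBefore {d T : ℕ} {X : Set (Vec d)} {loss : Fin T → Vec d → ℝ}
    {B β γ : ℝ} (h : IsLossSequence X loss B β γ) (hX : Convex ℝ X) (n : ℕ) :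
    ConvexOn ℝ X (lossBefore loss n) := by
  have := Finset.sum_induction (s := Finset.univ.filter (fun s : Fin T => s.val < n)) loss
    (ConvexOn ℝ X) (fun _ _ => ConvexOn.add) (convexOn_const 0 hX) fun t _ => h.convexOn t
  convert this using 1
  funext x
  simp [lossBefore]

lemma IsLossSequence.differentiableAt {d T : ℕ} {X : Set (Vec d)} {loss : Fin T → Vec d → ℝ}
    {B β γ : ℝ} (h : IsLossSequence X loss B β γ) (t : Fin T) {x : Vec d} (hx : x ∈ X) :
    DifferentiableAt ℝ (loss t) x :=
  (h.twiceDifferentiable t x hx).1.self_of_nhds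

lemma IsLossSequence.differentiableAt_lossBefore {d T : ℕ} {X : Set (Vec d)}
    {loss : Fin T → Vec d → ℝ} {B β γ : ℝ} (h : IsLossSequence X loss B β γ) (n : ℕ) {x : Vec d}
    (hx : x ∈ X) : DifferentiableAt ℝ (lossBefore loss n) x :=
  DifferentiableAt.fun_sum fun t _ => h.differentiableAt t hx

/-- The regularized potential rises by at most the best cumulative loss, plus the cost of the
regularizer and of the noise. -/
lemma potential_sub_le {d T : ℕ} {X : Set (Vec d)} {loss : Fin T → Vec d → ℝ} {D B β γ L c : ℝ}
    (hX : IsActionSet X D) (h : IsLossSequence X loss B β γ) (hL : IsBestLoss X loss L)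
    (hc : 0 ≤ c) (b : Vec d) :
    potential X (lossBefore loss T) c b - potential X (lossBefore loss 0) c b
      ≤ L + c * D ^ 2 + 2 * D * ‖b‖ := by
  obtain ⟨z, hz, hzL⟩ := hL.1
  have h1 := potential_le hX (fun y hy => h.differentiableAt_lossBefore T hy) c b hz
  obtain ⟨x, hx, hm⟩ := exists_isMinOn_tilted hX
    (fun y hy => h.differentiableAt_lossBefore 0 hy) c b
  rw [potential_eq_of_isMinOn hx hm]
  have hT : lossBefore loss T z = L := by simpa [lossBefore] using hzL
  have h0 : lossBefore loss 0 x = 0 := by simp [lossBefore]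
  have h2 : (inner ℝ b z : ℝ) ≤ ‖b‖ * D :=
    (real_inner_le_norm _ _).trans (mul_le_mul_of_nonneg_left (hX.norm_le z hz) (norm_nonneg _))
  have h3 : -(‖b‖ * D) ≤ (inner ℝ b x : ℝ) :=
    (neg_le_neg (mul_le_mul_of_nonneg_left (hX.norm_le x hx) (norm_nonneg _))).trans
      (neg_le_of_abs_le (abs_real_inner_le_norm _ _))
  have h4 : c * ‖z‖ ^ 2 ≤ c * D ^ 2 := by
    have := hX.norm_le z hz
    gcongr
  have h5 : 0 ≤ c * ‖x‖ ^ 2 := by positivity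
  simp only [tilted, hT, h0] at *
  linarith

/-- The increase of the potential in round `t`. -/
noncomputable def potentialIncrement {d T : ℕ} (X : Set (Vec d)) (loss : Fin T → Vec d → ℝ)
    (c : ℝ) (n : ℕ) (b : Vec d) : ℝ :=
  potential X (lossBefore loss (n + 1)) c b - potential X (lossBefore loss n) c b

lemma potentialIncrement_mem_Icc {d T : ℕ} {X : Set (Vec d)} {loss : Fin T → Vec d → ℝ}
    {D B β γ c : ℝ} (hX : IsActionSet X D) (h : IsLossSequence X loss B β γ) (t : Fin T)
    (b : Vec d) : potentialIncrement X loss c t b ∈ Icc 0 B := by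
  rw [potentialIncrement, lossBefore_succ]
  exact potential_add_mem_Icc hX (fun y hy => h.differentiableAt_lossBefore _ hy)
    (fun y hy => h.differentiableAt t hy) (h.nonneg t) (h.le_bound t) b

lemma continuous_potentialIncrement {d T : ℕ} {X : Set (Vec d)} {loss : Fin T → Vec d → ℝ}
    {D B β γ : ℝ} (hX : IsActionSet X D) (h : IsLossSequence X loss B β γ) (c : ℝ) (n : ℕ) :
    Continuous (potentialIncrement X loss c n) :=
  (continuous_potential hX (fun _ hy => h.differentiableAt_lossBefore _ hy) _).sub
    (continuous_potential hX (fun _ hy => h.differentiableAt_lossBefore _ hy) _)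

lemma integrable_potentialIncrement {d T : ℕ} {X : Set (Vec d)} {loss : Fin T → Vec d → ℝ}
    {D B β γ : ℝ} (hX : IsActionSet X D) (h : IsLossSequence X loss B β γ) (c : ℝ) (t : Fin T)
    (ν : Measure (Vec d)) [IsFiniteMeasure ν] : Integrable (potentialIncrement X loss c t) ν :=
  Integrable.of_bound (continuous_potentialIncrement hX h c t).aestronglyMeasurable B
    (ae_of_all _ fun b => by
      rw [Real.norm_of_nonneg (potentialIncrement_mem_Icc hX h t b).1]
      exact (potentialIncrement_mem_Icc hX h t b).2)

lemma sum_integral_potentialIncrement_le {d T : ℕ} {X : Set (Vec d)} {loss : Fin T → Vec d → ℝ}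
    {D B β γ L c : ℝ} (hX : IsActionSet X D) (h : IsLossSequence X loss B β γ)
    (hL : IsBestLoss X loss L) (hc : 0 ≤ c)
    {ν : Measure (Vec d)} [IsProbabilityMeasure ν] (hν : Integrable (fun b => ‖b‖) ν) :
    ∑ t : Fin T, ∫ b, potentialIncrement X loss c t b ∂ν ≤ L + c * D ^ 2 + 2 * D * ∫ b, ‖b‖ ∂ν := by
  have hint : ∀ t : Fin T, Integrable (potentialIncrement X loss c t) ν := fun t =>
    integrable_potentialIncrement hX h c t ν
  have htel : ∀ b, ∑ t : Fin T, potentialIncrement X loss c t b =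
      potential X (lossBefore loss T) c b - potential X (lossBefore loss 0) c b := by
    intro b
    rw [Fin.sum_univ_eq_sum_range (fun n => potentialIncrement X loss c n b) T]
    exact Finset.sum_range_sub (fun n => potential X (lossBefore loss n) c b) T
  calc ∑ t : Fin T, ∫ b, potentialIncrement X loss c t b ∂ν
      = ∫ b, ∑ t : Fin T, potentialIncrement X loss c t b ∂ν :=
        (integral_finsetSum _ fun t _ => hint t).symm
    _ ≤ ∫ b, (L + c * D ^ 2 + 2 * D * ‖b‖) ∂ν := by
        refine integral_mono (integrable_finsetSum _ fun t _ => hint t)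
          ((integrable_const _).add (hν.const_mul _)) fun b => ?_
        simp only [htel]
        exact potential_sub_le hX h hL hc b
    _ = _ := by
        rw [integral_add (integrable_const _) (hν.const_mul _), integral_const_mul]
        simp

/-- If shifts of the noise that do not decrease volume cost at most a factor `κ`, then so does
"being one round behind", and the expected total loss is bounded by the rise of the potential. -/
lemma integral_sum_loss_le {d T : ℕ} {X : Set (Vec d)} {loss : Fin T → Vec d → ℝ}
    {D B β γ L ε κ : ℝ} (hX : IsActionSet X D) (h : IsLossSequence X loss B β γ)
    (hL : IsBestLoss X loss L) (hγ : 0 ≤ γ) (hε : 0 < ε) (hκ : 0 ≤ κ)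
    {ν : Measure (Vec d)} [IsProbabilityMeasure ν] (hν : Integrable (fun b => ‖b‖) ν)
    (hstab : ∀ Φ : Vec d → Vec d, (∀ b, ‖Φ b - b‖ ≤ β) →
      (∀ u : Vec d → ℝ≥0∞, ∫⁻ b, u (Φ b) ≤ ∫⁻ b, u b) →
      ∀ u : Vec d → ℝ≥0∞, ∫⁻ b, u (Φ b) ∂ν ≤ ENNReal.ofReal κ * ∫⁻ b, u b ∂ν)
    {Ω : Type*} [MeasurableSpace Ω] {P : Measure Ω} [IsProbabilityMeasure P]
    {b x : Fin T → Ω → Vec d} (hrun : IsObjPertRun P X loss γ ε ν b x) :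
    ∫ ω, ∑ t, loss t (x t ω) ∂P ≤ κ * (L + γ / ε * D ^ 2 + 2 * D * ∫ b, ‖b‖ ∂ν) := by
  have hc : 0 ≤ γ / ε := by positivity
  set ψ : ℕ → Vec d → ℝ := potentialIncrement X loss (γ / ε)
  have hψmem : ∀ (t : Fin T) b, ψ t b ∈ Icc 0 B := potentialIncrement_mem_Icc hX h
  have hψcont : ∀ n, Continuous (ψ n) := continuous_potentialIncrement hX h _
  have hψint : ∀ t : Fin T, Integrable (ψ t) ν := fun t => integrable_potentialIncrement hX h _ t ν
  have hshift : ∀ t : Fin T, ∃ Φ : Vec d → Vec d, Measurable Φ ∧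
      (∀ ω, loss t (x t ω) ≤ ψ t (Φ (b t ω))) ∧ ∫ b, ψ t (Φ b) ∂ν ≤ κ * ∫ b, ψ t b ∂ν := by
    intro t
    obtain ⟨Φ, hΦm, hΦβ, hΦ, hvol⟩ := exists_noise_shift hX (h.convexOn_lossBefore hX.convex t)
      (fun _ hy => h.differentiableAt_lossBefore _ hy) (h.convexOn t) (h.twiceDifferentiable t)
      (h.rank_le_one t) (h.norm_gradient_le t) hc (fun h0 z hz μ hμ => by
        have : γ = 0 := by
          rcases div_eq_zero_iff.1 h0 with h0 | h0
          · exact h0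
          · exact absurd h0 hε.ne'
        exact this ▸ h.eigenvalue_le t z hz μ hμ)
    refine ⟨Φ, hΦm, fun ω => ?_, ?_⟩
    · have hm := hrun.move_isMin t ω
      rw [perturbedObjective_eq_tilted] at hm
      have := hΦ _ _ (hrun.move_mem t ω) hm
      rw [← lossBefore_succ] at this
      exact this
    · have hs := hstab Φ hΦβ hvol fun b => ENNReal.ofReal (ψ t b)
      rw [← ofReal_integral_eq_lintegral_ofReal (hψint t) (ae_of_all _ fun b => (hψmem t b).1),
        ← ENNReal.ofReal_mul hκ,
        ← ofReal_integral_eq_lintegral_ofReal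
          (f := fun b => ψ t (Φ b))
          (Integrable.of_bound ((hψcont t).measurable.comp hΦm).aestronglyMeasurable B
            (ae_of_all _ fun b => by
              rw [Real.norm_of_nonneg (hψmem t _).1]; exact (hψmem t _).2))
          (ae_of_all _ fun b => (hψmem t _).1)] at hs
      exact (ENNReal.ofReal_le_ofReal_iff
        (mul_nonneg hκ (integral_nonneg fun b => (hψmem t b).1))).1 hs
  choose Φ hΦm hΦ hΦν using hshift
  have hint : ∀ t : Fin T, Integrable (fun ω => ψ t (Φ t (b t ω))) P := fun t =>
    Integrable.of_bound ((hψcont t).measurable.comp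
        ((hΦm t).comp (hrun.measurable_noise t))).aestronglyMeasurable B
      (ae_of_all _ fun ω => by
        rw [Real.norm_of_nonneg (hψmem t _).1]; exact (hψmem t _).2)
  have hpull : ∀ t : Fin T, ∫ ω, ψ t (Φ t (b t ω)) ∂P = ∫ b, ψ t (Φ t b) ∂ν := by
    intro t
    rw [← hrun.noise_law t]
    exact (integral_map (hrun.measurable_noise t).aemeasurable
      ((hψcont t).measurable.comp (hΦm t)).aestronglyMeasurable).symm
  calc ∫ ω, ∑ t, loss t (x t ω) ∂P
      ≤ ∫ ω, ∑ t : Fin T, ψ t (Φ t (b t ω)) ∂P := integral_mono_of_nonneg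
        (ae_of_all _ fun ω => Finset.sum_nonneg fun t _ => h.nonneg t _ (hrun.move_mem t ω))
        (integrable_finsetSum _ fun t _ => hint t)
        (ae_of_all _ fun ω => Finset.sum_le_sum fun t _ => hΦ t ω)
    _ = ∑ t : Fin T, ∫ b, ψ t (Φ t b) ∂ν := by
        rw [integral_finsetSum _ fun t _ => hint t]
        exact Finset.sum_congr rfl fun t _ => hpull t
    _ ≤ ∑ t : Fin T, κ * ∫ b, ψ t b ∂ν := Finset.sum_le_sum fun t _ => hΦν t
    _ = κ * ∑ t : Fin T, ∫ b, ψ t b ∂ν := Finset.mul_sum .. |>.symm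
    _ ≤ _ := mul_le_mul_of_nonneg_left (sum_integral_potentialIncrement_le hX h hL hc hν) hκ

/-- On a one-point action set there is no regret. -/
lemma expectedRegret_eq_zero {d T : ℕ} {X : Set (Vec d)} (hX : X.Subsingleton)
    {loss : Fin T → Vec d → ℝ} {γ L ε : ℝ} (hL : IsBestLoss X loss L) {ν : Measure (Vec d)}
    {Ω : Type*} [MeasurableSpace Ω] {P : Measure Ω} [IsProbabilityMeasure P]
    {b x : Fin T → Ω → Vec d} (hrun : IsObjPertRun P X loss γ ε ν b x) :
    expectedRegret P loss x L = 0 := by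
  obtain ⟨z, hz, hzL⟩ := hL.1
  have h : ∀ ω, ∑ t, loss t (x t ω) = L := fun ω => by
    rw [← hzL]
    exact Finset.sum_congr rfl fun t _ => by rw [hX (hrun.move_mem t ω) hz]
  simp [expectedRegret, h]

lemma IsActionSet.subsingleton {d : ℕ} {X : Set (Vec d)} {D : ℝ} (hX : IsActionSet X D)
    (h : d = 0 ∨ D = 0) : X.Subsingleton := by
  rcases h with rfl | rfl
  · exact subsingleton_of_subsingleton
  · intro x hx y hy
    rw [norm_le_zero_iff.1 (hX.norm_le x hx), norm_le_zero_iff.1 (hX.norm_le y hy)]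

lemma IsActionSet.nonneg {d : ℕ} {X : Set (Vec d)} {D : ℝ} (hX : IsActionSet X D) : 0 ≤ D := by
  obtain ⟨x, hx⟩ := hX.nonempty
  exact (norm_nonneg x).trans (hX.norm_le x hx)

lemma IsBestLoss.nonneg {d T : ℕ} {X : Set (Vec d)} {loss : Fin T → Vec d → ℝ} {B β γ L : ℝ}
    (hL : IsBestLoss X loss L) (h : IsLossSequence X loss B β γ) : 0 ≤ L := by
  obtain ⟨z, hz, hzL⟩ := hL.1
  rw [← hzL]
  exact Finset.sum_nonneg fun t _ => h.nonneg t z hz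

/-- Regret under the Gamma perturbation, for every `ε ≤ 1`. -/
lemma expectedRegret_gammaNoise_le {d T : ℕ} {X : Set (Vec d)} {loss : Fin T → Vec d → ℝ}
    {D B β γ L ε : ℝ} (hX : IsActionSet X D) (h : IsLossSequence X loss B β γ)
    (hL : IsBestLoss X loss L) (hd : 0 < d) (hβ : 0 < β) (hγ : 0 ≤ γ) (hε : 0 < ε) (hε1 : ε ≤ 1)
    {Ω : Type*} [MeasurableSpace Ω] {P : Measure Ω} [IsProbabilityMeasure P]
    {b x : Fin T → Ω → Vec d} (hrun : IsObjPertRun P X loss γ ε (gammaNoise d ε β) b x) :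
    expectedRegret P loss x L ≤ ε * L + 8 * ((γ * D ^ 2 + β * d * D) / ε) := by
  obtain ⟨hprob, hint, hmom⟩ := gammaNoise_moment (d := d) hd hε hβ
  have hD := hX.nonneg
  have hL0 := hL.nonneg h
  have hmain := integral_sum_loss_le hX h hL hγ hε (Real.exp_pos (ε / 2)).le hint
    (fun Φ hΦ hvol => lintegral_comp_gammaNoise_le hε.le hβ hΦ hvol) hrun
  have hexp : Real.exp (ε / 2) ≤ 1 + ε := by
    have h1 := Real.exp_bound_div_one_sub_of_interval (x := ε / 2) (by positivity) (by linarith)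
    refine h1.trans ?_
    rw [div_le_iff₀ (by linarith)]
    nlinarith
  have hA : L + γ / ε * D ^ 2 + 2 * D * (2 * β * d / ε)
      ≤ L + 4 * ((γ * D ^ 2 + β * d * D) / ε) := by
    have : 0 ≤ γ * D ^ 2 / ε := by positivity
    have e : 4 * ((γ * D ^ 2 + β * d * D) / ε)
        = γ / ε * D ^ 2 + 2 * D * (2 * β * d / ε) + 3 * (γ * D ^ 2 / ε) := by ring
    linarith
  rw [hmom] at hmain
  have hA0 : 0 ≤ (γ * D ^ 2 + β * d * D) / ε := by positivity
  have h2 := hmain.trans (mul_le_mul hexp hA (by positivity) (by positivity))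
  rw [expectedRegret]
  nlinarith [mul_le_mul_of_nonneg_right hε1 hA0]

/-- The parameter `√(A / L)` balances `ε L` and `A / ε`; it is replaced by `1` when it exceeds
`1` or degenerates. -/
noncomputable def balancedParameter (A L : ℝ) : ℝ := if 0 < A ∧ A ≤ L then √(A / L) else 1

lemma balancedParameter_pos (A L : ℝ) : 0 < balancedParameter A L := by
  rw [balancedParameter]
  split_ifs with h
  · exact Real.sqrt_pos.2 (div_pos h.1 (h.1.trans_le h.2))
  · exact one_pos

lemma balancedParameter_le_one (A L : ℝ) : balancedParameter A L ≤ 1 := by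
  rw [balancedParameter]
  split_ifs with h
  · exact Real.sqrt_le_one.2 ((div_le_one (h.1.trans_le h.2)).2 h.2)
  · exact le_rfl

lemma balancedParameter_mul_add_le {A L k : ℝ} (hA : 0 < A) (hAL : A ≤ L) :
    balancedParameter A L * L + k * (A / balancedParameter A L) = (1 + k) * √(L * A) := by
  have hL : 0 < L := hA.trans_le hAL
  have hs : 0 < √A := Real.sqrt_pos.2 hA
  have hs' : 0 < √L := Real.sqrt_pos.2 hL
  rw [balancedParameter, if_pos ⟨hA, hAL⟩, Real.sqrt_div' _ hL.le, Real.sqrt_mul hL.le]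
  have h1 : √A / √L * L = √L * √A := by
    nth_rewrite 2 [← Real.mul_self_sqrt hL.le]
    field_simp
  have h2 : A / (√A / √L) = √L * √A := by
    nth_rewrite 1 [← Real.mul_self_sqrt hA.le]
    field_simp
  rw [h1, h2]
  ring

/-- First-order regret under the Gamma perturbation. -/
lemma regret_gammaNoise : ∃ C : ℝ, 0 < C ∧ ∀ (d : ℕ) (D β γ L : ℝ), 0 < β → 0 ≤ γ →
      ∃ ε : ℝ, 0 < ε ∧
        ∀ (T : ℕ) (B : ℝ) (X : Set (Vec d)) (loss : Fin T → Vec d → ℝ),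
          IsActionSet X D → IsLossSequence X loss B β γ → IsBestLoss X loss L →
          ∀ (Ω : Type*) [MeasurableSpace Ω] (P : MeasureTheory.Measure Ω)
            [MeasureTheory.IsProbabilityMeasure P] (b x : Fin T → Ω → Vec d),
            IsObjPertRun P X loss γ ε (gammaNoise d ε β) b x →
            (expectedRegret P loss x L
                ≤ C * (√(L * (γ * D ^ 2 + β * d * D)) + (γ * D ^ 2 + β * d * D))) ∧
            (γ * D ^ 2 + β * d * D ≤ L →
              expectedRegret P loss x L ≤ C * √(L * (γ * D ^ 2 + β * d * D))) := by
  refine ⟨9, by norm_num, fun d D β γ L hβ hγ => ?_⟩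
  set A := γ * D ^ 2 + β * d * D with hA
  refine ⟨balancedParameter A L, balancedParameter_pos A L, ?_⟩
  intro T B X loss hX h hL Ω _ P _ b x hrun
  have hD := hX.nonneg
  have hL0 := hL.nonneg h
  have hA0 : 0 ≤ A := by positivity
  have hs := Real.sqrt_nonneg (L * A)
  by_cases hdeg : d = 0 ∨ D = 0
  · rw [expectedRegret_eq_zero (hX.subsingleton hdeg) hL hrun]
    exact ⟨by positivity, fun _ => by positivity⟩
  push Not at hdeg
  have hd : 0 < d := Nat.pos_of_ne_zero hdeg.1
  have hApos : 0 < A := by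
    have : 0 < D := lt_of_le_of_ne hD (Ne.symm hdeg.2)
    positivity
  have hreg := expectedRegret_gammaNoise_le hX h hL hd hβ hγ (balancedParameter_pos A L)
    (balancedParameter_le_one A L) hrun
  rw [← hA] at hreg
  have hbig : A ≤ L → expectedRegret P loss x L ≤ 9 * √(L * A) := fun hAL => by
    rw [balancedParameter_mul_add_le hApos hAL] at hreg
    linarith
  refine ⟨?_, hbig⟩
  rcases le_or_gt A L with hAL | hAL
  · linarith [hbig hAL]
  · rw [balancedParameter, if_neg (fun h => hAL.not_ge h.2)] at hreg
    linarith

/-! ### The Gaussian perturbation -/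

lemma posSemidef_smul_one {d : ℕ} {v : ℝ} (hv : 0 ≤ v) :
    (v • (1 : Matrix (Fin d) (Fin d) ℝ)).PosSemidef :=
  Matrix.PosSemidef.one.smul hv

/-- The centred isotropic Gaussian distribution has the expected Lebesgue density, up to a
normalizing constant; both sides have the same characteristic function. -/
lemma exists_lintegral_multivariateGaussian_eq {d : ℕ} {v : ℝ} (hv : 0 < v) :
    ∃ Z : ℝ≥0∞, ∀ u : Vec d → ℝ≥0∞,
      ∫⁻ b, u b ∂ProbabilityTheory.multivariateGaussian 0 (v • (1 : Matrix (Fin d) (Fin d) ℝ))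
        = Z * ∫⁻ b, ENNReal.ofReal (Real.exp (-‖b‖ ^ 2 / (2 * v))) * u b := by
  have hm : Measurable fun b : Vec d => ENNReal.ofReal (Real.exp (-‖b‖ ^ 2 / (2 * v))) := by
    fun_prop
  have hre : 0 < (1 / (2 * v) : ℝ) := by positivity
  have hexp : ∀ b : Vec d, -‖b‖ ^ 2 / (2 * v) = -(1 / (2 * v)) * ‖b‖ ^ 2 := fun b => by ring
  have hZ : 0 < ∫ b : Vec d, Real.exp (-‖b‖ ^ 2 / (2 * v)) := by
    simp_rw [hexp]
    rw [GaussianFourier.integral_rexp_neg_mul_sq_norm hre]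
    positivity
  have hint : Integrable fun b : Vec d => Real.exp (-‖b‖ ^ 2 / (2 * v)) := by
    by_contra h
    rw [integral_undef h] at hZ
    exact hZ.false
  set Z := ∫ b : Vec d, Real.exp (-‖b‖ ^ 2 / (2 * v)) with hZdef
  set m : Measure (Vec d) := volume.withDensity
    fun b => ENNReal.ofReal (Real.exp (-‖b‖ ^ 2 / (2 * v))) with hmdef
  have hfin : IsFiniteMeasure m := isFiniteMeasure_withDensity_ofReal hint.2
  have key : ProbabilityTheory.multivariateGaussian 0 (v • (1 : Matrix (Fin d) (Fin d) ℝ))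
      = ENNReal.ofReal Z⁻¹ • m := by
    have : IsFiniteMeasure (ENNReal.ofReal Z⁻¹ • m) := Measure.smul_finite _ (by simp)
    refine Measure.ext_of_charFun ?_
    funext t
    rw [ProbabilityTheory.charFun_multivariateGaussian (posSemidef_smul_one hv.le), charFun_apply,
      integral_smul_measure, hmdef, integral_withDensity_eq_integral_toReal_smul hm (by simp)]
    have hre' : 0 < ((1 / (2 * v) : ℝ) : ℂ).re := by simpa using hre
    have h1 := GaussianFourier.integral_cexp_neg_mul_sq_norm_add hre' Complex.I t
    have h0 := GaussianFourier.integral_cexp_neg_mul_sq_norm (V := Vec d) hre'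
    have hZc : (Z : ℂ) =
        (Real.pi / ((1 / (2 * v) : ℝ) : ℂ)) ^ (Module.finrank ℝ (Vec d) / 2 : ℂ) := by
      rw [← h0, hZdef, ← integral_complex_ofReal]
      refine integral_congr_ae (ae_of_all _ fun b => ?_)
      simp only [hexp]
      push_cast
      ring_nf
    have hlhs : ∀ x : Vec d, (ENNReal.ofReal (Real.exp (-‖x‖ ^ 2 / (2 * v)))).toReal
        • Complex.exp (inner ℝ x t * Complex.I) =
        Complex.exp (-((1 / (2 * v) : ℝ) : ℂ) * ‖x‖ ^ 2 + Complex.I * inner ℝ t x) := fun x => by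
      rw [ENNReal.toReal_ofReal (Real.exp_pos _).le, hexp, Complex.real_smul, Complex.ofReal_exp,
        ← Complex.exp_add, real_inner_comm]
      push_cast
      ring_nf
    simp_rw [hlhs]
    rw [h1, ← hZc, ENNReal.toReal_ofReal (by positivity), Complex.real_smul, ← mul_assoc,
      ← Complex.ofReal_mul, inv_mul_cancel₀ hZ.ne', Complex.ofReal_one, one_mul]
    congr 1
    have hdot : t.ofLp ⬝ᵥ (v • (1 : Matrix (Fin d) (Fin d) ℝ)).mulVec t.ofLp = v * ‖t‖ ^ 2 := by
      rw [Matrix.smul_mulVec, Matrix.one_mulVec, dotProduct_smul, smul_eq_mul,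
        EuclideanSpace.real_norm_sq_eq]
      simp [dotProduct, pow_two]
    rw [hdot]
    have hvc : (v : ℂ) ≠ 0 := by exact_mod_cast hv.ne'
    simp only [inner_zero_right, Complex.ofReal_zero, zero_mul, zero_sub, Complex.I_sq]
    push_cast
    field_simp
    ring
  refine ⟨ENNReal.ofReal Z⁻¹, fun u => ?_⟩
  rw [key, lintegral_smul_measure, smul_eq_mul,
    lintegral_withDensity_eq_lintegral_mul_non_measurable _ hm (by simp)]
  rfl

lemma integral_norm_multivariateGaussian_le {d : ℕ} {v : ℝ} (hv : 0 ≤ v) :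
    Integrable (fun b => ‖b‖)
        (ProbabilityTheory.multivariateGaussian 0 (v • (1 : Matrix (Fin d) (Fin d) ℝ))) ∧
      ∫ b, ‖b‖ ∂ProbabilityTheory.multivariateGaussian 0 (v • (1 : Matrix (Fin d) (Fin d) ℝ))
        ≤ √(d * v) := by
  set ν := ProbabilityTheory.multivariateGaussian 0 (v • (1 : Matrix (Fin d) (Fin d) ℝ)) with hν
  have h2 : MemLp (fun b : Vec d => ‖b‖) 2 ν :=
    (ProbabilityTheory.IsGaussian.memLp_two_id (μ := ν)).norm
  have h1 : Integrable (fun b : Vec d => ‖b‖) ν := h2.integrable (by norm_num)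
  have hcoord : ∀ i : Fin d, MemLp (fun b : Vec d => b i) 2 ν := fun i =>
    (ProbabilityTheory.IsGaussian.memLp_two_id (μ := ν)).continuousLinearMap_comp
      (EuclideanSpace.proj (𝕜 := ℝ) i)
  have hsq : ∫ b, ‖b‖ ^ 2 ∂ν = d * v := by
    simp_rw [EuclideanSpace.real_norm_sq_eq]
    rw [integral_finsetSum _ fun i _ => (hcoord i).integrable_sq]
    have hvar : ∀ i : Fin d, ∫ b, b i ^ 2 ∂ν = v := by
      intro i
      have h := ProbabilityTheory.variance_eval_multivariateGaussian (μ := (0 : Vec d))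
        (posSemidef_smul_one (d := d) hv) i
      have hmean : ∫ b, b i ∂ν = 0 := by
        have := (EuclideanSpace.proj (𝕜 := ℝ) i).integral_comp_comm
          (ProbabilityTheory.IsGaussian.integrable_id (μ := ν))
        simpa [hν] using this
      rw [ProbabilityTheory.variance_of_integral_eq_zero (by fun_prop) hmean] at h
      simpa using h
    simp [hvar]
  refine ⟨h1, Real.le_sqrt_of_sq_le ?_⟩
  have hvar := ProbabilityTheory.variance_nonneg (fun b : Vec d => ‖b‖) ν
  rw [ProbabilityTheory.variance_eq_sub h2] at hvar
  simp only [Pi.pow_apply] at hvar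
  linarith

/-! ### The path of minimizers along a growing loss -/

/-- One round of the game: a convex objective `f` and a nonnegative convex loss `h` whose Hessians
have rank at most one on `X`, with a regularizer `c ‖x‖²` at least as strongly convex as `h` is
smooth. -/
structure IsRound {d : ℕ} (X : Set (Vec d)) (D : ℝ) (f h : Vec d → ℝ) (c : ℝ) : Prop where
  actionSet : IsActionSet X D
  convex_objective : ConvexOn ℝ X f
  differentiable_objective : ∀ y ∈ X, DifferentiableAt ℝ f y
  convex_loss : ConvexOn ℝ X h
  twiceDifferentiable_loss : ∀ x ∈ X, TwiceDifferentiableAt h x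
  rank_le_one : ∀ x ∈ X, Module.finrank ℝ (LinearMap.range (hessian h x)) ≤ 1
  nonneg_loss : ∀ x ∈ X, 0 ≤ h x
  eigenvalue_le : ∀ x ∈ X, ∀ μ : ℝ, Module.End.HasEigenvalue (hessian h x) μ → μ ≤ 2 * c
  pos : 0 < c

namespace IsRound

variable {d : ℕ} {X : Set (Vec d)} {D : ℝ} {f h : Vec d → ℝ} {c : ℝ}

lemma differentiable_loss (hR : IsRound X D f h c) {x : Vec d} (hx : x ∈ X) :
    DifferentiableAt ℝ h x :=
  (hR.twiceDifferentiable_loss x hx).1.self_of_nhds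

lemma convex_add (hR : IsRound X D f h c) {s : ℝ} (hs : 0 ≤ s) : ConvexOn ℝ X (f + s • h) :=
  hR.convex_objective.add (hR.convex_loss.smul hs)

lemma hasGradientAt_smul (hR : IsRound X D f h c) (s : ℝ) {x : Vec d} (hx : x ∈ X) :
    HasGradientAt (s • h) (s • gradient h x) x := by
  rw [hasGradientAt_iff_hasFDerivAt, map_smul]
  exact (hR.differentiable_loss hx).hasGradientAt.hasFDerivAt.const_smul s

lemma hasGradientAt_add (hR : IsRound X D f h c) (s : ℝ) {x : Vec d} (hx : x ∈ X) :
    HasGradientAt (f + s • h) (gradient f x + s • gradient h x) x := by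
  rw [hasGradientAt_iff_hasFDerivAt, map_add]
  exact (hR.differentiable_objective x hx).hasGradientAt.hasFDerivAt.add
    (hR.hasGradientAt_smul s hx).hasFDerivAt

lemma differentiable_add (hR : IsRound X D f h c) (s : ℝ) : ∀ y ∈ X,
    DifferentiableAt ℝ (f + s • h) y :=
  fun _ hy => (hR.hasGradientAt_add s hy).differentiableAt

end IsRound

/-- The minimizer when the loss `h` has been added `s` times to the objective. -/
noncomputable def pathPoint {d : ℕ} (X : Set (Vec d)) (f h : Vec d → ℝ) (c s : ℝ) (b : Vec d) :
    Vec d :=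
  minimizer X (f + s • h) c b

/-- The gradient of the loss at `pathPoint`. -/
noncomputable def pathGradient {d : ℕ} (X : Set (Vec d)) (f h : Vec d → ℝ) (c s : ℝ)
    (b : Vec d) : Vec d :=
  gradient h (pathPoint X f h c s b)

namespace IsRound

variable {d : ℕ} {X : Set (Vec d)} {D : ℝ} {f h : Vec d → ℝ} {c : ℝ}

lemma pathPoint_mem (hR : IsRound X D f h c) (s : ℝ) (b : Vec d) : pathPoint X f h c s b ∈ X :=
  (minimizer_spec hR.actionSet (hR.differentiable_add s) c b).1

lemma pathPoint_isMinOn (hR : IsRound X D f h c) (s : ℝ) (b : Vec d) :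
    IsMinOn (tilted (f + s • h) c b) X (pathPoint X f h c s b) :=
  (minimizer_spec hR.actionSet (hR.differentiable_add s) c b).2

lemma eq_pathPoint (hR : IsRound X D f h c) {s : ℝ} (hs : 0 ≤ s) {b x : Vec d} (hx : x ∈ X)
    (hm : IsMinOn (tilted (f + s • h) c b) X x) : x = pathPoint X f h c s b :=
  eq_minimizer hR.actionSet (hR.convex_add hs) (hR.differentiable_add s) hR.pos hx hm

/-- Moving along the path is the same as shifting the noise by a multiple of the gradient. -/
lemma isMinOn_shift (hR : IsRound X D f h c) {s r : ℝ} (hs : 0 ≤ s) (hr : 0 ≤ r) {b x : Vec d}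
    (hx : x ∈ X) (hm : IsMinOn (tilted (f + s • h) c b) X x) :
    IsMinOn (tilted (f + r • h) c (b + (s - r) • gradient h x)) X x := by
  rw [isMinOn_tilted_iff (hR.convex_add hs) hR.pos.le hx (hR.hasGradientAt_add s hx)] at hm
  rw [isMinOn_tilted_iff (hR.convex_add hr) hR.pos.le hx (hR.hasGradientAt_add r hx)]
  convert hm using 4
  module

lemma pathPoint_shift (hR : IsRound X D f h c) {s r : ℝ} (hs : 0 ≤ s) (hr : 0 ≤ r) (b : Vec d) :
    pathPoint X f h c r (b + (s - r) • pathGradient X f h c s b) = pathPoint X f h c s b :=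
  (hR.eq_pathPoint hr (hR.pathPoint_mem s b)
    (hR.isMinOn_shift hs hr (hR.pathPoint_mem s b) (hR.pathPoint_isMinOn s b))).symm

lemma exists_lipschitzWith_pathPoint (hR : IsRound X D f h c) {s : ℝ} (hs : 0 ≤ s) :
    ∃ K : ℝ≥0, LipschitzWith K (pathPoint X f h c s) :=
  exists_lipschitzWith_minimizer hR.actionSet (hR.convex_add hs) (hR.differentiable_add s) hR.pos

lemma continuous_pathPoint (hR : IsRound X D f h c) {s : ℝ} (hs : 0 ≤ s) :
    Continuous (pathPoint X f h c s) :=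
  (hR.exists_lipschitzWith_pathPoint hs).choose_spec.continuous

lemma continuous_pathGradient (hR : IsRound X D f h c) {s : ℝ} (hs : 0 ≤ s) :
    Continuous (pathGradient X f h c s) :=
  continuous_iff_continuousAt.2 fun b =>
    (hR.twiceDifferentiable_loss _ (hR.pathPoint_mem s b)).2.continuousAt.comp
      (hR.continuous_pathPoint hs).continuousAt

lemma continuous_loss_pathPoint (hR : IsRound X D f h c) {s : ℝ} (hs : 0 ≤ s) :
    Continuous fun b => h (pathPoint X f h c s b) :=
  continuous_iff_continuousAt.2 fun b =>
    (hR.differentiable_loss (hR.pathPoint_mem s b)).continuousAt.comp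
      (hR.continuous_pathPoint hs).continuousAt

/-- On `X`, the gradient of the loss is Lipschitz with the strong convexity constant of the
regularizer. -/
lemma norm_gradient_sub_le (hR : IsRound X D f h c) {x y : Vec d} (hx : x ∈ X) (hy : y ∈ X) :
    ‖gradient h y - gradient h x‖ ≤ 2 * c * ‖y - x‖ := by
  have hbound : ∀ z ∈ X, ∀ w ∈ X, ‖hessian h z (w - z)‖ ≤ 2 * c * ‖w - z‖ := by
    intro z hz w hw
    obtain ⟨μ, n, hμ⟩ := exists_hessian_eq (hR.twiceDifferentiable_loss z hz) (hR.rank_le_one z hz)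
    have hnn := inner_hessian_nonneg hR.convex_loss (fun _ h => hR.differentiable_loss h)
      (hR.twiceDifferentiable_loss z hz).2 hz hw
    have hc := hR.pos
    by_cases hn : n = 0
    · rw [hμ, hn, smul_zero, norm_zero]; positivity
    have hn2 : 0 < ‖n‖ ^ 2 := by positivity
    have hle : μ * ‖n‖ ^ 2 ≤ 2 * c := by
      refine hR.eigenvalue_le z hz _ (Module.End.hasEigenvalue_of_hasEigenvector (x := n) ⟨?_, hn⟩)
      rw [Module.End.mem_eigenspace_iff, hμ, real_inner_self_eq_norm_sq]
    rw [hμ, real_inner_smul_left] at hnn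
    rw [hμ, norm_smul, norm_mul, Real.norm_eq_abs, Real.norm_eq_abs]
    rcases le_or_gt 0 μ with h0 | h0
    · rw [abs_of_nonneg h0]
      calc μ * |inner ℝ n (w - z)| * ‖n‖ ≤ μ * (‖n‖ * ‖w - z‖) * ‖n‖ := by
            gcongr; exact abs_real_inner_le_norm _ _
        _ = μ * ‖n‖ ^ 2 * ‖w - z‖ := by ring
        _ ≤ _ := by gcongr
    · have h3 : (inner ℝ n (w - z) : ℝ) * inner ℝ n (w - z) ≤ 0 := by nlinarith
      have h4 := mul_self_eq_zero.1 (le_antisymm h3 (mul_self_nonneg _))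
      rw [h4]
      simp
      positivity
  have hder : ∀ t ∈ Icc (0 : ℝ) 1, HasDerivWithinAt (fun t : ℝ => gradient h (x + t • (y - x)))
      (hessian h (x + t • (y - x)) (y - x)) (Icc 0 1) t := by
    intro t ht
    have hmem : x + t • (y - x) ∈ X := hR.actionSet.convex.add_smul_sub_mem hx hy ht
    have hline : HasDerivAt (fun t : ℝ => x + t • (y - x)) (y - x) t := by
      simpa using ((hasDerivAt_id t).smul_const (y - x)).const_add x
    exact ((hR.twiceDifferentiable_loss _ hmem).2.hasFDerivAt.comp_hasDerivAt t
      hline).hasDerivWithinAt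
  have hmean := norm_image_sub_le_of_norm_deriv_le_segment' hder
    (C := 2 * c * ‖y - x‖) (fun t ht => ?_) 1 (right_mem_Icc.2 zero_le_one)
  · simpa using hmean
  · have hmem : x + t • (y - x) ∈ X :=
      hR.actionSet.convex.add_smul_sub_mem hx hy ⟨ht.1, ht.2.le⟩
    have h1 := hbound _ hmem y hy
    have e : y - (x + t • (y - x)) = (1 - t) • (y - x) := by module
    have ht1 : 0 < 1 - t := by linarith [ht.2]
    rw [e, map_smul, norm_smul, norm_smul, Real.norm_of_nonneg ht1.le] at h1
    have : (1 - t) * ‖hessian h (x + t • (y - x)) (y - x)‖ ≤ (1 - t) * (2 * c * ‖y - x‖) := by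
      linarith
    exact le_of_mul_le_mul_left this ht1

/-- One step along the path: the displacement is controlled by the decrease of the loss. -/
lemma norm_pathPoint_sub_sq_le (hR : IsRound X D f h c) {s r : ℝ} (hs : 0 ≤ s) (hsr : s ≤ r)
    (b : Vec d) :
    2 * c * ‖pathPoint X f h c s b - pathPoint X f h c r b‖ ^ 2 ≤
      (r - s) * inner ℝ (pathGradient X f h c r b)
        (pathPoint X f h c s b - pathPoint X f h c r b) := by
  have h1 := two_mul_norm_sub_sq_le_inner (hR.convex_add hs) (hR.differentiable_add s) hR.pos.le
    (hR.pathPoint_mem s b) (hR.pathPoint_mem r b) (hR.pathPoint_isMinOn s b)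
    (hR.isMinOn_shift (hs.trans hsr) hs (hR.pathPoint_mem r b) (hR.pathPoint_isMinOn r b))
  rwa [add_sub_cancel_left, real_inner_smul_left] at h1

lemma inner_pathGradient_le (hR : IsRound X D f h c) (s r : ℝ) (b : Vec d) :
    (inner ℝ (pathGradient X f h c r b) (pathPoint X f h c s b - pathPoint X f h c r b) : ℝ) ≤
      h (pathPoint X f h c s b) - h (pathPoint X f h c r b) := by
  have := hR.convex_loss.add_inner_gradient_le (hR.pathPoint_mem r b) (hR.pathPoint_mem s b)
    (hR.differentiable_loss (hR.pathPoint_mem r b)).hasGradientAt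
  rw [pathGradient]
  linarith

lemma potential_sub_mem_Icc (hR : IsRound X D f h c) (s r : ℝ) (b : Vec d) :
    potential X (f + r • h) c b - potential X (f + s • h) c b ∈
      Icc ((r - s) * h (pathPoint X f h c r b)) ((r - s) * h (pathPoint X f h c s b)) := by
  have h1 := potential_le hR.actionSet (hR.differentiable_add s) c b (hR.pathPoint_mem r b)
  have h2 := potential_le hR.actionSet (hR.differentiable_add r) c b (hR.pathPoint_mem s b)
  rw [potential_eq_of_isMinOn (hR.pathPoint_mem s b) (hR.pathPoint_isMinOn s b)] at h1 ⊢
  rw [potential_eq_of_isMinOn (hR.pathPoint_mem r b) (hR.pathPoint_isMinOn r b)] at h2 ⊢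
  simp only [tilted, Pi.add_apply, Pi.smul_apply, smul_eq_mul] at *
  constructor <;> linarith

end IsRound

/-- Envelope theorem: the gradient of the potential is the minimizer. -/
lemma hasGradientAt_potential {d : ℕ} {X : Set (Vec d)} {f : Vec d → ℝ} {c D : ℝ}
    (hX : IsActionSet X D) (hf : ConvexOn ℝ X f) (hd : ∀ y ∈ X, DifferentiableAt ℝ f y)
    (hc : 0 < c) (b : Vec d) : HasGradientAt (potential X f c) (minimizer X f c b) b := by
  obtain ⟨K, hK⟩ := exists_lipschitzWith_minimizer hX hf hd hc
  have hbound : ∀ b', ‖potential X f c b' - potential X f c b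
      - inner ℝ (minimizer X f c b) (b' - b)‖ ≤ K * ‖b' - b‖ ^ 2 := by
    intro b'
    obtain ⟨hx, hm⟩ := minimizer_spec hX hd c b
    obtain ⟨hx', hm'⟩ := minimizer_spec hX hd c b'
    have h1 := potential_le hX hd c b' hx
    have h2 := potential_le hX hd c b hx'
    rw [potential_eq_of_isMinOn hx hm] at h2 ⊢
    rw [potential_eq_of_isMinOn hx' hm'] at h1 ⊢
    have h3 : (inner ℝ (b' - b) (minimizer X f c b - minimizer X f c b') : ℝ)
        ≤ K * ‖b' - b‖ ^ 2 := by
      refine (real_inner_le_norm _ _).trans ?_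
      have := hK.dist_le_mul b b'
      rw [dist_eq_norm, dist_eq_norm, norm_sub_rev b b'] at this
      nlinarith [norm_nonneg (b' - b)]
    rw [Real.norm_eq_abs, abs_le]
    simp only [tilted, inner_sub_left, inner_sub_right, real_inner_comm b' (minimizer X f c b),
      real_inner_comm b (minimizer X f c b)] at *
    constructor <;> linarith
  rw [hasGradientAt_iff_isLittleO]
  have h1 : (fun b' => potential X f c b' - potential X f c b
      - inner ℝ (minimizer X f c b) (b' - b)) =O[𝓝 b] fun b' => ‖b' - b‖ ^ 2 :=
    Asymptotics.IsBigO.of_bound K (Eventually.of_forall fun b' => by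
      simpa [norm_pow] using hbound b')
  refine h1.trans_isLittleO ?_
  have h2 : (fun b' : Vec d => ‖b' - b‖) =o[𝓝 b] fun _ => (1 : ℝ) := by
    rw [Asymptotics.isLittleO_one_iff]
    have : Tendsto (fun b' : Vec d => ‖b' - b‖) (𝓝 b) (𝓝 ‖b - b‖) :=
      (continuous_id.sub continuous_const).norm.continuousAt
    simpa using this
  have h3 := (Asymptotics.isBigO_refl (fun b' : Vec d => ‖b' - b‖) (𝓝 b)).mul_isLittleO h2
  simpa [pow_two] using h3.norm_right

namespace IsRound

variable {d : ℕ} {X : Set (Vec d)} {D : ℝ} {f h : Vec d → ℝ} {c : ℝ}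

lemma hasGradientAt_potential (hR : IsRound X D f h c) {s : ℝ} (hs : 0 ≤ s) (b : Vec d) :
    HasGradientAt (potential X (f + s • h) c) (pathPoint X f h c s b) b :=
  _root_.hasGradientAt_potential hR.actionSet (hR.convex_add hs) (hR.differentiable_add s) hR.pos b

/-- Shifting the noise against the path gradient does not decrease volume. -/
lemma lintegral_comp_sub_pathGradient_le (hR : IsRound X D f h c) {s t : ℝ} (hs : 0 ≤ s)
    (ht : 0 ≤ t) (u : Vec d → ℝ≥0∞) :
    ∫⁻ b, u (b - t • pathGradient X f h c s b) ≤ ∫⁻ b, u b := by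
  have hgrad : ∀ x ∈ X, gradient (t • h) x = t • gradient h x := fun x hx =>
    (hR.hasGradientAt_smul t hx).gradient
  have h2 : ∀ x ∈ X, (∀ᶠ y in 𝓝 x, gradient (t • h) y = t • gradient h y) := fun x hx =>
    (hR.twiceDifferentiable_loss x hx).1.mono fun y hy => by
      refine HasGradientAt.gradient ?_
      rw [hasGradientAt_iff_hasFDerivAt, map_smul]
      exact hy.hasGradientAt.hasFDerivAt.const_smul t
  have hhess : ∀ x ∈ X, hessian (t • h) x = t • hessian h x := fun x hx => by
    have : fderiv ℝ (gradient (t • h)) x = t • fderiv ℝ (gradient h) x := by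
      rw [Filter.EventuallyEq.fderiv_eq (h2 x hx)]
      exact fderiv_const_smul (hR.twiceDifferentiable_loss x hx).2 t
    rw [hessian, this]; rfl
  have key := lintegral_comp_sub_gradient_le (l := t • h) hR.actionSet (hR.convex_add hs)
    (hR.differentiable_add s) (hR.convex_loss.smul ht)
    (fun x hx => ⟨(hR.twiceDifferentiable_loss x hx).1.mono fun y hy => hy.const_smul t,
      ((hR.twiceDifferentiable_loss x hx).2.const_smul t).congr_of_eventuallyEq (h2 x hx)⟩)
    (fun x hx => by
      rw [hhess x hx]
      refine le_trans (Submodule.finrank_mono ?_) (hR.rank_le_one x hx)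
      rintro _ ⟨v, rfl⟩
      exact ⟨t • v, by simp⟩) hR.pos u
  have heq : ∀ b, gradient (t • h) (minimizer X (f + s • h) c b) = t • pathGradient X f h c s b :=
    fun b => hgrad _ (hR.pathPoint_mem s b)
  simpa only [heq] using key

end IsRound

namespace IsRound

variable {d : ℕ} {X : Set (Vec d)} {D : ℝ} {f h : Vec d → ℝ} {c : ℝ}

/-- Strong monotonicity of the minimizer at position `s` of the path: the loss that is already
part of the objective contributes as well. -/
lemma two_mul_norm_sub_sq_add_le (hR : IsRound X D f h c) {s : ℝ} (hs : 0 ≤ s) (b b' : Vec d) :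
    2 * c * ‖pathPoint X f h c s b' - pathPoint X f h c s b‖ ^ 2 +
      s * inner ℝ (pathGradient X f h c s b' - pathGradient X f h c s b)
        (pathPoint X f h c s b' - pathPoint X f h c s b) ≤
      -inner ℝ (b' - b) (pathPoint X f h c s b' - pathPoint X f h c s b) := by
  have key := two_mul_norm_sub_sq_le_inner hR.convex_objective hR.differentiable_objective
    hR.pos.le (hR.pathPoint_mem s b') (hR.pathPoint_mem s b)
    (b := b' + s • pathGradient X f h c s b') (b' := b + s • pathGradient X f h c s b) ?_ ?_
  · have e : b + s • pathGradient X f h c s b - (b' + s • pathGradient X f h c s b')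
        = -(b' - b) - s • (pathGradient X f h c s b' - pathGradient X f h c s b) := by module
    rw [e, inner_sub_left, inner_neg_left, real_inner_smul_left] at key
    linarith
  · have := hR.isMinOn_shift hs le_rfl (hR.pathPoint_mem s b') (hR.pathPoint_isMinOn s b')
    rwa [zero_smul, add_zero, sub_zero] at this
  · have := hR.isMinOn_shift hs le_rfl (hR.pathPoint_mem s b) (hR.pathPoint_isMinOn s b)
    rwa [zero_smul, add_zero, sub_zero] at this

/-- The shift `b ↦ b + s G_s(b)`, which turns the path point at position `s` into the one at
position `0`, contracts volume at most by the factor `1 + s`. With `H = μ n nᵀ` and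
`p = -μ ⟨n, Dx_s n⟩` its determinant is `1 - s p`, and strong monotonicity gives
`(1 + s) p² ≤ p`. -/
lemma one_le_mul_det_fderiv (hR : IsRound X D f h c) {s : ℝ} (hs : 0 ≤ s) {b : Vec d}
    (hξ : DifferentiableAt ℝ (pathPoint X f h c s) b) :
    1 ≤ (1 + s) * (ContinuousLinearMap.id ℝ (Vec d) +
      s • (fderiv ℝ (gradient h) (pathPoint X f h c s b)).comp
        (fderiv ℝ (pathPoint X f h c s) b)).det := by
  have hmem := hR.pathPoint_mem s
  have h2 := hR.twiceDifferentiable_loss _ (hmem b)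
  obtain ⟨μ, n, hμ⟩ := exists_hessian_eq h2 (hR.rank_le_one _ (hmem b))
  set K := fderiv ℝ (pathPoint X f h c s) b
  have hc := hR.pos
  have hμ' : ∀ v, fderiv ℝ (gradient h) (pathPoint X f h c s b) v = (μ * inner ℝ n v) • n := hμ
  have hline : HasDerivAt (fun t : ℝ => b + t • n) n 0 := by
    simpa using ((hasDerivAt_id (0 : ℝ)).smul_const n).const_add b
  have hξ' : HasFDerivAt (pathPoint X f h c s) K (b + (0 : ℝ) • n) := by
    simpa using hξ.hasFDerivAt
  have hslope : Tendsto (fun t : ℝ => t⁻¹ • (pathPoint X f h c s (b + t • n)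
      - pathPoint X f h c s b)) (𝓝[>] 0) (𝓝 (K n)) := by
    simpa using (hξ'.comp_hasDerivAt (0 : ℝ) hline).tendsto_slope_zero_right
  have hGder : HasFDerivAt (pathGradient X f h c s)
      ((fderiv ℝ (gradient h) (pathPoint X f h c s b)).comp K) b :=
    h2.2.hasFDerivAt.comp b hξ.hasFDerivAt
  have hslopeG : Tendsto (fun t : ℝ => t⁻¹ • (pathGradient X f h c s (b + t • n)
      - pathGradient X f h c s b)) (𝓝[>] 0) (𝓝 ((μ * inner ℝ n (K n)) • n)) := by
    have hG' : HasFDerivAt (pathGradient X f h c s)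
        ((fderiv ℝ (gradient h) (pathPoint X f h c s b)).comp K) (b + (0 : ℝ) • n) := by
      simpa using hGder
    have := (hG'.comp_hasDerivAt (0 : ℝ) hline).tendsto_slope_zero_right
    simpa [hμ'] using this
  have hlim : 2 * c * ‖K n‖ ^ 2 + s * inner ℝ ((μ * inner ℝ n (K n)) • n) (K n)
      ≤ -inner ℝ n (K n) := by
    have hl := (((hslope.norm.pow 2).const_mul (2 * c)).add
      ((hslopeG.inner hslope (𝕜 := ℝ)).const_mul s))
    have hr := ((tendsto_const_nhds (x := n)).inner hslope (𝕜 := ℝ)).neg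
    refine le_of_tendsto_of_tendsto hl hr ?_
    filter_upwards [self_mem_nhdsWithin] with t ht
    have ht0 : (0 : ℝ) < t := ht
    have hineq := hR.two_mul_norm_sub_sq_add_le hs b (b + t • n)
    rw [add_sub_cancel_left, real_inner_smul_left] at hineq
    rw [norm_smul, mul_pow, Real.norm_eq_abs, sq_abs, real_inner_smul_left, real_inner_smul_right,
      real_inner_smul_right]
    set δ := pathPoint X f h c s (b + t • n) - pathPoint X f h c s b
    set p : ℝ := inner ℝ (pathGradient X f h c s (b + t • n) - pathGradient X f h c s b) δ
    set q : ℝ := inner ℝ n δ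
    have hscaled := mul_le_mul_of_nonneg_left hineq (sq_nonneg t⁻¹)
    have e : t⁻¹ ^ 2 * -(t * q) = -(t⁻¹ * q) := by field_simp
    rw [e] at hscaled
    linarith
  set a : ℝ := inner ℝ n (K n) with ha
  rw [real_inner_smul_left, ← ha] at hlim
  have hdet : (ContinuousLinearMap.id ℝ (Vec d) +
      s • (fderiv ℝ (gradient h) (pathPoint X f h c s b)).comp K).det = 1 + s * (μ * a) := by
    have heq : ((ContinuousLinearMap.id ℝ (Vec d) +
        s • (fderiv ℝ (gradient h) (pathPoint X f h c s b)).comp K :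
        Vec d →L[ℝ] Vec d) : Vec d →ₗ[ℝ] Vec d) = LinearMap.transvection
          (((s * μ) • (innerSL ℝ n).comp K : Vec d →L[ℝ] ℝ) : Vec d →ₗ[ℝ] ℝ) n := by
      ext1 v
      simp [LinearMap.transvection.apply, hμ', smul_smul, mul_assoc]
    rw [ContinuousLinearMap.det, heq, LinearMap.transvection.det]
    simp [ha, mul_assoc]
  rw [hdet]
  rcases le_or_gt 0 μ with h0 | h0
  · by_cases hn : n = 0
    · have : a = 0 := by rw [ha, hn, inner_zero_left]
      rw [this]; nlinarith
    have hn2 : 0 < ‖n‖ ^ 2 := by positivity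
    have hle : μ * ‖n‖ ^ 2 ≤ 2 * c := by
      refine hR.eigenvalue_le _ (hmem b) _
        (Module.End.hasEigenvalue_of_hasEigenvector (x := n) ⟨?_, hn⟩)
      rw [Module.End.mem_eigenspace_iff, hμ, real_inner_self_eq_norm_sq]
    have hcs : a ^ 2 ≤ ‖n‖ ^ 2 * ‖K n‖ ^ 2 := by
      rw [← mul_pow, ← sq_abs a]
      gcongr
      exact abs_real_inner_le_norm _ _
    -- The quantity `p = -μ a` satisfies `(1 + s) p² ≤ p`.
    have h3 : (1 + s) * (μ * a) ^ 2 ≤ -(μ * a) := by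
      have h4 : μ * (2 * c * ‖K n‖ ^ 2 + s * (μ * a * a)) ≤ μ * -a :=
        mul_le_mul_of_nonneg_left hlim h0
      have h5 : (μ * a) ^ 2 ≤ μ * (2 * c * ‖K n‖ ^ 2) := by
        calc (μ * a) ^ 2 = μ * (μ * a ^ 2) := by ring
          _ ≤ μ * (μ * (‖n‖ ^ 2 * ‖K n‖ ^ 2)) := by gcongr
          _ = μ * ((μ * ‖n‖ ^ 2) * ‖K n‖ ^ 2) := by ring
          _ ≤ _ := by gcongr
      nlinarith
    have h6 : (1 + s) * -(μ * a) ≤ 1 := by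
      by_contra hcon
      push Not at hcon
      have h7 : 0 < -(μ * a) := by
        by_contra h8
        nlinarith
      nlinarith
    nlinarith [mul_le_mul_of_nonneg_left h6 hs]
  · have horth : ∀ y ∈ X, (inner ℝ n (y - pathPoint X f h c s b) : ℝ) = 0 := by
      intro y hy
      have hnn := inner_hessian_nonneg hR.convex_loss (fun _ hz => hR.differentiable_loss hz)
        h2.2 (hmem b) hy
      rw [hμ, real_inner_smul_left] at hnn
      have h3 : (inner ℝ n (y - pathPoint X f h c s b) : ℝ)
          * inner ℝ n (y - pathPoint X f h c s b) ≤ 0 := by nlinarith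
      exact mul_self_eq_zero.1 (le_antisymm h3 (mul_self_nonneg _))
    have h0' : a = 0 :=
      tendsto_nhds_unique ((tendsto_const_nhds (x := n)).inner hslope (𝕜 := ℝ))
        (tendsto_const_nhds.congr fun t => by
          rw [real_inner_smul_right, horth _ (hmem _), mul_zero])
    rw [h0']; nlinarith

/-- The change of variables that turns the path point at position `s` into the one at position
`0`; it is injective because `G_s` can be recovered from the image. -/
lemma lintegral_comp_add_pathGradient_le (hR : IsRound X D f h c) {s : ℝ} (hs : 0 ≤ s)
    (u : Vec d → ℝ≥0∞) :
    ∫⁻ b, u (b + s • pathGradient X f h c s b) ≤ ENNReal.ofReal (1 + s) * ∫⁻ b, u b := by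
  obtain ⟨K, hK⟩ := hR.exists_lipschitzWith_pathPoint hs
  have hinj : Function.Injective fun b => b + s • pathGradient X f h c s b := by
    intro b b' hbb
    have hbb' : b + s • pathGradient X f h c s b = b' + s • pathGradient X f h c s b' := hbb
    have h1 := hR.pathPoint_shift hs le_rfl b
    have h2 := hR.pathPoint_shift hs le_rfl b'
    rw [sub_zero] at h1 h2
    rw [hbb', h2] at h1
    have h3 : pathGradient X f h c s b' = pathGradient X f h c s b := by
      rw [pathGradient, pathGradient, h1]
    rwa [h3, add_left_inj] at hbb'
  refine lintegral_comp_le_of_one_le_mul_det (by linarith)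
    (s := {b | DifferentiableAt ℝ (pathPoint X f h c s) b})
    (measurableSet_of_differentiableAt ℝ _) hK.ae_differentiableAt hinj
    (Φ' := fun b => ContinuousLinearMap.id ℝ (Vec d) +
      s • (fderiv ℝ (gradient h) (pathPoint X f h c s b)).comp
        (fderiv ℝ (pathPoint X f h c s) b)) (fun b hb => ?_)
    (fun b hb => hR.one_le_mul_det_fderiv hs hb) u
  exact (hasFDerivAt_id b).add (((hR.twiceDifferentiable_loss _
    (hR.pathPoint_mem s b)).2.hasFDerivAt.comp b hb.hasFDerivAt).const_smul s)

end IsRound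

/-- The centred Gaussian distribution with covariance `v` times the identity. -/
noncomputable abbrev isoGaussian (d : ℕ) (v : ℝ) : Measure (Vec d) :=
  ProbabilityTheory.multivariateGaussian 0 (v • (1 : Matrix (Fin d) (Fin d) ℝ))

lemma exp_neg_norm_sub_sq {d : ℕ} (v : ℝ) (b a : Vec d) :
    Real.exp (-‖b - a‖ ^ 2 / (2 * v)) =
      Real.exp (-‖b‖ ^ 2 / (2 * v)) * Real.exp (inner ℝ b a / v - ‖a‖ ^ 2 / (2 * v)) := by
  rw [← Real.exp_add, norm_sub_sq_real]
  congr 1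
  rcases eq_or_ne v 0 with rfl | hv
  · simp
  · field_simp; ring

lemma isoGaussian_absolutelyContinuous {d : ℕ} {v : ℝ} (hv : 0 < v) :
    isoGaussian d v ≪ (volume : Measure (Vec d)) := by
  obtain ⟨Z, hZ⟩ := exists_lintegral_multivariateGaussian_eq (d := d) hv
  refine Measure.AbsolutelyContinuous.mk fun s hs h0 => ?_
  have h1 := hZ (s.indicator 1)
  rw [lintegral_indicator_one hs] at h1
  rw [isoGaussian, h1]
  have : (fun b : Vec d => ENNReal.ofReal (Real.exp (-‖b‖ ^ 2 / (2 * v))) *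
      s.indicator (1 : Vec d → ℝ≥0∞) b) =ᵐ[volume] fun _ => 0 := by
    filter_upwards [measure_eq_zero_iff_ae_notMem.1 h0] with b hb
    simp [hb]
  rw [lintegral_congr_ae this]
  simp

namespace IsRound

variable {d : ℕ} {X : Set (Vec d)} {D : ℝ} {f h : Vec d → ℝ} {c : ℝ}

/-- Change of variables for the Gaussian distribution under the shift that turns the path point
at position `s` into the one at position `0`. -/
lemma lintegral_gaussian_comp_add_le (hR : IsRound X D f h c) {s v : ℝ} (hs : 0 ≤ s) (hv : 0 < v)
    (θ : Vec d → ℝ≥0∞) :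
    ∫⁻ b, θ (b + s • pathGradient X f h c s b) ∂isoGaussian d v ≤
      ENNReal.ofReal (1 + s) * ∫⁻ b, ENNReal.ofReal (Real.exp
        (s * (inner ℝ b (pathGradient X f h c 0 b) / v))) * θ b ∂isoGaussian d v := by
  obtain ⟨Z, hZ⟩ := exists_lintegral_multivariateGaussian_eq (d := d) hv
  rw [isoGaussian, hZ, hZ]
  have key := hR.lintegral_comp_add_pathGradient_le hs (fun b =>
    ENNReal.ofReal (Real.exp (-‖b - s • pathGradient X f h c 0 b‖ ^ 2 / (2 * v))) * θ b)
  have hback : ∀ b, pathGradient X f h c 0 (b + s • pathGradient X f h c s b)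
      = pathGradient X f h c s b := by
    intro b
    have h1 := hR.pathPoint_shift hs le_rfl b
    rw [sub_zero] at h1
    rw [pathGradient, h1, pathGradient]
  simp only [hback, add_sub_cancel_right] at key
  calc _ ≤ Z * _ := mul_le_mul_right key _
    _ ≤ Z * (ENNReal.ofReal (1 + s) * ∫⁻ b, ENNReal.ofReal (Real.exp (-‖b‖ ^ 2 / (2 * v))) *
        (ENNReal.ofReal (Real.exp
        (s * (inner ℝ b (pathGradient X f h c 0 b) / v))) * θ b)) := by
      refine mul_le_mul_right (mul_le_mul_right (lintegral_mono fun b => ?_) _) _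
      rw [← mul_assoc, ← ENNReal.ofReal_mul (Real.exp_pos _).le, exp_neg_norm_sub_sq,
        real_inner_smul_right, mul_div_assoc]
      refine mul_le_mul_left (ENNReal.ofReal_le_ofReal (mul_le_mul_of_nonneg_left
        (Real.exp_le_exp.2 (sub_le_self _ ?_)) (Real.exp_pos _).le)) _
      positivity
    _ = _ := by ring

/-- The integration by parts inequality: the shift against the path gradient does not decrease
volume, that is, the path gradient has nonpositive divergence. -/
lemma integral_mul_inner_pathGradient_le (hR : IsRound X D f h c) {s v g M : ℝ} (hs : 0 ≤ s)
    (hv : 0 < v) (hg : ∀ x ∈ X, ‖gradient h x‖ ≤ g) {w : Vec d → ℝ} {w' : Vec d → Vec d}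
    {K : ℝ≥0} (hw : LipschitzWith K w) (hw0 : ∀ b, 0 ≤ w b) (hwM : ∀ b, w b ≤ M)
    (hw' : ∀ᵐ b, HasGradientAt w (w' b) b)
    (hi1 : Integrable (fun b => (inner ℝ (w' b) (pathGradient X f h c s b) : ℝ))
      (isoGaussian d v)) :
    ∫ b, w b * inner ℝ b (pathGradient X f h c s b) ∂isoGaussian d v ≤
      v * ∫ b, inner ℝ (w' b) (pathGradient X f h c s b) ∂isoGaussian d v := by
  obtain ⟨Z, hZ⟩ := exists_lintegral_multivariateGaussian_eq (d := d) hv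
  set ν := isoGaussian d v with hν
  set G := pathGradient X f h c s with hGdef
  have hG : ∀ b, ‖G b‖ ≤ g := fun b => hg _ (hR.pathPoint_mem s b)
  have hGc : Continuous G := hR.continuous_pathGradient hs
  have hg0 : 0 ≤ g := (norm_nonneg _).trans (hG 0)
  have hM0 : 0 ≤ M := (hw0 0).trans (hwM 0)
  have hnorm : Integrable (fun b : Vec d => ‖b‖) ν :=
    (integral_norm_multivariateGaussian_le (d := d) hv.le).1
  have hinn : ∀ b, |inner ℝ b (G b)| ≤ g * ‖b‖ := fun b =>
    (abs_real_inner_le_norm _ _).trans (by rw [mul_comm]; gcongr; exact hG b)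
  set F : ℝ → Vec d → ℝ := fun t b => t⁻¹ * (w (b - t • G b) - w b) +
    w (b - t • G b) * (inner ℝ b (G b) / v - t * g ^ 2 / (2 * v)) with hF
  have hbound : ∀ t ∈ Ioc (0 : ℝ) 1, ∀ b,
      ‖F t b‖ ≤ K * g + M * (g * ‖b‖ / v + g ^ 2 / (2 * v)) := by
    intro t ht b
    have h1 : |t⁻¹ * (w (b - t • G b) - w b)| ≤ K * g := by
      have := hw.dist_le_mul (b - t • G b) b
      rw [Real.dist_eq, dist_eq_norm, sub_sub_cancel_left, norm_neg, norm_smul,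
        Real.norm_of_nonneg ht.1.le] at this
      rw [abs_mul, abs_of_pos (inv_pos.2 ht.1)]
      calc t⁻¹ * |w (b - t • G b) - w b| ≤ t⁻¹ * (K * (t * ‖G b‖)) := by
            have := ht.1; gcongr
        _ = K * ‖G b‖ := by have := ht.1.ne'; field_simp
        _ ≤ _ := by gcongr; exact hG b
    have h2 : |w (b - t • G b) * (inner ℝ b (G b) / v - t * g ^ 2 / (2 * v))|
        ≤ M * (g * ‖b‖ / v + g ^ 2 / (2 * v)) := by
      rw [abs_mul, abs_of_nonneg (hw0 _)]
      gcongr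
      · exact hwM _
      refine (abs_sub _ _).trans ?_
      have ht0 := ht.1
      rw [abs_div, abs_of_pos hv, abs_of_nonneg (a := t * g ^ 2 / (2 * v)) (by positivity)]
      gcongr
      · exact hinn b
      · exact mul_le_of_le_one_left (sq_nonneg g) ht.2
    exact (abs_add_le _ _).trans (add_le_add h1 h2)
  have hbint : Integrable (fun b : Vec d => K * g + M * (g * ‖b‖ / v + g ^ 2 / (2 * v))) ν :=
    (integrable_const _).add
      ((((hnorm.const_mul g).div_const v).add (integrable_const _)).const_mul M)
  have hcont : ∀ t, Continuous (F t) := by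
    intro t
    have := hw.continuous
    have h1 : Continuous fun b => w (b - t • G b) := by fun_prop
    have h2 : Continuous fun b => (inner ℝ b (G b) : ℝ) := continuous_id.inner hGc
    fun_prop
  have hFint : ∀ t ∈ Ioc (0 : ℝ) 1, Integrable (F t) ν := fun t ht =>
    hbint.mono' (hcont t).aestronglyMeasurable (ae_of_all _ (hbound t ht))
  have hwint : Integrable w ν :=
    (integrable_const M).mono' hw.continuous.aestronglyMeasurable (ae_of_all _ fun b => by
      rw [Real.norm_of_nonneg (hw0 b)]; exact hwM b)
  -- Comparison of the weight with its shifted copy.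
  have hle : ∀ t ∈ Ioc (0 : ℝ) 1, ∫ b, F t b ∂ν ≤ 0 := by
    intro t ht
    have ht0 := ht.1
    have hshift := hR.lintegral_comp_sub_pathGradient_le hs ht0.le (fun b =>
      ENNReal.ofReal (Real.exp (-‖b‖ ^ 2 / (2 * v))) * ENNReal.ofReal (w b))
    have h1 : ∫⁻ b, ENNReal.ofReal (w b + t * F t b) ∂ν ≤ ∫⁻ b, ENNReal.ofReal (w b) ∂ν := by
      rw [hν, isoGaussian, hZ, hZ]
      refine mul_le_mul_right (le_trans (lintegral_mono fun b => ?_) hshift) _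
      rw [exp_neg_norm_sub_sq, ENNReal.ofReal_mul (Real.exp_pos _).le, mul_assoc]
      refine mul_le_mul_right ?_ _
      rw [← ENNReal.ofReal_mul (Real.exp_pos _).le]
      refine ENNReal.ofReal_le_ofReal ?_
      have e : w b + t * F t b = w (b - t • G b) *
          (1 + (t * inner ℝ b (G b) / v - t ^ 2 * g ^ 2 / (2 * v))) := by
        simp only [hF]
        field_simp
        ring
      rw [e, mul_comm]
      refine mul_le_mul_of_nonneg_right ?_ (hw0 _)
      rw [real_inner_smul_right, norm_smul, mul_pow, Real.norm_eq_abs, sq_abs, add_comm]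
      refine le_trans ?_ (Real.add_one_le_exp _)
      gcongr
      exact hG b
    have h2 : ∫ b, (w b + t * F t b) ∂ν ≤ ∫ b, w b ∂ν := by
      have hi : Integrable (fun b => w b + t * F t b) ν := hwint.add ((hFint t ht).const_mul t)
      calc ∫ b, (w b + t * F t b) ∂ν ≤ ∫ b, max (w b + t * F t b) 0 ∂ν :=
            integral_mono hi hi.pos_part fun b => le_max_left _ _
        _ = (∫⁻ b, ENNReal.ofReal (w b + t * F t b) ∂ν).toReal := by
            have hp := integral_eq_lintegral_of_nonneg_ae (μ := ν)
              (f := fun b => max (w b + t * F t b) 0) (ae_of_all _ fun b => le_max_right _ _)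
              hi.pos_part.1
            rw [hp]
            congr 2 with b
            simp [ENNReal.ofReal_max]
        _ ≤ (∫⁻ b, ENNReal.ofReal (w b) ∂ν).toReal :=
            ENNReal.toReal_mono hwint.lintegral_lt_top.ne h1
        _ = ∫ b, w b ∂ν := (integral_eq_lintegral_of_nonneg_ae (ae_of_all _ hw0) hwint.1).symm
    rw [integral_add hwint ((hFint t ht).const_mul t), integral_const_mul] at h2
    nlinarith
  have hlim : Tendsto (fun t => ∫ b, F t b ∂ν) (𝓝[>] 0)
      (𝓝 (∫ b, (-inner ℝ (w' b) (G b) + w b * (inner ℝ b (G b) / v)) ∂ν)) := by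
    have hmem : Ioc (0 : ℝ) 1 ∈ 𝓝[>] (0 : ℝ) := Ioc_mem_nhdsGT zero_lt_one
    refine tendsto_integral_filter_of_dominated_convergence _
      (Eventually.of_forall fun t => (hcont t).aestronglyMeasurable)
      (by filter_upwards [hmem] with t ht using ae_of_all _ (hbound t ht)) hbint ?_
    filter_upwards [(isoGaussian_absolutelyContinuous hv).ae_le hw'] with b hb
    have hline : HasDerivAt (fun t : ℝ => b - t • G b) (-G b) 0 := by
      simpa using ((hasDerivAt_id (0 : ℝ)).smul_const (G b)).const_sub b
    have hb' : HasFDerivAt w ((InnerProductSpace.toDual ℝ (Vec d)) (w' b)) (b - (0 : ℝ) • G b) := by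
      simpa using hb.hasFDerivAt
    have h1 : Tendsto (fun t : ℝ => t⁻¹ * (w (b - t • G b) - w b)) (𝓝[>] 0)
        (𝓝 (-inner ℝ (w' b) (G b))) := by
      simpa using (hb'.comp_hasDerivAt (0 : ℝ) hline).tendsto_slope_zero_right
    have h2 : Tendsto (fun t : ℝ => w (b - t • G b) * (inner ℝ b (G b) / v - t * g ^ 2 / (2 * v)))
        (𝓝[>] 0) (𝓝 (w b * (inner ℝ b (G b) / v))) := by
      have hcw := hw.continuous
      have : Continuous fun t : ℝ =>
          w (b - t • G b) * (inner ℝ b (G b) / v - t * g ^ 2 / (2 * v)) := by fun_prop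
      simpa using (this.tendsto 0).mono_left nhdsWithin_le_nhds
    exact h1.add h2
  have hfin : ∫ b, (-inner ℝ (w' b) (G b) + w b * (inner ℝ b (G b) / v)) ∂ν ≤ 0 :=
    le_of_tendsto hlim (by
      filter_upwards [Ioc_mem_nhdsGT zero_lt_one] with t ht using hle t ht)
  have hi2 : Integrable (fun b => w b * inner ℝ b (G b)) ν := by
    refine (hnorm.const_mul (M * g)).mono' (hw.continuous.mul
      (continuous_id.inner hGc)).aestronglyMeasurable (ae_of_all _ fun b => ?_)
    rw [norm_mul, Real.norm_of_nonneg (hw0 b), Real.norm_eq_abs, mul_assoc]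
    gcongr
    · exact hwM b
    · exact hinn b
  have e : (fun b => -inner ℝ (w' b) (G b) + w b * (inner ℝ b (G b) / v))
      = fun b => (w b * inner ℝ b (G b)) / v - inner ℝ (w' b) (G b) := by
    funext b; ring
  rw [e, integral_sub (hi2.div_const v) hi1, integral_div, sub_nonpos, div_le_iff₀ hv,
    mul_comm] at hfin
  exact hfin

end IsRound

/-! ### Weights along the path: deterministic estimates -/

/-- Summation by parts. -/
lemma sum_inner_sub_add_inner {E : Type*} [NormedAddCommGroup E] [InnerProductSpace ℝ E]
    (C G : ℕ → E) (N : ℕ) :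
    ∑ i ∈ Finset.range N, (inner ℝ (C i - C (i + 1)) (G i) : ℝ) + inner ℝ (C N) (G N) =
      inner ℝ (C 0) (G 0) + ∑ i ∈ Finset.range N, inner ℝ (C (i + 1)) (G (i + 1) - G i) := by
  induction N with
  | zero => simp
  | succ N ih =>
    rw [Finset.sum_range_succ, Finset.sum_range_succ, ← add_assoc, ← ih, inner_sub_left,
      inner_sub_right]
    ring

/-- The potential `(∑_{j < n} 4^(j+1) m_j)² / 4^(n+1)` makes the bound on the double sum go
through by induction. -/
lemma sum_add_sum_mul_le (g : ℝ) (m : ℕ → ℝ) (n : ℕ) :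
    ∑ i ∈ Finset.range n, (g + ∑ j ∈ Finset.range (i + 1), 4 ^ (j + 1) * m j) * m i ≤
      g ^ 2 / 4 + 7 / 3 * ∑ j ∈ Finset.range n, 4 ^ (j + 1) * m j ^ 2 := by
  have h1 : ∀ n, ∑ i ∈ Finset.range n, g * m i ≤
      g ^ 2 / 4 * (1 - 1 / 4 ^ n) + 1 / 3 * ∑ j ∈ Finset.range n, 4 ^ (j + 1) * m j ^ 2 := by
    intro n
    induction n with
    | zero => simp
    | succ n ih =>
      rw [Finset.sum_range_succ, Finset.sum_range_succ]
      have hp : (0 : ℝ) < 4 ^ n := by positivity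
      have h2 : g * m n ≤ g ^ 2 / 4 * (1 / 4 ^ n - 1 / 4 ^ (n + 1))
          + 1 / 3 * (4 ^ (n + 1) * m n ^ 2) := by
        have e : g ^ 2 / 4 * (1 / 4 ^ n - 1 / 4 ^ (n + 1)) + 1 / 3 * (4 ^ (n + 1) * m n ^ 2)
            - g * m n = 3 / (16 * 4 ^ n) * (g - 8 / 3 * (4 ^ n * m n)) ^ 2 := by
          field_simp
          ring
        have : 0 ≤ 3 / (16 * 4 ^ n) * (g - 8 / 3 * (4 ^ n * m n)) ^ 2 := by positivity
        linarith
      linarith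
  have h2 : ∀ n, ∑ i ∈ Finset.range n, (∑ j ∈ Finset.range (i + 1), 4 ^ (j + 1) * m j) * m i
      + (∑ j ∈ Finset.range n, 4 ^ (j + 1) * m j) ^ 2 / 4 ^ (n + 1)
      ≤ 2 * ∑ j ∈ Finset.range n, 4 ^ (j + 1) * m j ^ 2 := by
    intro n
    induction n with
    | zero => simp
    | succ n ih =>
      rw [Finset.sum_range_succ, Finset.sum_range_succ _ n, Finset.sum_range_succ _ n]
      set T := ∑ j ∈ Finset.range n, 4 ^ (j + 1) * m j
      have hp : (0 : ℝ) < 4 ^ n := by positivity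
      have e : T ^ 2 / 4 ^ (n + 1) + 2 * (4 ^ (n + 1) * m n ^ 2) -
          (T + 4 ^ (n + 1) * m n) * m n - (T + 4 ^ (n + 1) * m n) ^ 2 / 4 ^ (n + 1 + 1)
          = 3 / (16 * 4 ^ n) * (T - 4 ^ (n + 1) * m n) ^ 2 := by
        field_simp
        ring
      have : 0 ≤ 3 / (16 * 4 ^ n) * (T - 4 ^ (n + 1) * m n) ^ 2 := by positivity
      linarith
  simp only [add_mul, Finset.sum_add_distrib]
  have h3 := h1 n
  have h4 := h2 n
  have h5 : 0 ≤ (∑ j ∈ Finset.range n, 4 ^ (j + 1) * m j) ^ 2 / 4 ^ (n + 1) := by positivity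
  have h6 : g ^ 2 / 4 * (1 - 1 / 4 ^ n) ≤ g ^ 2 / 4 * 1 := by
    have : (0 : ℝ) < 1 / 4 ^ n := by positivity
    gcongr
    linarith
  linarith

/-- A sum over the indices satisfying a condition that propagates downwards is an initial sum. -/
lemma exists_sum_ite_eq (p : ℕ → Prop) [DecidablePred p] (hp : ∀ i, p (i + 1) → p i) (t : ℕ → ℝ)
    (N : ℕ) : ∃ n, (∀ i < n, p i) ∧
      ∑ i ∈ Finset.range N, (if p i then t i else 0) = ∑ i ∈ Finset.range n, t i := by
  induction N with
  | zero => exact ⟨0, by simp, by simp⟩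
  | succ N ih =>
    by_cases hN : p N
    · have hall : ∀ k i, i + k = N → p i := by
        intro k
        induction k with
        | zero => rintro i rfl; exact hN
        | succ k ihk => intro i hi; exact hp i (ihk (i + 1) (by omega))
      refine ⟨N + 1, fun i hi => hall (N - i) i (by omega), Finset.sum_congr rfl fun i hi => ?_⟩
      rw [if_pos (hall (N - i) i (by have := Finset.mem_range.1 hi; omega))]
    · obtain ⟨n, h1, h2⟩ := ih
      exact ⟨n, h1, by rw [Finset.sum_range_succ, h2, if_neg hN, add_zero]⟩

lemma exp_mul_max_le {s : ℝ} (hs : 1 ≤ s) (τ : ℝ) :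
    (1 + s) * (Real.exp (s * τ) * max (-τ - 4) 0) ≤ 2 * Real.exp (-(4 * s)) := by
  rcases le_total (-τ - 4) 0 with h0 | h0
  · rw [max_eq_right h0]; simp; positivity
  rw [max_eq_left h0]
  have h1 : s * (-τ - 4) * Real.exp (-(s * (-τ - 4))) ≤ 1 := by
    have := Real.add_one_le_exp (s * (-τ - 4))
    rw [Real.exp_neg, ← div_eq_mul_inv, div_le_one (Real.exp_pos _)]
    linarith
  have e : Real.exp (s * τ) = Real.exp (-(4 * s)) * Real.exp (-(s * (-τ - 4))) := by
    rw [← Real.exp_add]; ring_nf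
  rw [e]
  have h2 : 0 ≤ (-τ - 4) * Real.exp (-(s * (-τ - 4))) := by positivity
  calc _ = Real.exp (-(4 * s)) * ((1 + s) * ((-τ - 4) * Real.exp (-(s * (-τ - 4))))) := by ring
    _ ≤ Real.exp (-(4 * s)) * (2 * s * ((-τ - 4) * Real.exp (-(s * (-τ - 4))))) := by
      gcongr; linarith
    _ = 2 * Real.exp (-(4 * s)) * (s * (-τ - 4) * Real.exp (-(s * (-τ - 4)))) := by ring
    _ ≤ 2 * Real.exp (-(4 * s)) * 1 := by gcongr
    _ = _ := mul_one _

namespace IsRound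

variable {d : ℕ} {X : Set (Vec d)} {D : ℝ} {f h : Vec d → ℝ} {c : ℝ}

lemma integrable_mul_inner_pathGradient (hR : IsRound X D f h c) {s v g M : ℝ} (hs : 0 ≤ s)
    (hv : 0 ≤ v) (hg : ∀ x ∈ X, ‖gradient h x‖ ≤ g) {w : Vec d → ℝ} (hw : Continuous w)
    (hwM : ∀ b, |w b| ≤ M) :
    Integrable (fun b => w b * inner ℝ b (pathGradient X f h c s b)) (isoGaussian d v) := by
  refine ((integral_norm_multivariateGaussian_le (d := d) hv).1.const_mul (M * g)).mono'
    (hw.mul (continuous_id.inner (hR.continuous_pathGradient hs))).aestronglyMeasurable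
    (ae_of_all _ fun b => ?_)
  rw [norm_mul, Real.norm_eq_abs, Real.norm_eq_abs, mul_assoc]
  have h1 := abs_real_inner_le_norm b (pathGradient X f h c s b)
  have h2 : ‖pathGradient X f h c s b‖ ≤ g := hg _ (hR.pathPoint_mem s b)
  have hM : 0 ≤ M := (abs_nonneg _).trans (hwM b)
  gcongr
  · exact hwM b
  · exact h1.trans (by rw [mul_comm]; gcongr)

/-- The logarithmic density ratio `-⟨b, G_s b⟩ / v` rarely exceeds `6`, also when weighted with a
function of the path point: the shift to position `0` of the path gains a factor `exp (-4 s)`. -/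
lemma integral_mul_max_le (hR : IsRound X D f h c) {s v M : ℝ} (hs : 1 ≤ s) (hv : 0 < v)
    (hg : ∀ x ∈ X, s * ‖gradient h x‖ ^ 2 ≤ 2 * v) {k : Vec d → ℝ} (hk0 : ∀ x ∈ X, 0 ≤ k x)
    (hkM : ∀ x ∈ X, k x ≤ M) (hk : ∀ r, 0 ≤ r → Continuous fun b => k (pathPoint X f h c r b)) :
    Integrable (fun b => k (pathPoint X f h c s b) *
        max (-(inner ℝ b (pathGradient X f h c s b) / v) - 6) 0) (isoGaussian d v) ∧
      ∫ b, k (pathPoint X f h c s b) *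
          max (-(inner ℝ b (pathGradient X f h c s b) / v) - 6) 0 ∂isoGaussian d v ≤
        2 * Real.exp (-(4 * s)) * ∫ b, k (pathPoint X f h c 0 b) ∂isoGaussian d v := by
  have hs0 : 0 ≤ s := by linarith
  set ν := isoGaussian d v with hν
  set F : Vec d → ℝ := fun b => k (pathPoint X f h c s b) *
    max (-(inner ℝ b (pathGradient X f h c s b) / v) - 6) 0 with hF
  have hF0 : ∀ b, 0 ≤ F b := fun b =>
    mul_nonneg (hk0 _ (hR.pathPoint_mem s b)) (le_max_right _ _)
  have hFc : Continuous F := by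
    have h1 := hk s hs0
    have h2 : Continuous fun b => (inner ℝ b (pathGradient X f h c s b) : ℝ) :=
      continuous_id.inner (hR.continuous_pathGradient hs0)
    exact h1.mul (((h2.div_const v).neg.sub continuous_const).max continuous_const)
  have hk0int : Integrable (fun b => k (pathPoint X f h c 0 b)) ν :=
    (integrable_const M).mono' (hk 0 le_rfl).aestronglyMeasurable (ae_of_all _ fun b => by
      rw [Real.norm_of_nonneg (hk0 _ (hR.pathPoint_mem 0 b))]
      exact hkM _ (hR.pathPoint_mem 0 b))
  have hle : ∫⁻ b, ENNReal.ofReal (F b) ∂ν ≤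
      ENNReal.ofReal (2 * Real.exp (-(4 * s))) *
        ∫⁻ b, ENNReal.ofReal (k (pathPoint X f h c 0 b)) ∂ν := by
    have key := hR.lintegral_gaussian_comp_add_le hs0 hv fun y =>
      ENNReal.ofReal (k (pathPoint X f h c 0 y) *
        max (-(inner ℝ y (pathGradient X f h c 0 y) / v) - 4) 0)
    refine (lintegral_mono fun b => ?_).trans (key.trans ?_)
    · have h1 := hR.pathPoint_shift hs0 le_rfl b
      rw [sub_zero] at h1
      simp only [pathGradient] at h1 ⊢
      rw [h1]
      refine ENNReal.ofReal_le_ofReal ?_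
      simp only [hF, pathGradient]
      refine mul_le_mul_of_nonneg_left (max_le_max ?_ le_rfl) (hk0 _ (hR.pathPoint_mem s b))
      rw [inner_add_left, real_inner_smul_left, real_inner_self_eq_norm_sq, add_div]
      have := (div_le_iff₀ hv).2 (hg _ (hR.pathPoint_mem s b))
      linarith
    · rw [← lintegral_const_mul' _ _ ENNReal.ofReal_ne_top,
        ← lintegral_const_mul' _ _ ENNReal.ofReal_ne_top]
      refine lintegral_mono fun b => ?_
      rw [← ENNReal.ofReal_mul (Real.exp_pos _).le, ← ENNReal.ofReal_mul (by linarith),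
        ← ENNReal.ofReal_mul (by positivity)]
      refine ENNReal.ofReal_le_ofReal ?_
      have := mul_le_mul_of_nonneg_left (exp_mul_max_le hs
        (inner ℝ b (pathGradient X f h c 0 b) / v)) (hk0 _ (hR.pathPoint_mem 0 b))
      linarith
  have hfin : ∫⁻ b, ENNReal.ofReal (k (pathPoint X f h c 0 b)) ∂ν ≠ ∞ :=
    hk0int.lintegral_lt_top.ne
  have hFint : Integrable F ν := by
    refine ⟨hFc.aestronglyMeasurable, ?_⟩
    rw [hasFiniteIntegral_iff_ofReal (ae_of_all _ hF0)]
    exact hle.trans_lt (ENNReal.mul_lt_top ENNReal.ofReal_lt_top hk0int.lintegral_lt_top)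
  refine ⟨hFint, ?_⟩
  rw [integral_eq_lintegral_of_nonneg_ae (ae_of_all _ hF0) hFint.1,
    integral_eq_lintegral_of_nonneg_ae (ae_of_all _ fun b => hk0 _ (hR.pathPoint_mem 0 b))
      hk0int.1]
  have := ENNReal.toReal_mono (ENNReal.mul_ne_top ENNReal.ofReal_ne_top hfin) hle
  rwa [ENNReal.toReal_mul, ENNReal.toReal_ofReal (by positivity)] at this

end IsRound

/-! ### Stability of one round under Gaussian noise -/

/-- The increase of the potential along the `j`-th unit step of the path. -/
noncomputable def stepIncrement {d : ℕ} (X : Set (Vec d)) (f h : Vec d → ℝ) (c : ℝ) (j : ℕ)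
    (b : Vec d) : ℝ :=
  potential X (f + ((j + 1 : ℕ) : ℝ) • h) c b - potential X (f + (j : ℝ) • h) c b

/-- The average increase of the potential along the first `ε` of the path. -/
noncomputable def averageIncrement {d : ℕ} (X : Set (Vec d)) (f h : Vec d → ℝ) (c ε : ℝ)
    (b : Vec d) : ℝ :=
  ε⁻¹ * (potential X (f + ε • h) c b - potential X (f + (0 : ℝ) • h) c b)

/-- What is left of the average increment after subtracting geometrically growing multiples of
the increments of the first `i` steps. -/
noncomputable def residualIncrement {d : ℕ} (X : Set (Vec d)) (f h : Vec d → ℝ) (c ε : ℝ) (i : ℕ)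
    (b : Vec d) : ℝ :=
  averageIncrement X f h c ε b -
    ∑ j ∈ Finset.range i, 4 ^ (j + 1) * stepIncrement X f h c (j + 1) b

/-- The gradient of `residualIncrement`. -/
noncomputable def residualGradient {d : ℕ} (X : Set (Vec d)) (f h : Vec d → ℝ) (c ε : ℝ) (i : ℕ)
    (b : Vec d) : Vec d :=
  ε⁻¹ • (pathPoint X f h c ε b - pathPoint X f h c 0 b) -
    ∑ j ∈ Finset.range i, (4 ^ (j + 1) : ℝ) •
      (pathPoint X f h c ((j + 1 + 1 : ℕ) : ℝ) b - pathPoint X f h c ((j + 1 : ℕ) : ℝ) b)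

/-- The almost everywhere gradient of the positive part of `residualIncrement`. -/
noncomputable def positiveGradient {d : ℕ} (X : Set (Vec d)) (f h : Vec d → ℝ) (c ε : ℝ) (i : ℕ)
    (b : Vec d) : Vec d :=
  {b | 0 < residualIncrement X f h c ε i b}.indicator (residualGradient X f h c ε i) b

namespace IsRound

variable {d : ℕ} {X : Set (Vec d)} {D : ℝ} {f h : Vec d → ℝ} {c ε : ℝ}

lemma stepIncrement_mem_Icc (hR : IsRound X D f h c) (j : ℕ) (b : Vec d) :
    stepIncrement X f h c j b ∈ Icc (h (pathPoint X f h c ((j + 1 : ℕ) : ℝ) b))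
      (h (pathPoint X f h c (j : ℝ) b)) := by
  have := hR.potential_sub_mem_Icc (j : ℝ) ((j + 1 : ℕ) : ℝ) b
  have e : (((j + 1 : ℕ) : ℝ) - j) = 1 := by push_cast; ring
  rwa [e, one_mul, one_mul] at this

lemma stepIncrement_nonneg (hR : IsRound X D f h c) (j : ℕ) (b : Vec d) :
    0 ≤ stepIncrement X f h c j b :=
  (hR.nonneg_loss _ (hR.pathPoint_mem _ b)).trans (hR.stepIncrement_mem_Icc j b).1

lemma averageIncrement_mem_Icc (hR : IsRound X D f h c) (hε : 0 < ε) (b : Vec d) :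
    averageIncrement X f h c ε b ∈ Icc (h (pathPoint X f h c ε b)) (h (pathPoint X f h c 0 b)) := by
  have := hR.potential_sub_mem_Icc 0 ε b
  rw [sub_zero] at this
  constructor
  · rw [averageIncrement, inv_mul_eq_div, le_div_iff₀' hε]; exact this.1
  · rw [averageIncrement, inv_mul_eq_div, div_le_iff₀' hε]; exact this.2

lemma averageIncrement_nonneg (hR : IsRound X D f h c) (hε : 0 < ε) (b : Vec d) :
    0 ≤ averageIncrement X f h c ε b :=
  (hR.nonneg_loss _ (hR.pathPoint_mem _ b)).trans (hR.averageIncrement_mem_Icc hε b).1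

lemma residualIncrement_succ (i : ℕ) (b : Vec d) : residualIncrement X f h c ε (i + 1) b =
    residualIncrement X f h c ε i b - 4 ^ (i + 1) * stepIncrement X f h c (i + 1) b := by
  rw [residualIncrement, residualIncrement, Finset.sum_range_succ]; ring

lemma residualIncrement_zero (b : Vec d) :
    residualIncrement X f h c ε 0 b = averageIncrement X f h c ε b := by
  simp [residualIncrement]

lemma residualIncrement_succ_le (hR : IsRound X D f h c) (i : ℕ) (b : Vec d) :
    residualIncrement X f h c ε (i + 1) b ≤ residualIncrement X f h c ε i b := by
  rw [residualIncrement_succ]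
  have := hR.stepIncrement_nonneg (i + 1) b
  exact sub_le_self _ (by positivity)

lemma residualIncrement_le (hR : IsRound X D f h c) (hε : 0 < ε) (i : ℕ) (b : Vec d) :
    residualIncrement X f h c ε i b ≤ h (pathPoint X f h c 0 b) := by
  induction i with
  | zero => rw [residualIncrement_zero]; exact (hR.averageIncrement_mem_Icc hε b).2
  | succ i ih => exact (hR.residualIncrement_succ_le i b).trans ih

lemma hasGradientAt_residualIncrement (hR : IsRound X D f h c) (hε : 0 < ε) (i : ℕ) (b : Vec d) :
    HasGradientAt (residualIncrement X f h c ε i) (residualGradient X f h c ε i b) b := by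
  have hpot : ∀ {s : ℝ}, 0 ≤ s → HasFDerivAt (potential X (f + s • h) c)
      (InnerProductSpace.toDual ℝ (Vec d) (pathPoint X f h c s b)) b := fun hs =>
    (hR.hasGradientAt_potential hs b).hasFDerivAt
  rw [hasGradientAt_iff_hasFDerivAt, residualGradient, map_sub, map_sum, map_smul, map_sub]
  refine (((hpot hε.le).sub (hpot le_rfl)).const_mul ε⁻¹).sub (HasFDerivAt.fun_sum fun j _ => ?_)
  rw [map_smul, map_sub]
  exact ((hpot (Nat.cast_nonneg _)).sub (hpot (Nat.cast_nonneg _))).const_mul _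

lemma continuous_residualIncrement (hR : IsRound X D f h c) (hε : 0 < ε) (i : ℕ) :
    Continuous (residualIncrement X f h c ε i) :=
  continuous_iff_continuousAt.2 fun b => (hR.hasGradientAt_residualIncrement hε i b).continuousAt

lemma continuous_residualGradient (hR : IsRound X D f h c) (hε : 0 < ε) (i : ℕ) :
    Continuous (residualGradient X f h c ε i) := by
  have h1 := hR.continuous_pathPoint hε.le
  have h0 := hR.continuous_pathPoint le_rfl
  have hn : ∀ n : ℕ, Continuous (pathPoint X f h c (n : ℝ)) := fun n =>
    hR.continuous_pathPoint (Nat.cast_nonneg n)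
  unfold residualGradient
  exact ((h1.sub h0).const_smul ε⁻¹).sub
    (continuous_finsetSum _ fun j _ =>
      ((hn (j + 1 + 1)).sub (hn (j + 1))).const_smul (4 ^ (j + 1) : ℝ))

lemma exists_norm_residualGradient_le (hR : IsRound X D f h c) (i : ℕ) :
    ∃ K : ℝ≥0, ∀ b, ‖residualGradient X f h c ε i b‖ ≤ K := by
  have hD : ∀ s r b, ‖pathPoint X f h c s b - pathPoint X f h c r b‖ ≤ D + D := fun s r b =>
    (norm_sub_le _ _).trans (add_le_add (hR.actionSet.norm_le _ (hR.pathPoint_mem s b))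
      (hR.actionSet.norm_le _ (hR.pathPoint_mem r b)))
  refine ⟨Real.toNNReal (‖ε⁻¹‖ * (D + D) +
    ∑ j ∈ Finset.range i, ‖(4 ^ (j + 1) : ℝ)‖ * (D + D)), fun b => ?_⟩
  refine le_trans ((norm_sub_le _ _).trans (add_le_add ?_ ?_)) (Real.le_coe_toNNReal _)
  · rw [norm_smul]
    gcongr
    exact hD _ _ b
  · refine (norm_sum_le _ _).trans (Finset.sum_le_sum fun j _ => ?_)
    rw [norm_smul]
    gcongr
    exact hD _ _ b

lemma exists_lipschitzWith_max_residualIncrement (hR : IsRound X D f h c) (hε : 0 < ε) (i : ℕ) :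
    ∃ K : ℝ≥0, LipschitzWith K fun b => max (residualIncrement X f h c ε i b) 0 := by
  obtain ⟨K, hK⟩ := hR.exists_norm_residualGradient_le (ε := ε) i
  refine ⟨K, LipschitzWith.max_const ?_ 0⟩
  refine lipschitzWith_of_nnnorm_fderiv_le
    (fun b => (hR.hasGradientAt_residualIncrement hε i b).differentiableAt) fun b => ?_
  rw [(hR.hasGradientAt_residualIncrement hε i b).hasFDerivAt.fderiv, ← NNReal.coe_le_coe,
    coe_nnnorm, LinearIsometryEquiv.norm_map]
  exact hK b

lemma positiveGradient_of_pos {i : ℕ} {b : Vec d} (hpos : 0 < residualIncrement X f h c ε i b) :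
    positiveGradient X f h c ε i b = residualGradient X f h c ε i b :=
  indicator_of_mem (s := {b | 0 < residualIncrement X f h c ε i b}) hpos _

lemma positiveGradient_of_not_pos {i : ℕ} {b : Vec d}
    (hpos : ¬0 < residualIncrement X f h c ε i b) : positiveGradient X f h c ε i b = 0 :=
  indicator_of_notMem (s := {b | 0 < residualIncrement X f h c ε i b}) hpos _

/-- The positive part of `residualIncrement` has a vanishing gradient where it vanishes and is
differentiable, because it is minimal there. -/
lemma ae_hasGradientAt_max_residualIncrement (hR : IsRound X D f h c) (hε : 0 < ε) (i : ℕ) :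
    ∀ᵐ b, HasGradientAt (fun b => max (residualIncrement X f h c ε i b) 0)
      (positiveGradient X f h c ε i b) b := by
  obtain ⟨K, hK⟩ := hR.exists_lipschitzWith_max_residualIncrement hε i
  filter_upwards [hK.ae_differentiableAt] with b hb
  by_cases hpos : 0 < residualIncrement X f h c ε i b
  · rw [positiveGradient_of_pos hpos]
    refine (hR.hasGradientAt_residualIncrement hε i b).congr_of_eventuallyEq ?_
    filter_upwards [(hR.continuous_residualIncrement hε i).continuousAt.eventually
      (lt_mem_nhds hpos)] with b' hb'
    exact max_eq_left (le_of_lt hb')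
  · rw [positiveGradient_of_not_pos hpos]
    have hmin : IsLocalMin (fun b => max (residualIncrement X f h c ε i b) 0) b :=
      Eventually.of_forall fun b' => by
        simp only [max_eq_right (not_lt.1 hpos)]
        exact le_max_right _ _
    rw [hasGradientAt_iff_hasFDerivAt, map_zero, ← hmin.fderiv_eq_zero]
    exact hb.hasFDerivAt

lemma norm_positiveGradient_le (i : ℕ) (b : Vec d) : ‖positiveGradient X f h c ε i b‖ ≤
    if 0 < residualIncrement X f h c ε i b then ‖residualGradient X f h c ε i b‖ else 0 := by
  by_cases hpos : 0 < residualIncrement X f h c ε i b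
  · rw [positiveGradient_of_pos hpos, if_pos hpos]
  · rw [positiveGradient_of_not_pos hpos, if_neg hpos, norm_zero]

/-- Where the average increment vanishes it is minimal, so its gradient vanishes as well. -/
lemma positiveGradient_zero (hR : IsRound X D f h c) (hε : 0 < ε) (b : Vec d) :
    positiveGradient X f h c ε 0 b = residualGradient X f h c ε 0 b := by
  by_cases hpos : 0 < residualIncrement X f h c ε 0 b
  · exact positiveGradient_of_pos hpos
  · rw [positiveGradient_of_not_pos hpos]
    have hmin : IsLocalMin (residualIncrement X f h c ε 0) b := Eventually.of_forall fun b' =>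
      (not_lt.1 hpos).trans (by rw [residualIncrement_zero]; exact hR.averageIncrement_nonneg hε b')
    have h1 := hmin.hasFDerivAt_eq_zero (hR.hasGradientAt_residualIncrement hε 0 b).hasFDerivAt
    exact ((map_eq_zero_iff _ (InnerProductSpace.toDual ℝ (Vec d)).injective).1 h1).symm

lemma integrable_inner_positiveGradient (hR : IsRound X D f h c) (hε : 0 < ε) {s v g : ℝ}
    (hs : 0 ≤ s) (hg : ∀ x ∈ X, ‖gradient h x‖ ≤ g) (i : ℕ) :
    Integrable (fun b => (inner ℝ (positiveGradient X f h c ε i b) (pathGradient X f h c s b) : ℝ))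
      (isoGaussian d v) := by
  obtain ⟨K, hK⟩ := hR.exists_norm_residualGradient_le (ε := ε) i
  have hmeas : Measurable (positiveGradient X f h c ε i) :=
    (hR.continuous_residualGradient hε i).measurable.indicator
      (measurableSet_lt measurable_const (hR.continuous_residualIncrement hε i).measurable)
  refine (integrable_const (K * g)).mono' (hmeas.inner
    (hR.continuous_pathGradient hs).measurable).aestronglyMeasurable (ae_of_all _ fun b => ?_)
  rw [Real.norm_eq_abs]
  refine (abs_real_inner_le_norm _ _).trans ?_
  gcongr
  · refine (norm_positiveGradient_le i b).trans ?_
    split_ifs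
    · exact hK b
    · exact K.2
  · exact hg _ (hR.pathPoint_mem s b)

/-- While `residualIncrement` is positive, the weighted losses along the path stay below a
multiple of the first one. -/
lemma sum_loss_pathPoint_le (hR : IsRound X D f h c) (hε : 0 < ε) {n : ℕ} {b : Vec d}
    (hn : ∀ i < n, 0 < residualIncrement X f h c ε (i + 1) b) :
    ∑ j ∈ Finset.range n, 4 ^ (j + 1) * h (pathPoint X f h c ((j + 1 : ℕ) : ℝ) b) ≤
      8 * h (pathPoint X f h c 0 b) := by
  have h00 := hR.nonneg_loss _ (hR.pathPoint_mem 0 b)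
  have hsum : ∑ j ∈ Finset.range n, 4 ^ (j + 1) * stepIncrement X f h c (j + 1) b
      ≤ h (pathPoint X f h c 0 b) := by
    rcases n with _ | n
    · simpa using h00
    · have h1 := hn n (Nat.lt_succ_self n)
      rw [residualIncrement] at h1
      linarith [(hR.averageIncrement_mem_Icc hε b).2]
  have hind : ∀ n, ∑ j ∈ Finset.range n, 4 ^ (j + 1) * h (pathPoint X f h c ((j + 1 : ℕ) : ℝ) b) ≤
      4 * h (pathPoint X f h c 0 b) +
        4 * ∑ j ∈ Finset.range n, 4 ^ (j + 1) * stepIncrement X f h c (j + 1) b := by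
    intro n
    rcases n with _ | n
    · simpa using h00
    rw [Finset.sum_range_succ']
    have h1 := (hR.stepIncrement_mem_Icc 0 b).1.trans (hR.stepIncrement_mem_Icc 0 b).2
    have h2 : ∑ j ∈ Finset.range n,
          4 ^ (j + 1 + 1) * h (pathPoint X f h c ((j + 1 + 1 : ℕ) : ℝ) b) ≤
        4 * ∑ j ∈ Finset.range n, 4 ^ (j + 1) * stepIncrement X f h c (j + 1) b := by
      rw [Finset.mul_sum]
      refine Finset.sum_le_sum fun j _ => ?_
      have := (hR.stepIncrement_mem_Icc (j + 1) b).1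
      calc _ = 4 * (4 ^ (j + 1) * h (pathPoint X f h c ((j + 1 + 1 : ℕ) : ℝ) b)) := by ring
        _ ≤ _ := by gcongr
    have h3 : ∑ j ∈ Finset.range n, 4 ^ (j + 1) * stepIncrement X f h c (j + 1) b ≤
        ∑ j ∈ Finset.range (n + 1), 4 ^ (j + 1) * stepIncrement X f h c (j + 1) b := by
      rw [Finset.sum_range_succ]
      have := hR.stepIncrement_nonneg (n + 1) b
      exact le_add_of_nonneg_right (by positivity)
    simp only [Nat.cast_zero, zero_add, pow_one] at h1 ⊢
    linarith
  linarith [hind n]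

/-- One unit step along the path. -/
lemma two_mul_norm_step_sq_le (hR : IsRound X D f h c) (j : ℕ) (b : Vec d) :
    2 * c * ‖pathPoint X f h c ((j + 1 : ℕ) : ℝ) b - pathPoint X f h c (j : ℝ) b‖ ^ 2 ≤
      h (pathPoint X f h c (j : ℝ) b) := by
  have h1 := hR.norm_pathPoint_sub_sq_le (Nat.cast_nonneg j)
    (Nat.cast_le.2 (Nat.le_succ j) : (j : ℝ) ≤ ((j + 1 : ℕ) : ℝ)) b
  have h2 := hR.inner_pathGradient_le (j : ℝ) ((j + 1 : ℕ) : ℝ) b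
  have e : (((j + 1 : ℕ) : ℝ) - j) = 1 := by push_cast; ring
  rw [e, one_mul] at h1
  rw [norm_sub_rev]
  linarith [hR.nonneg_loss _ (hR.pathPoint_mem ((j + 1 : ℕ) : ℝ) b)]

lemma norm_residualGradient_le (i : ℕ) (b : Vec d) : ‖residualGradient X f h c ε i b‖ ≤
    ‖residualGradient X f h c ε 0 b‖ + ∑ j ∈ Finset.range i, 4 ^ (j + 1) *
      ‖pathPoint X f h c ((j + 1 + 1 : ℕ) : ℝ) b - pathPoint X f h c ((j + 1 : ℕ) : ℝ) b‖ := by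
  have h0 : residualGradient X f h c ε 0 b =
      ε⁻¹ • (pathPoint X f h c ε b - pathPoint X f h c 0 b) := by simp [residualGradient]
  rw [h0, residualGradient]
  refine (norm_sub_le _ _).trans (add_le_add le_rfl ((norm_sum_le _ _).trans
    (Finset.sum_le_sum fun j _ => ?_)))
  have hp : (0 : ℝ) ≤ 4 ^ (j + 1) := by positivity
  rw [norm_smul, Real.norm_of_nonneg hp]

/-- The contribution of one step to the weighted divergence. -/
lemma inner_positiveGradient_le (hR : IsRound X D f h c) (i : ℕ) (b : Vec d) :
    (inner ℝ (positiveGradient X f h c ε (i + 1) b)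
      (pathGradient X f h c ((i + 1 + 1 : ℕ) : ℝ) b - pathGradient X f h c ((i + 1 : ℕ) : ℝ) b)
      : ℝ) ≤ if 0 < residualIncrement X f h c ε (i + 1) b then
        2 * c * ((‖residualGradient X f h c ε 0 b‖ + ∑ j ∈ Finset.range (i + 1), 4 ^ (j + 1) *
          ‖pathPoint X f h c ((j + 1 + 1 : ℕ) : ℝ) b - pathPoint X f h c ((j + 1 : ℕ) : ℝ) b‖) *
          ‖pathPoint X f h c ((i + 1 + 1 : ℕ) : ℝ) b - pathPoint X f h c ((i + 1 : ℕ) : ℝ) b‖)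
        else 0 := by
  have h1 : ‖pathGradient X f h c ((i + 1 + 1 : ℕ) : ℝ) b
      - pathGradient X f h c ((i + 1 : ℕ) : ℝ) b‖ ≤ 2 * c *
      ‖pathPoint X f h c ((i + 1 + 1 : ℕ) : ℝ) b - pathPoint X f h c ((i + 1 : ℕ) : ℝ) b‖ :=
    hR.norm_gradient_sub_le (hR.pathPoint_mem _ b) (hR.pathPoint_mem _ b)
  have h2 := norm_positiveGradient_le (X := X) (f := f) (h := h) (c := c) (ε := ε) (i + 1) b
  have h3 := (le_abs_self _).trans (abs_real_inner_le_norm (positiveGradient X f h c ε (i + 1) b)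
    (pathGradient X f h c ((i + 1 + 1 : ℕ) : ℝ) b - pathGradient X f h c ((i + 1 : ℕ) : ℝ) b))
  by_cases hpos : 0 < residualIncrement X f h c ε (i + 1) b
  · rw [if_pos hpos] at h2 ⊢
    have h4 := h2.trans (norm_residualGradient_le (i + 1) b)
    refine h3.trans ((mul_le_mul h4 h1 (norm_nonneg _) ((norm_nonneg _).trans h4)).trans
      (le_of_eq ?_))
    ring
  · rw [if_neg hpos] at h2 ⊢
    rwa [le_antisymm h2 (norm_nonneg _), zero_mul] at h3

/-- The gradient of the average increment is controlled by the slope of the loss. -/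
lemma two_mul_norm_residualGradient_zero_sq_le (hR : IsRound X D f h c) (hε : 0 < ε) (b : Vec d) :
    2 * c * ‖residualGradient X f h c ε 0 b‖ ^ 2 ≤ (inner ℝ (pathGradient X f h c 0 b)
      (pathPoint X f h c 0 b - pathPoint X f h c ε b) : ℝ) / ε := by
  have h0 : residualGradient X f h c ε 0 b =
      ε⁻¹ • (pathPoint X f h c ε b - pathPoint X f h c 0 b) := by simp [residualGradient]
  have h1 := hR.norm_pathPoint_sub_sq_le le_rfl hε.le b
  have h2 := hR.inner_pathGradient_le ε 0 b
  have h3 := hR.inner_pathGradient_le 0 ε b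
  rw [← neg_sub (pathPoint X f h c 0 b), inner_neg_right] at h2
  rw [h0, norm_smul, mul_pow, norm_sub_rev, norm_inv, Real.norm_of_nonneg hε.le,
    le_div_iff₀ hε]
  rw [sub_zero] at h1
  set a : ℝ := inner ℝ (pathGradient X f h c 0 b) (pathPoint X f h c 0 b - pathPoint X f h c ε b)
  set a' : ℝ := inner ℝ (pathGradient X f h c ε b) (pathPoint X f h c 0 b - pathPoint X f h c ε b)
  set q := ‖pathPoint X f h c 0 b - pathPoint X f h c ε b‖
  have h5 : 2 * c * q ^ 2 ≤ ε * a := h1.trans (mul_le_mul_of_nonneg_left (by linarith) hε.le)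
  calc 2 * c * (ε⁻¹ ^ 2 * q ^ 2) * ε = ε⁻¹ * (2 * c * q ^ 2) := by field_simp
    _ ≤ ε⁻¹ * (ε * a) := mul_le_mul_of_nonneg_left h5 (inv_pos.2 hε).le
    _ = a := by field_simp

/-- The pointwise estimate behind the stability bound: the slope of the loss along the first
segment of the path is absorbed by the weighted divergence terms. -/
lemma inner_pathGradient_zero_le (hR : IsRound X D f h c) (hε : 0 < ε) (N : ℕ) (b : Vec d) :
    (inner ℝ (pathGradient X f h c 0 b) (pathPoint X f h c 0 b - pathPoint X f h c ε b) : ℝ) / ε ≤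
      40 * h (pathPoint X f h c 0 b) - 2 * (∑ i ∈ Finset.range N,
        (inner ℝ (positiveGradient X f h c ε i b - positiveGradient X f h c ε (i + 1) b)
          (pathGradient X f h c ((i + 1 : ℕ) : ℝ) b) : ℝ) +
        inner ℝ (positiveGradient X f h c ε N b) (pathGradient X f h c ((N + 1 : ℕ) : ℝ) b)) := by
  classical
  have hc := hR.pos
  have h00 := hR.nonneg_loss _ (hR.pathPoint_mem 0 b)
  rw [sum_inner_sub_add_inner (fun i => positiveGradient X f h c ε i b)
    (fun i => pathGradient X f h c ((i + 1 : ℕ) : ℝ) b) N]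
  set p := residualGradient X f h c ε 0 b with hp
  have hp' : p = ε⁻¹ • (pathPoint X f h c ε b - pathPoint X f h c 0 b) := by
    simp [hp, residualGradient]
  rw [hR.positiveGradient_zero hε b, ← hp]
  set e := (inner ℝ (pathGradient X f h c 0 b)
    (pathPoint X f h c 0 b - pathPoint X f h c ε b) : ℝ) / ε with he
  have hpe : (inner ℝ p (pathGradient X f h c 0 b) : ℝ) = -e := by
    rw [hp', real_inner_smul_left, he, real_inner_comm, ← neg_sub (pathPoint X f h c 0 b),
      inner_neg_right]
    field_simp
  set m : ℕ → ℝ := fun j => ‖pathPoint X f h c ((j + 1 + 1 : ℕ) : ℝ) b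
    - pathPoint X f h c ((j + 1 : ℕ) : ℝ) b‖ with hm
  have hm2 : ∀ j, 2 * c * m j ^ 2 ≤ h (pathPoint X f h c ((j + 1 : ℕ) : ℝ) b) := fun j =>
    hR.two_mul_norm_step_sq_le (j + 1) b
  have hgp : 2 * c * ‖p‖ ^ 2 ≤ e := hR.two_mul_norm_residualGradient_zero_sq_le hε b
  have hfirst : (inner ℝ p (pathGradient X f h c ((0 + 1 : ℕ) : ℝ) b) : ℝ) ≤
      -e + (e / 4 + h (pathPoint X f h c 0 b)) := by
    have h1 : |(inner ℝ p (pathGradient X f h c ((0 + 1 : ℕ) : ℝ) b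
        - pathGradient X f h c 0 b) : ℝ)| ≤ e / 4 + h (pathPoint X f h c 0 b) := by
      have h2 := hR.two_mul_norm_step_sq_le 0 b
      rw [Nat.cast_zero] at h2
      have h3 : ‖pathGradient X f h c ((0 + 1 : ℕ) : ℝ) b - pathGradient X f h c 0 b‖ ≤
          2 * c * ‖pathPoint X f h c ((0 + 1 : ℕ) : ℝ) b - pathPoint X f h c 0 b‖ :=
        hR.norm_gradient_sub_le (hR.pathPoint_mem 0 b) (hR.pathPoint_mem _ b)
      set q := ‖pathPoint X f h c ((0 + 1 : ℕ) : ℝ) b - pathPoint X f h c 0 b‖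
      calc _ ≤ ‖p‖ * (2 * c * q) := (abs_real_inner_le_norm _ _).trans (by gcongr)
        _ ≤ 2 * c * ‖p‖ ^ 2 / 4 + 2 * c * q ^ 2 := by
          have : 0 ≤ 2 * c * (‖p‖ / 2 - q) ^ 2 := by positivity
          linarith
        _ ≤ _ := by linarith
    rw [inner_sub_right, hpe] at h1
    linarith [(abs_le.1 h1).2]
  have hsum : ∑ i ∈ Finset.range N, (inner ℝ (positiveGradient X f h c ε (i + 1) b)
      (pathGradient X f h c ((i + 1 + 1 : ℕ) : ℝ) b - pathGradient X f h c ((i + 1 : ℕ) : ℝ) b)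
      : ℝ) ≤ e / 4 + 56 / 3 * h (pathPoint X f h c 0 b) := by
    obtain ⟨n, hn, hn'⟩ := exists_sum_ite_eq (fun i => 0 < residualIncrement X f h c ε (i + 1) b)
      (fun i hi => hi.trans_le (hR.residualIncrement_succ_le (i + 1) b))
      (fun i => 2 * c * ((‖p‖ + ∑ j ∈ Finset.range (i + 1), 4 ^ (j + 1) * m j) * m i)) N
    have h1 := Finset.sum_le_sum fun i (_ : i ∈ Finset.range N) =>
      hR.inner_positiveGradient_le (ε := ε) i b
    rw [hn', ← Finset.mul_sum] at h1
    have h2 := mul_le_mul_of_nonneg_left (sum_add_sum_mul_le ‖p‖ m n) (by positivity : 0 ≤ 2 * c)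
    have h3 : 2 * c * ∑ j ∈ Finset.range n, 4 ^ (j + 1) * m j ^ 2 ≤
        8 * h (pathPoint X f h c 0 b) := by
      refine le_trans ?_ (hR.sum_loss_pathPoint_le hε hn)
      rw [Finset.mul_sum]
      refine Finset.sum_le_sum fun j _ => ?_
      calc _ = 4 ^ (j + 1) * (2 * c * m j ^ 2) := by ring
        _ ≤ _ := by gcongr; exact hm2 j
    have h4 : 2 * c * (‖p‖ ^ 2 / 4 + 7 / 3 * ∑ j ∈ Finset.range n, 4 ^ (j + 1) * m j ^ 2) =
      (2 * c * ‖p‖ ^ 2) / 4 + 7 / 3 * (2 * c * ∑ j ∈ Finset.range n, 4 ^ (j + 1) * m j ^ 2) := by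
      ring
    linarith
  refine le_trans ?_ (sub_le_sub_left (mul_le_mul_of_nonneg_left (add_le_add hfirst hsum)
    zero_le_two) _)
  linarith

end IsRound

lemma max_sub_max_sub_le {a t : ℝ} (ht : 0 ≤ t) : max a 0 - max (a - t) 0 ≤ t := by
  rcases le_total a 0 with h1 | h1
  · rw [max_eq_right h1]; linarith [le_max_right (a - t) 0]
  · rw [max_eq_left h1]; linarith [le_max_left (a - t) 0]

lemma sum_pow_mul_exp_le (N : ℕ) : ∑ i ∈ Finset.range N,
    (4 : ℝ) ^ (i + 1) * (2 * Real.exp (-(4 * ((i + 1 : ℕ) : ℝ)))) ≤ 2 / 3 := by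
  have hterm : ∀ i : ℕ, (4 : ℝ) ^ (i + 1) * (2 * Real.exp (-(4 * ((i + 1 : ℕ) : ℝ)))) ≤
      2 * (1 / 4) ^ (i + 1) := by
    intro i
    have h1 : Real.exp (-4) ≤ 1 / 16 := by
      have h2 : (2 : ℝ) ≤ Real.exp 1 := by linarith [Real.add_one_le_exp (1 : ℝ)]
      have h3 : Real.exp 4 = Real.exp 1 ^ 4 := by rw [← Real.exp_nat_mul]; norm_num
      rw [Real.exp_neg, inv_eq_one_div, h3]
      refine one_div_le_one_div_of_le (by norm_num) ?_
      calc (16 : ℝ) = 2 ^ 4 := by norm_num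
        _ ≤ _ := by gcongr
    have h4 : Real.exp (-(4 * ((i + 1 : ℕ) : ℝ))) = Real.exp (-4) ^ (i + 1) := by
      rw [← Real.exp_nat_mul]; ring_nf
    rw [h4]
    calc (4 : ℝ) ^ (i + 1) * (2 * Real.exp (-4) ^ (i + 1))
        = 2 * (4 * Real.exp (-4)) ^ (i + 1) := by rw [mul_pow]; ring
      _ ≤ _ := by
        gcongr
        linarith
  have hgeom : ∀ N : ℕ, ∑ i ∈ Finset.range N, 2 * (1 / 4 : ℝ) ^ (i + 1) =
      2 / 3 * (1 - (1 / 4) ^ N) := by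
    intro N
    induction N with
    | zero => simp
    | succ N ih => rw [Finset.sum_range_succ, ih]; ring
  refine (Finset.sum_le_sum fun i _ => hterm i).trans ?_
  rw [hgeom]
  have : (0 : ℝ) ≤ (1 / 4) ^ N := by positivity
  linarith

namespace IsRound

variable {d : ℕ} {X : Set (Vec d)} {D : ℝ} {f h : Vec d → ℝ} {c ε : ℝ}

/-- Integration by parts turns a divergence term into a mean of logarithmic density ratios, which
are at most `6` up to an exponentially small part. -/
lemma neg_integral_inner_le (hR : IsRound X D f h c) {s v g M A : ℝ} (hs : 1 ≤ s) (hv : 0 < v)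
    (hg' : ∀ x ∈ X, ‖gradient h x‖ ≤ g)
    (hg : ∀ x ∈ X, s * ‖gradient h x‖ ^ 2 ≤ 2 * v) {k : Vec d → ℝ} (hk0 : ∀ x ∈ X, 0 ≤ k x)
    (hkM : ∀ x ∈ X, k x ≤ M) (hk : ∀ r, 0 ≤ r → Continuous fun b => k (pathPoint X f h c r b))
    (hA : 0 ≤ A) {w : Vec d → ℝ} {w' : Vec d → Vec d}
    {K : ℝ≥0} (hw : LipschitzWith K w) (hw0 : ∀ b, 0 ≤ w b)
    (hwk : ∀ b, w b ≤ A * k (pathPoint X f h c s b))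
    (hw' : ∀ᵐ b, HasGradientAt w (w' b) b)
    (hi : Integrable (fun b => (inner ℝ (w' b) (pathGradient X f h c s b) : ℝ))
      (isoGaussian d v)) :
    -∫ b, inner ℝ (w' b) (pathGradient X f h c s b) ∂isoGaussian d v ≤
      6 * ∫ b, w b ∂isoGaussian d v +
        A * (2 * Real.exp (-(4 * s)) * ∫ b, k (pathPoint X f h c 0 b) ∂isoGaussian d v) := by
  have hs0 : 0 ≤ s := by linarith
  have hwM : ∀ b, w b ≤ A * M := fun b =>
    (hwk b).trans (mul_le_mul_of_nonneg_left (hkM _ (hR.pathPoint_mem s b)) hA)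
  have hparts := hR.integral_mul_inner_pathGradient_le hs0 hv hg' hw hw0 hwM hw' hi
  obtain ⟨htail, htail'⟩ := hR.integral_mul_max_le hs hv hg hk0 hkM hk
  have hint := hR.integrable_mul_inner_pathGradient hs0 hv.le hg' hw.continuous
    (M := A * M) fun b => by rw [abs_of_nonneg (hw0 b)]; exact hwM b
  have hwint : Integrable w (isoGaussian d v) :=
    (integrable_const (A * M)).mono' hw.continuous.aestronglyMeasurable (ae_of_all _ fun b => by
      rw [Real.norm_of_nonneg (hw0 b)]; exact hwM b)
  have h1 : -((∫ b, w b * inner ℝ b (pathGradient X f h c s b) ∂isoGaussian d v) / v) ≤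
      6 * ∫ b, w b ∂isoGaussian d v + A * ∫ b, k (pathPoint X f h c s b) *
          max (-(inner ℝ b (pathGradient X f h c s b) / v) - 6) 0 ∂isoGaussian d v := by
    rw [← integral_div, ← integral_neg, ← integral_const_mul, ← integral_const_mul,
      ← integral_add (hwint.const_mul 6) (htail.const_mul A)]
    refine integral_mono (hint.div_const v).neg ((hwint.const_mul 6).add (htail.const_mul A))
      fun b => ?_
    have h2 := mul_le_mul_of_nonneg_left
      (le_max_left (-(inner ℝ b (pathGradient X f h c s b) / v) - 6) 0) (hw0 b)
    have h3 := mul_le_mul_of_nonneg_right (hwk b)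
      (le_max_right (-(inner ℝ b (pathGradient X f h c s b) / v) - 6) 0)
    simp only [mul_div_assoc]
    linarith
  have h4 : (∫ b, w b * inner ℝ b (pathGradient X f h c s b) ∂isoGaussian d v) / v ≤
      ∫ b, inner ℝ (w' b) (pathGradient X f h c s b) ∂isoGaussian d v := by
    rw [div_le_iff₀ hv, mul_comm]; exact hparts
  have h5 := mul_le_mul_of_nonneg_left htail' hA
  linarith

/-- The stability bound for one round: in expectation, the slope of the loss along the first
segment of the path is bounded by the loss itself. -/
lemma integral_slope_le (hR : IsRound X D f h c) (hε : 0 < ε) {v M : ℝ} {N : ℕ} (hv : 0 < v)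
    (hg : ∀ x ∈ X, ((N + 1 : ℕ) : ℝ) * ‖gradient h x‖ ^ 2 ≤ 2 * v)
    (hM : ∀ x ∈ X, h x ≤ M) :
    Integrable (fun b => (inner ℝ (pathGradient X f h c 0 b)
        (pathPoint X f h c 0 b - pathPoint X f h c ε b) : ℝ) / ε) (isoGaussian d v) ∧
    ∫ b, (inner ℝ (pathGradient X f h c 0 b)
        (pathPoint X f h c 0 b - pathPoint X f h c ε b) : ℝ) / ε ∂isoGaussian d v ≤
      54 * ∫ b, h (pathPoint X f h c 0 b) ∂isoGaussian d v +
        4 * (M * Real.exp (-(4 * ((N + 1 : ℕ) : ℝ)))) := by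
  set ν := isoGaussian d v with hν
  have hM0 : 0 ≤ M := (hR.nonneg_loss _ (hR.pathPoint_mem 0 0)).trans (hM _ (hR.pathPoint_mem 0 0))
  have hg' : ∀ x ∈ X, ‖gradient h x‖ ≤ √(2 * v) := fun x hx => Real.le_sqrt_of_sq_le (by
    have := hg x hx
    push_cast at this
    nlinarith [Nat.cast_nonneg (α := ℝ) N, sq_nonneg ‖gradient h x‖])
  have hgi : ∀ i ≤ N, ∀ x ∈ X, ((i + 1 : ℕ) : ℝ) * ‖gradient h x‖ ^ 2 ≤ 2 * v := fun i hi x hx =>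
    le_trans (by gcongr) (hg x hx)
  have hone : ∀ i : ℕ, (1 : ℝ) ≤ ((i + 1 : ℕ) : ℝ) := fun i => by
    push_cast; linarith [Nat.cast_nonneg (α := ℝ) i]
  have hhint : ∀ s, 0 ≤ s → Integrable (fun b => h (pathPoint X f h c s b)) ν := fun s hs =>
    (integrable_const M).mono' (hR.continuous_loss_pathPoint hs).aestronglyMeasurable
      (ae_of_all _ fun b => by
        rw [Real.norm_of_nonneg (hR.nonneg_loss _ (hR.pathPoint_mem s b))]
        exact hM _ (hR.pathPoint_mem s b))
  set H := ∫ b, h (pathPoint X f h c 0 b) ∂ν with hH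
  have hH0 : 0 ≤ H := integral_nonneg fun b => hR.nonneg_loss _ (hR.pathPoint_mem 0 b)
  set C : ℕ → Vec d → ℝ := fun i b => max (residualIncrement X f h c ε i b) 0 with hC
  have hC0 : ∀ i b, 0 ≤ C i b := fun i b => le_max_right _ _
  have hCle : ∀ i b, C i b ≤ h (pathPoint X f h c 0 b) := fun i b =>
    max_le (hR.residualIncrement_le hε i b) (hR.nonneg_loss _ (hR.pathPoint_mem 0 b))
  have hCmono : ∀ i b, C (i + 1) b ≤ C i b := fun i b =>
    max_le_max (hR.residualIncrement_succ_le i b) le_rfl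
  have hCint : ∀ i, Integrable (C i) ν := fun i =>
    (integrable_const M).mono'
      ((hR.continuous_residualIncrement hε i).max continuous_const).aestronglyMeasurable
      (ae_of_all _ fun b => by
        rw [Real.norm_of_nonneg (hC0 i b)]
        exact (hCle i b).trans (hM _ (hR.pathPoint_mem 0 b)))
  have hPint : ∀ i j : ℕ, Integrable (fun b => (inner ℝ (positiveGradient X f h c ε i b)
      (pathGradient X f h c (j : ℝ) b) : ℝ)) ν := fun i j =>
    hR.integrable_inner_positiveGradient hε (Nat.cast_nonneg j) hg' i
  -- The contribution of the inner steps.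
  have hstep : ∀ i < N, -∫ b, (inner ℝ (positiveGradient X f h c ε i b
      - positiveGradient X f h c ε (i + 1) b) (pathGradient X f h c ((i + 1 : ℕ) : ℝ) b) : ℝ) ∂ν ≤
      6 * (∫ b, C i b ∂ν - ∫ b, C (i + 1) b ∂ν) +
        4 ^ (i + 1) * (2 * Real.exp (-(4 * ((i + 1 : ℕ) : ℝ))) * H) := by
    intro i hi
    obtain ⟨K, hK⟩ := hR.exists_lipschitzWith_max_residualIncrement hε i
    obtain ⟨K', hK'⟩ := hR.exists_lipschitzWith_max_residualIncrement hε (i + 1)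
    rw [← integral_sub (hCint i) (hCint (i + 1))]
    refine hR.neg_integral_inner_le (hone i) hv hg' (hgi i hi.le) hR.nonneg_loss hM
      (fun r hr => hR.continuous_loss_pathPoint hr) (by positivity) (hK.sub hK')
      (fun b => sub_nonneg.2 (hCmono i b)) (fun b => ?_) ?_ ?_
    · have h1 := hR.stepIncrement_mem_Icc (i + 1) b
      have h2 := hR.stepIncrement_nonneg (i + 1) b
      simp only [hC, residualIncrement_succ]
      exact (max_sub_max_sub_le (by positivity)).trans (by gcongr; exact h1.2)
    · filter_upwards [hR.ae_hasGradientAt_max_residualIncrement hε i,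
        hR.ae_hasGradientAt_max_residualIncrement hε (i + 1)] with b hb hb'
      rw [hasGradientAt_iff_hasFDerivAt, map_sub]
      exact hb.hasFDerivAt.sub hb'.hasFDerivAt
    · exact ((hPint i (i + 1)).sub (hPint (i + 1) (i + 1))).congr
        (ae_of_all _ fun b => (inner_sub_left _ _ _).symm)
  -- The contribution of the last step, where only boundedness of the loss is left.
  have hlast : -∫ b, (inner ℝ (positiveGradient X f h c ε N b)
      (pathGradient X f h c ((N + 1 : ℕ) : ℝ) b) : ℝ) ∂ν ≤
      6 * ∫ b, C N b ∂ν + M * (2 * Real.exp (-(4 * ((N + 1 : ℕ) : ℝ)))) := by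
    obtain ⟨K, hK⟩ := hR.exists_lipschitzWith_max_residualIncrement hε N
    have := hR.neg_integral_inner_le (hone N) hv hg' (hgi N le_rfl) (k := fun _ => 1)
      (fun _ _ => zero_le_one) (fun _ _ => le_rfl) (fun r hr => continuous_const) hM0 hK (hC0 N)
      (fun b => by rw [mul_one]; exact (hCle N b).trans (hM _ (hR.pathPoint_mem 0 b)))
      (hR.ae_hasGradientAt_max_residualIncrement hε N) (hPint N (N + 1))
    simpa using this
  have htotal : -∫ b, (∑ i ∈ Finset.range N,
        (inner ℝ (positiveGradient X f h c ε i b - positiveGradient X f h c ε (i + 1) b)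
          (pathGradient X f h c ((i + 1 : ℕ) : ℝ) b) : ℝ) +
        inner ℝ (positiveGradient X f h c ε N b) (pathGradient X f h c ((N + 1 : ℕ) : ℝ) b)) ∂ν ≤
      6 * H + 2 / 3 * H + M * (2 * Real.exp (-(4 * ((N + 1 : ℕ) : ℝ)))) := by
    rw [integral_add (integrable_finsetSum _ fun i _ => by
      simp only [inner_sub_left]; exact (hPint i (i + 1)).sub (hPint (i + 1) (i + 1)))
      (hPint N (N + 1)), integral_finsetSum _ fun i _ => by
      simp only [inner_sub_left]; exact (hPint i (i + 1)).sub (hPint (i + 1) (i + 1))]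
    have h1 := Finset.sum_le_sum fun i (hi : i ∈ Finset.range N) => hstep i (Finset.mem_range.1 hi)
    rw [Finset.sum_neg_distrib, Finset.sum_add_distrib, ← Finset.mul_sum,
      Finset.sum_range_sub' (fun i => ∫ b, C i b ∂ν)] at h1
    simp only [← mul_assoc] at h1
    rw [← Finset.sum_mul] at h1
    have h2 := mul_le_mul_of_nonneg_right (sum_pow_mul_exp_le N) hH0
    simp only [← mul_assoc] at h2
    have h3 : ∫ b, C 0 b ∂ν ≤ H := integral_mono (hCint 0) (hhint 0 le_rfl) (hCle 0)
    linarith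
  have hTint : Integrable (fun b => ∑ i ∈ Finset.range N,
        (inner ℝ (positiveGradient X f h c ε i b - positiveGradient X f h c ε (i + 1) b)
          (pathGradient X f h c ((i + 1 : ℕ) : ℝ) b) : ℝ) +
        inner ℝ (positiveGradient X f h c ε N b)
          (pathGradient X f h c ((N + 1 : ℕ) : ℝ) b)) ν :=
    (integrable_finsetSum _ fun i _ => by
      simp only [inner_sub_left]; exact (hPint i (i + 1)).sub (hPint (i + 1) (i + 1))).add
      (hPint N (N + 1))
  have heint : Integrable (fun b => (inner ℝ (pathGradient X f h c 0 b)
        (pathPoint X f h c 0 b - pathPoint X f h c ε b) : ℝ) / ε) ν := by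
    refine Integrable.div_const ?_ ε
    refine (integrable_const (√(2 * v) * (D + D))).mono' ((hR.continuous_pathGradient le_rfl).inner
      ((hR.continuous_pathPoint le_rfl).sub
        (hR.continuous_pathPoint hε.le))).aestronglyMeasurable (ae_of_all _ fun b => ?_)
    rw [Real.norm_eq_abs]
    refine (abs_real_inner_le_norm _ _).trans (mul_le_mul (hg' _ (hR.pathPoint_mem 0 b))
      ((norm_sub_le _ _).trans (add_le_add (hR.actionSet.norm_le _ (hR.pathPoint_mem 0 b))
      (hR.actionSet.norm_le _ (hR.pathPoint_mem ε b)))) (norm_nonneg _) (Real.sqrt_nonneg _))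
  refine ⟨heint, ?_⟩
  have hfinal := integral_mono heint (((hhint 0 le_rfl).const_mul 40).sub (hTint.const_mul 2))
    fun b => hR.inner_pathGradient_zero_le hε N b
  simp only [Pi.sub_apply] at hfinal
  rw [integral_sub ((hhint 0 le_rfl).const_mul 40) (hTint.const_mul 2), integral_const_mul,
    integral_const_mul] at hfinal
  linarith

/-- Playing the minimizer before the loss `ε h` is seen costs little more than the increase of the
potential. -/
lemma integral_loss_le (hR : IsRound X D f h c) (hε : 0 < ε) {v M : ℝ} {N : ℕ} (hv : 0 < v)
    (hg : ∀ x ∈ X, ((N + 1 : ℕ) : ℝ) * ‖gradient h x‖ ^ 2 ≤ 2 * v)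
    (hM : ∀ x ∈ X, h x ≤ M) :
    ∫ b, h (pathPoint X f h c 0 b) ∂isoGaussian d v ≤
      ∫ b, averageIncrement X f h c ε b ∂isoGaussian d v +
        ε * (54 * ∫ b, h (pathPoint X f h c 0 b) ∂isoGaussian d v +
        4 * (M * Real.exp (-(4 * ((N + 1 : ℕ) : ℝ))))) := by
  obtain ⟨hi, hle⟩ := hR.integral_slope_le hε hv hg hM
  have hψ : Continuous (averageIncrement X f h c ε) := by
    have := hR.continuous_residualIncrement hε 0
    rwa [show residualIncrement X f h c ε 0 = averageIncrement X f h c ε from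
      funext fun b => residualIncrement_zero b] at this
  have hψint : Integrable (averageIncrement X f h c ε) (isoGaussian d v) :=
    (integrable_const M).mono' hψ.aestronglyMeasurable (ae_of_all _ fun b => by
      rw [Real.norm_of_nonneg (hR.averageIncrement_nonneg hε b)]
      exact (hR.averageIncrement_mem_Icc hε b).2.trans (hM _ (hR.pathPoint_mem 0 b)))
  have hhint : Integrable (fun b => h (pathPoint X f h c 0 b)) (isoGaussian d v) :=
    (integrable_const M).mono' (hR.continuous_loss_pathPoint le_rfl).aestronglyMeasurable
      (ae_of_all _ fun b => by
        rw [Real.norm_of_nonneg (hR.nonneg_loss _ (hR.pathPoint_mem 0 b))]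
        exact hM _ (hR.pathPoint_mem 0 b))
  have h1 := integral_mono hhint (hψint.add (hi.const_mul ε)) fun b => by
    have h2 := (hR.averageIncrement_mem_Icc hε b).1
    have h3 := hR.inner_pathGradient_le ε 0 b
    rw [← neg_sub (pathPoint X f h c 0 b), inner_neg_right] at h3
    simp only [Pi.add_apply]
    rw [mul_div_cancel₀ _ hε.ne']
    linarith
  simp only [Pi.add_apply] at h1
  rw [integral_add hψint (hi.const_mul ε), integral_const_mul] at h1
  have h4 := mul_le_mul_of_nonneg_left hle hε.le
  linarith

end IsRound

/-! ### Translations of Gaussian noise -/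

lemma lintegral_gaussian_comp_sub {d : ℕ} {v : ℝ} (hv : 0 < v) (g : Vec d) (u : Vec d → ℝ≥0∞) :
    ∫⁻ b, u (b - g) ∂isoGaussian d v = ∫⁻ b, ENNReal.ofReal (Real.exp
      (-(inner ℝ b g / v) - ‖g‖ ^ 2 / (2 * v))) * u b ∂isoGaussian d v := by
  obtain ⟨Z, hZ⟩ := exists_lintegral_multivariateGaussian_eq (d := d) hv
  rw [isoGaussian, hZ, hZ]
  congr 1
  rw [← lintegral_add_right_eq_self _ g]
  refine lintegral_congr fun b => ?_
  have h1 := exp_neg_norm_sub_sq v b (-g)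
  rw [sub_neg_eq_add, inner_neg_right, norm_neg, neg_div v (inner ℝ b g)] at h1
  rw [add_sub_cancel_right, h1, ENNReal.ofReal_mul (Real.exp_pos _).le, mul_assoc]

/-- The moment generating function of a linear functional of Gaussian noise. -/
lemma lintegral_exp_inner_gaussian {d : ℕ} {v : ℝ} (hv : 0 < v) (g : Vec d) (r : ℝ) :
    ∫⁻ b, ENNReal.ofReal (Real.exp (r * -(inner ℝ b g / v))) ∂isoGaussian d v =
      ENNReal.ofReal (Real.exp (r ^ 2 * ‖g‖ ^ 2 / (2 * v))) := by
  have h1 := lintegral_gaussian_comp_sub hv (r • g) fun _ => 1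
  simp only [lintegral_one, measure_univ, mul_one] at h1
  have h2 : ∀ b : Vec d, ENNReal.ofReal (Real.exp (r * -(inner ℝ b g / v))) =
      ENNReal.ofReal (Real.exp (r ^ 2 * ‖g‖ ^ 2 / (2 * v))) * ENNReal.ofReal (Real.exp
        (-(inner ℝ b (r • g) / v) - ‖r • g‖ ^ 2 / (2 * v))) := fun b => by
    rw [← ENNReal.ofReal_mul (Real.exp_pos _).le, ← Real.exp_add, real_inner_smul_right, norm_smul,
      mul_pow, Real.norm_eq_abs, sq_abs]
    ring_nf
  simp_rw [h2]
  rw [lintegral_const_mul' _ _ ENNReal.ofReal_ne_top, ← h1, mul_one]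

lemma exp_le_exp_add_mul_exp {a r s : ℝ} (hs : 0 < s) :
    Real.exp r ≤ Real.exp a + s⁻¹ * (Real.exp (-(s * a)) * Real.exp ((1 + s) * r)) := by
  have h1 : (r - a) * Real.exp r ≤ s⁻¹ * (Real.exp (-(s * a)) * Real.exp ((1 + s) * r)) := by
    have e : Real.exp (-(s * a)) * Real.exp ((1 + s) * r) =
        Real.exp (s * (r - a)) * Real.exp r := by
      rw [← Real.exp_add, ← Real.exp_add]; ring_nf
    rw [e, ← mul_assoc]
    gcongr
    rw [le_inv_mul_iff₀ hs]
    linarith [Real.add_one_le_exp (s * (r - a))]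
  have h2 : Real.exp r - (r - a) * Real.exp r ≤ Real.exp a := by
    have h3 := Real.add_one_le_exp (a - r)
    have e : Real.exp a = Real.exp (a - r) * Real.exp r := by rw [← Real.exp_add]; ring_nf
    rw [e, ← one_sub_mul]
    gcongr
    linarith
  linarith

/-- Translating Gaussian noise by a vector that is short relative to the standard deviation
changes expectations by a factor close to `1`, up to an exponentially small term. -/
lemma integral_gaussian_comp_sub_le {d : ℕ} {v ε Λ M : ℝ} (hv : 0 < v) (hε : 0 < ε) (hε1 : ε ≤ 1)
    (hΛ : 1 ≤ Λ) {g : Vec d} (hg : Λ * ‖g‖ ^ 2 ≤ ε ^ 2 * v) {u : Vec d → ℝ} (hu : Continuous u)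
    (hu0 : ∀ b, 0 ≤ u b) (huM : ∀ b, u b ≤ M) :
    ∫ b, u (b - g) ∂isoGaussian d v ≤
      Real.exp (6 * ε) * ∫ b, u b ∂isoGaussian d v + ε * (M * Real.exp (-(4 * Λ))) := by
  set ν := isoGaussian d v with hν
  have hM : 0 ≤ M := (hu0 0).trans (huM 0)
  have hΛ0 : 0 < Λ := by linarith
  have hint : ∀ g : Vec d, Integrable (fun b => u (b - g)) ν := fun g =>
    Integrable.of_bound (by fun_prop) M (ae_of_all _ fun b => by
      rw [Real.norm_of_nonneg (hu0 _)]; exact huM _)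
  have hint0 : Integrable u ν := by simpa using hint 0
  -- The exponent of the tail estimate.
  set s := Λ / ε with hs
  have hs0 : 0 < s := by positivity
  have hexp : Real.exp (-(s * (6 * ε))) * Real.exp ((1 + s) ^ 2 * ‖g‖ ^ 2 / (2 * v)) ≤
      Real.exp (-(4 * Λ)) := by
    rw [← Real.exp_add]
    refine Real.exp_le_exp.2 ?_
    have h1 : s * (6 * ε) = 6 * Λ := by rw [hs]; field_simp
    have h2 : (1 + s) ^ 2 * ‖g‖ ^ 2 / (2 * v) ≤ 2 * Λ := by
      rw [div_le_iff₀ (by positivity)]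
      have h3 : 1 + s ≤ 2 * s := by
        have : 1 ≤ s := by rw [hs, le_div_iff₀ hε]; linarith
        linarith
      have h4 : (1 + s) ^ 2 * ‖g‖ ^ 2 ≤ (2 * s) ^ 2 * ‖g‖ ^ 2 := by gcongr
      have h5 : (2 * s) ^ 2 * ‖g‖ ^ 2 = 4 * Λ / ε ^ 2 * (Λ * ‖g‖ ^ 2) := by
        rw [hs]; field_simp; ring
      have h6 : 4 * Λ / ε ^ 2 * (Λ * ‖g‖ ^ 2) ≤ 4 * Λ / ε ^ 2 * (ε ^ 2 * v) := by gcongr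
      have h7 : 4 * Λ / ε ^ 2 * (ε ^ 2 * v) = 2 * Λ * (2 * v) := by field_simp; ring
      linarith
    linarith
  have hle : ∫⁻ b, ENNReal.ofReal (u (b - g)) ∂ν ≤
      ENNReal.ofReal (Real.exp (6 * ε)) * ∫⁻ b, ENNReal.ofReal (u b) ∂ν +
        ENNReal.ofReal (ε * (M * Real.exp (-(4 * Λ)))) := by
    rw [lintegral_gaussian_comp_sub hv g fun b => ENNReal.ofReal (u b)]
    set A : ℝ≥0∞ := ENNReal.ofReal (M * (s⁻¹ * Real.exp (-(s * (6 * ε)))))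
    calc _ ≤ ∫⁻ b, (ENNReal.ofReal (Real.exp (6 * ε)) * ENNReal.ofReal (u b) +
          A * ENNReal.ofReal (Real.exp ((1 + s) * -(inner ℝ b g / v)))) ∂ν := by
          refine lintegral_mono fun b => ?_
          rw [← ENNReal.ofReal_mul (Real.exp_pos _).le, ← ENNReal.ofReal_mul (Real.exp_pos _).le,
            ← ENNReal.ofReal_mul (by positivity), ← ENNReal.ofReal_add
              (mul_nonneg (Real.exp_pos _).le (hu0 b)) (by positivity)]
          refine ENNReal.ofReal_le_ofReal ?_
          have h1 : Real.exp (-(inner ℝ b g / v) - ‖g‖ ^ 2 / (2 * v)) ≤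
              Real.exp (-(inner ℝ b g / v)) :=
            Real.exp_le_exp.2 (sub_le_self _ (by positivity))
          have h2 := h1.trans (exp_le_exp_add_mul_exp (a := 6 * ε) hs0)
          set t := s⁻¹ * (Real.exp (-(s * (6 * ε))) *
            Real.exp ((1 + s) * -(inner ℝ b g / v))) with ht
          have ht0 : 0 ≤ t := by positivity
          have h3 := mul_le_mul_of_nonneg_right h2 (hu0 b)
          have h4 := mul_le_mul_of_nonneg_left (huM b) ht0
          have e : M * (s⁻¹ * Real.exp (-(s * (6 * ε)))) *
            Real.exp ((1 + s) * -(inner ℝ b g / v)) = t * M := by rw [ht]; ring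
          rw [e]
          linarith
      _ = ENNReal.ofReal (Real.exp (6 * ε)) * ∫⁻ b, ENNReal.ofReal (u b) ∂ν +
          A * ENNReal.ofReal (Real.exp ((1 + s) ^ 2 * ‖g‖ ^ 2 / (2 * v))) := by
          rw [lintegral_add_left (by fun_prop), lintegral_const_mul' _ _ ENNReal.ofReal_ne_top,
            lintegral_const_mul' _ _ ENNReal.ofReal_ne_top, lintegral_exp_inner_gaussian hv]
      _ ≤ _ := by
          gcongr
          rw [← ENNReal.ofReal_mul (by positivity)]
          refine ENNReal.ofReal_le_ofReal ?_
          have h1 : s⁻¹ ≤ ε := by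
            rw [hs, inv_div, div_le_iff₀ hΛ0]; nlinarith
          calc _ = M * (s⁻¹ * (Real.exp (-(s * (6 * ε))) *
              Real.exp ((1 + s) ^ 2 * ‖g‖ ^ 2 / (2 * v)))) := by ring
            _ ≤ M * (ε * Real.exp (-(4 * Λ))) := by gcongr
            _ = _ := by ring
  rw [integral_eq_lintegral_of_nonneg_ae (ae_of_all _ fun b => hu0 _) (hint g).1,
    integral_eq_lintegral_of_nonneg_ae (ae_of_all _ hu0) hint0.1]
  have hfin : ∫⁻ b, ENNReal.ofReal (u b) ∂ν ≠ ∞ := hint0.lintegral_lt_top.ne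
  have h1 := ENNReal.toReal_mono (ENNReal.add_ne_top.2
    ⟨ENNReal.mul_ne_top ENNReal.ofReal_ne_top hfin, ENNReal.ofReal_ne_top⟩) hle
  rwa [ENNReal.toReal_add (ENNReal.mul_ne_top ENNReal.ofReal_ne_top hfin) ENNReal.ofReal_ne_top,
    ENNReal.toReal_mul, ENNReal.toReal_ofReal (Real.exp_pos _).le,
    ENNReal.toReal_ofReal (by positivity)] at h1

/-! ### Regret under Gaussian noise -/

/-- The increase of the potential is at most the loss of the minimizer. -/
lemma potentialIncrement_le_loss {d T : ℕ} {X : Set (Vec d)} {loss : Fin T → Vec d → ℝ}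
    {D B β γ c : ℝ} (hX : IsActionSet X D) (h : IsLossSequence X loss B β γ) (t : Fin T)
    {b x : Vec d} (hx : x ∈ X) (hm : IsMinOn (tilted (lossBefore loss t) c b) X x) :
    potentialIncrement X loss c t b ≤ loss t x := by
  have h1 := potential_le hX (fun y hy => h.differentiableAt_lossBefore (t + 1) hy) c b hx
  rw [potentialIncrement, potential_eq_of_isMinOn hx hm]
  rw [lossBefore_succ] at h1 ⊢
  simp only [tilted, Pi.add_apply] at h1 ⊢
  linarith

/-- The stability bound in one round of the game, without curvature: all losses are affine on
`X`, and being one round behind is a translation of the noise. -/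
lemma integral_loss_le_of_curvature_eq_zero {d T : ℕ} {X : Set (Vec d)}
    {loss : Fin T → Vec d → ℝ} {D B β v ε Λ M : ℝ} (hX : IsActionSet X D)
    (h : IsLossSequence X loss B β 0) (hv : 0 < v) (hε : 0 < ε) (hε1 : 12 * ε ≤ 1)
    (hΛ : 1 ≤ Λ) (hβv : Λ * β ^ 2 ≤ ε ^ 2 * v) {t : Fin T} (hM : ∀ x ∈ X, loss t x ≤ M)
    {Ω : Type*} [MeasurableSpace Ω] {P : Measure Ω} [IsProbabilityMeasure P]
    {b x : Fin T → Ω → Vec d} (hrun : IsObjPertRun P X loss 0 ε (isoGaussian d v) b x)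
    (hint : Integrable (fun ω => loss t (x t ω)) P) :
    ∫ ω, loss t (x t ω) ∂P ≤ ∫ b, potentialIncrement X loss (0 / ε) t b ∂isoGaussian d v +
      ε * (54 * ∫ ω, loss t (x t ω) ∂P + 4 * (M * Real.exp (-(4 * Λ)))) := by
  obtain ⟨z, hz⟩ := hX.nonempty
  set ψ := potentialIncrement X loss (0 / ε) t
  have hmin : ∀ ω, IsMinOn (tilted (lossBefore loss t) (0 / ε) (b t ω)) X (x t ω) := fun ω => by
    have := hrun.move_isMin t ω
    rwa [perturbedObjective_eq_tilted] at this
  have hψc : Continuous ψ := continuous_potentialIncrement hX h _ t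
  have hψ0 : ∀ b, 0 ≤ ψ b := fun b => (potentialIncrement_mem_Icc hX h t b).1
  have hψM : ∀ b, ψ b ≤ M := fun b => by
    obtain ⟨y, hy, hm⟩ := exists_isMinOn_tilted hX
      (fun y hy => h.differentiableAt_lossBefore t hy) (0 / ε) b
    exact (potentialIncrement_le_loss hX h t hy hm).trans (hM y hy)
  have hM0 : 0 ≤ M := (h.nonneg t z hz).trans (hM z hz)
  set g := gradient (loss t) z
  have hgrad : ∀ y ∈ X, gradient (loss t) y = g := fun y hy =>
    gradient_eq_of_eigenvalue_nonpos (h.convexOn t) (h.twiceDifferentiable t)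
      (h.eigenvalue_le t) (h.rank_le_one t) hy hz
  have hψint : ∀ g, Integrable (fun b => ψ (b - g)) (isoGaussian d v) := fun g =>
    Integrable.of_bound (by fun_prop) M (ae_of_all _ fun b => by
      rw [Real.norm_of_nonneg (hψ0 _)]; exact hψM _)
  have hpull : ∀ g, ∫ ω, ψ (b t ω - g) ∂P = ∫ b, ψ (b - g) ∂isoGaussian d v := fun g => by
    rw [← hrun.noise_law t]
    exact (integral_map (hrun.measurable_noise t).aemeasurable
      (by fun_prop : Continuous fun b => ψ (b - g)).aestronglyMeasurable).symm
  have hpint : ∀ g, Integrable (fun ω => ψ (b t ω - g)) P := fun g => by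
    have := hrun.measurable_noise t
    exact Integrable.of_bound (hψc.measurable.comp (this.sub_const g)).aestronglyMeasurable M
      (ae_of_all _ fun ω => by rw [Real.norm_of_nonneg (hψ0 _)]; exact hψM _)
  have h1 : ∫ ω, loss t (x t ω) ∂P ≤ ∫ b, ψ (b - g) ∂isoGaussian d v := by
    rw [← hpull]
    refine integral_mono hint (hpint g) fun ω => ?_
    have := loss_le_potential_sub hX (h.convexOn_lossBefore hX.convex t) (h.convexOn t)
      (by simp) (hrun.move_mem t ω) (fun y hy => h.differentiableAt_lossBefore _ hy)
      (h.differentiableAt t (hrun.move_mem t ω)) (hmin ω)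
    rwa [hgrad _ (hrun.move_mem t ω), ← lossBefore_succ] at this
  have h2 := integral_gaussian_comp_sub_le (ε := ε) (Λ := Λ) hv hε (by linarith) hΛ (g := g)
    (le_trans (by gcongr; exact h.norm_gradient_le t z hz) hβv) hψc hψ0 hψM
  have h3 : ∫ b, ψ b ∂isoGaussian d v ≤ ∫ ω, loss t (x t ω) ∂P := by
    have := hpull 0
    simp only [sub_zero] at this
    rw [← this]
    refine integral_mono (by simpa using hpint 0) hint fun ω => ?_
    exact potentialIncrement_le_loss hX h t (hrun.move_mem t ω) (hmin ω)
  have h4 : Real.exp (6 * ε) ≤ 1 + 12 * ε := by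
    have h5 := Real.exp_bound_div_one_sub_of_interval (x := 6 * ε) (by positivity) (by linarith)
    refine h5.trans ?_
    rw [div_le_iff₀ (by linarith)]
    nlinarith
  have h5 : 0 ≤ ∫ b, ψ b ∂isoGaussian d v := integral_nonneg hψ0
  have h6 : 0 ≤ M * Real.exp (-(4 * Λ)) := by positivity
  have h7 := mul_le_mul_of_nonneg_right h4 h5
  have h8 := mul_le_mul_of_nonneg_left h3 hε.le
  nlinarith [mul_nonneg hε.le h6, mul_nonneg hε.le h5]

/-- The stability bound in one round of the game, with curvature. -/
lemma integral_loss_le_of_curvature_pos {d T : ℕ} {X : Set (Vec d)}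
    {loss : Fin T → Vec d → ℝ} {D B β γ v ε Λ M : ℝ} (hX : IsActionSet X D)
    (h : IsLossSequence X loss B β γ) (hγ : 0 < γ) (hv : 0 < v) (hε : 0 < ε)
    (hΛ : 1 ≤ Λ) (hβv : Λ * β ^ 2 ≤ ε ^ 2 * v) {t : Fin T} (hM : ∀ x ∈ X, loss t x ≤ M)
    {Ω : Type*} [MeasurableSpace Ω] {P : Measure Ω} [IsProbabilityMeasure P]
    {b x : Fin T → Ω → Vec d} (hrun : IsObjPertRun P X loss γ ε (isoGaussian d v) b x) :
    ∫ ω, loss t (x t ω) ∂P ≤ ∫ b, potentialIncrement X loss (γ / ε) t b ∂isoGaussian d v +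
      ε * (54 * ∫ ω, loss t (x t ω) ∂P + 4 * (M * Real.exp (-(4 * Λ)))) := by
  set k : Vec d → ℝ := ε⁻¹ • loss t with hk
  have hc : 0 < γ / ε := by positivity
  have hgrad : ∀ y, DifferentiableAt ℝ (loss t) y →
      HasGradientAt k (ε⁻¹ • gradient (loss t) y) y := fun y hy => by
    rw [hasGradientAt_iff_hasFDerivAt, map_smul]
    exact hy.hasGradientAt.hasFDerivAt.const_smul ε⁻¹
  have hev : ∀ y ∈ X, gradient k =ᶠ[𝓝 y] fun z => ε⁻¹ • gradient (loss t) z := fun y hy =>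
    (h.twiceDifferentiable t y hy).1.mono fun z hz => (hgrad z hz).gradient
  have hhess : ∀ y ∈ X, hessian k y = ε⁻¹ • hessian (loss t) y := fun y hy => by
    have : fderiv ℝ (gradient k) y = ε⁻¹ • fderiv ℝ (gradient (loss t)) y := by
      rw [(hev y hy).fderiv_eq]
      exact fderiv_const_smul (h.twiceDifferentiable t y hy).2 ε⁻¹
    rw [hessian, this]; rfl
  have hR : IsRound X D (lossBefore loss t) k (γ / ε) :=
    { actionSet := hX
      convex_objective := h.convexOn_lossBefore hX.convex t
      differentiable_objective := fun y hy => h.differentiableAt_lossBefore _ hy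
      convex_loss := (h.convexOn t).smul (by positivity)
      twiceDifferentiable_loss := fun y hy =>
        ⟨(h.twiceDifferentiable t y hy).1.mono fun z hz => hz.const_smul _,
          ((h.twiceDifferentiable t y hy).2.const_smul ε⁻¹).congr_of_eventuallyEq (hev y hy)⟩
      rank_le_one := fun y hy => by
        rw [hhess y hy]
        refine le_trans (Submodule.finrank_mono ?_) (h.rank_le_one t y hy)
        rintro _ ⟨w, rfl⟩
        exact ⟨ε⁻¹ • w, by simp⟩
      nonneg_loss := fun y hy => mul_nonneg (by positivity) (h.nonneg t y hy)
      eigenvalue_le := fun y hy μ hμ => by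
        obtain ⟨w, hw⟩ := hμ.exists_hasEigenvector
        have h1 : Module.End.HasEigenvalue (hessian (loss t) y) (ε * μ) := by
          refine Module.End.hasEigenvalue_of_hasEigenvector (x := w) ⟨?_, hw.2⟩
          rw [Module.End.mem_eigenspace_iff]
          have h2 := hw.apply_eq_smul
          rw [hhess y hy, LinearMap.smul_apply, inv_smul_eq_iff₀ hε.ne', smul_smul] at h2
          exact h2
        have h2 := h.eigenvalue_le t y hy _ h1
        have h3 : μ ≤ γ / ε := by rw [le_div_iff₀ hε]; linarith
        linarith
      pos := hc }
  -- The number of steps along the path.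
  obtain ⟨N, hN⟩ : ∃ N : ℕ, ⌈Λ⌉₊ = N + 1 :=
    Nat.exists_eq_succ_of_ne_zero (Nat.ceil_pos.2 (by linarith)).ne'
  have hN1 : Λ ≤ ((N + 1 : ℕ) : ℝ) := hN ▸ Nat.le_ceil Λ
  have hN2 : ((N + 1 : ℕ) : ℝ) ≤ 2 * Λ := by
    have := Nat.ceil_lt_add_one (a := Λ) (by linarith)
    rw [hN] at this
    linarith
  have hg : ∀ y ∈ X, ((N + 1 : ℕ) : ℝ) * ‖gradient k y‖ ^ 2 ≤ 2 * v := fun y hy => by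
    have hβ := h.norm_gradient_le t y hy
    rw [(hgrad y (h.differentiableAt t hy)).gradient, norm_smul, norm_inv,
      Real.norm_of_nonneg hε.le]
    calc ((N + 1 : ℕ) : ℝ) * (ε⁻¹ * ‖gradient (loss t) y‖) ^ 2 ≤ 2 * Λ * (ε⁻¹ * β) ^ 2 := by
          gcongr
      _ = 2 * (ε⁻¹ ^ 2 * (Λ * β ^ 2)) := by ring
      _ ≤ 2 * (ε⁻¹ ^ 2 * (ε ^ 2 * v)) := by gcongr
      _ = 2 * v := by field_simp
  have hx : ∀ ω, x t ω = pathPoint X (lossBefore loss t) k (γ / ε) 0 (b t ω) := fun ω => by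
    have := hrun.move_isMin t ω
    rw [perturbedObjective_eq_tilted] at this
    exact hR.eq_pathPoint le_rfl (hrun.move_mem t ω) (by rwa [zero_smul, add_zero])
  have hpull : ∫ ω, loss t (x t ω) ∂P =
      ε * ∫ b, k (pathPoint X (lossBefore loss t) k (γ / ε) 0 b) ∂isoGaussian d v := by
    rw [← integral_const_mul, ← hrun.noise_law t, integral_map
      (hrun.measurable_noise t).aemeasurable
      ((hR.continuous_loss_pathPoint le_rfl).const_mul ε).aestronglyMeasurable]
    refine integral_congr_ae (ae_of_all _ fun ω => ?_)
    have hk' : ∀ y, loss t y = ε * k y := fun y => (mul_inv_cancel_left₀ hε.ne' _).symm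
    simp only [← hx, hk']
  have hψ : ∀ b, averageIncrement X (lossBefore loss t) k (γ / ε) ε b =
      ε⁻¹ * potentialIncrement X loss (γ / ε) t b := fun b => by
    rw [averageIncrement, potentialIncrement, lossBefore_succ, hk, smul_inv_smul₀ hε.ne', zero_smul,
      add_zero]
  have key := hR.integral_loss_le hε hv hg (M := ε⁻¹ * M) fun y hy =>
    mul_le_mul_of_nonneg_left (hM y hy) (by positivity)
  simp only [hψ] at key
  rw [integral_const_mul] at key
  have h1 := mul_le_mul_of_nonneg_left key hε.le
  rw [hpull]
  set I := ∫ b, k (pathPoint X (lossBefore loss t) k (γ / ε) 0 b) ∂isoGaussian d v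
  set Q := ∫ b, potentialIncrement X loss (γ / ε) t b ∂isoGaussian d v
  have hM0 : 0 ≤ M := by
    obtain ⟨z, hz⟩ := hX.nonempty
    exact (h.nonneg t z hz).trans (hM z hz)
  have h2 : ε * (ε⁻¹ * Q + ε * (54 * I +
      4 * (ε⁻¹ * M * Real.exp (-(4 * ((N + 1 : ℕ) : ℝ)))))) =
      Q + ε * (54 * (ε * I) + 4 * (M * Real.exp (-(4 * ((N + 1 : ℕ) : ℝ))))) := by
    field_simp
  rw [h2] at h1
  have h3 : M * Real.exp (-(4 * ((N + 1 : ℕ) : ℝ))) ≤ M * Real.exp (-(4 * Λ)) := by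
    gcongr
  have h4 := mul_le_mul_of_nonneg_left h3 hε.le
  linarith

/-- Cumulative loss under Gaussian noise. The last term vanishes quickly with `Λ`; it involves
bounds `M t` on the losses on `X`. -/
lemma expectedRegret_isoGaussian_le {d T : ℕ} {X : Set (Vec d)} {loss : Fin T → Vec d → ℝ}
    {D B β γ L v ε Λ : ℝ} (hX : IsActionSet X D) (h : IsLossSequence X loss B β γ)
    (hL : IsBestLoss X loss L) (hγ : 0 ≤ γ) (hv : 0 < v) (hε : 0 < ε) (hε1 : 108 * ε ≤ 1)
    (hΛ : 1 ≤ Λ) (hβv : Λ * β ^ 2 ≤ ε ^ 2 * v) {M : Fin T → ℝ}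
    (hM : ∀ t, ∀ x ∈ X, loss t x ≤ M t)
    {Ω : Type*} [MeasurableSpace Ω] {P : Measure Ω} [IsProbabilityMeasure P]
    {b x : Fin T → Ω → Vec d} (hrun : IsObjPertRun P X loss γ ε (isoGaussian d v) b x) :
    expectedRegret P loss x L ≤ 108 * ε * L + 2 * (γ / ε * D ^ 2 + 2 * D * √(d * v)) +
      8 * ε * (Real.exp (-(4 * Λ)) * ∑ t, M t) := by
  have hD := hX.nonneg
  have hL0 := hL.nonneg h
  have hc : 0 ≤ γ / ε := by positivity
  obtain ⟨hν, hmom⟩ := integral_norm_multivariateGaussian_le (d := d) hv.le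
  -- The moves are measurable, and the loss is continuous on the closed set `X`.
  have hint : ∀ t, Integrable (fun ω => loss t (x t ω)) P := by
    intro t
    have hcont : ContinuousOn (loss t) X := fun y hy =>
      (h.differentiableAt t hy).continuousAt.continuousWithinAt
    have hmeas : Measurable fun ω => loss t (x t ω) := by
      have h1 : Measurable (X.domRestrict (loss t)) := hcont.domRestrict.measurable
      exact h1.comp ((hrun.measurable_move t).subtype_mk (h := hrun.move_mem t))
    exact Integrable.of_bound hmeas.aestronglyMeasurable B (ae_of_all _ fun ω => by
      rw [Real.norm_of_nonneg (h.nonneg t _ (hrun.move_mem t ω))]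
      exact h.le_bound t _ (hrun.move_mem t ω))
  have hround : ∀ t, ∫ ω, loss t (x t ω) ∂P ≤
      ∫ b, potentialIncrement X loss (γ / ε) t b ∂isoGaussian d v +
      ε * (54 * ∫ ω, loss t (x t ω) ∂P + 4 * (M t * Real.exp (-(4 * Λ)))) := by
    intro t
    rcases hγ.eq_or_lt with rfl | hγ'
    · exact integral_loss_le_of_curvature_eq_zero hX h hv hε (by linarith) hΛ hβv (hM t) hrun
        (hint t)
    · exact integral_loss_le_of_curvature_pos hX h hγ' hv hε hΛ hβv (hM t) hrun
  have hsum := Finset.sum_le_sum fun t (_ : t ∈ Finset.univ) => hround t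
  rw [Finset.sum_add_distrib, ← Finset.mul_sum, Finset.sum_add_distrib, ← Finset.mul_sum,
    ← Finset.mul_sum, ← Finset.sum_mul] at hsum
  have hpot := sum_integral_potentialIncrement_le (c := γ / ε) hX h hL hc
    (ν := isoGaussian d v) hν
  rw [expectedRegret, integral_finsetSum _ fun t _ => hint t]
  have hI : 0 ≤ ∑ t, ∫ ω, loss t (x t ω) ∂P := Finset.sum_nonneg fun t _ =>
    integral_nonneg fun ω => h.nonneg t _ (hrun.move_mem t ω)
  have hM0 : 0 ≤ Real.exp (-(4 * Λ)) * ∑ t, M t := by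
    obtain ⟨z, hz⟩ := hX.nonempty
    exact mul_nonneg (Real.exp_pos _).le
      (Finset.sum_nonneg fun t _ => (h.nonneg t z hz).trans (hM t z hz))
  set I := ∑ t, ∫ ω, loss t (x t ω) ∂P
  set E := Real.exp (-(4 * Λ)) * ∑ t, M t with hE
  set R := γ / ε * D ^ 2 + 2 * D * √(d * v) with hR
  have hR0 : 0 ≤ R := by positivity
  have h1 : 2 * D * ∫ b, ‖b‖ ∂isoGaussian d v ≤ 2 * D * √(d * v) := by gcongr
  have h2 : I ≤ L + R + ε * (54 * I + 4 * E) := by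
    have e : 4 * E = 4 * ((∑ t, M t) * Real.exp (-(4 * Λ))) := by rw [hE]; ring
    rw [e]
    linarith
  -- Solve for `I`, using `1 / (1 - 54 ε) ≤ 1 + 108 ε`.
  have h3 : (1 - 54 * ε) * I ≤ L + R + 4 * ε * E := by linarith
  have h4 : (1 + 108 * ε) * ((1 - 54 * ε) * I) ≤ (1 + 108 * ε) * (L + R + 4 * ε * E) := by gcongr
  have h5 : I ≤ (1 + 108 * ε) * ((1 - 54 * ε) * I) := by
    have : 0 ≤ (54 * ε * (1 - 108 * ε)) * I :=
      mul_nonneg (mul_nonneg (by positivity) (by linarith)) hI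
    linarith
  have h6 : 108 * ε * (R + 4 * ε * E) ≤ 1 * (R + 4 * ε * E) := by gcongr
  linarith

/-- Regret under Gaussian noise with the parameter `ε = η / 108`, where `η ≤ 1`. -/
lemma expectedRegret_gaussianNoise_le {d T : ℕ} {X : Set (Vec d)} {loss : Fin T → Vec d → ℝ}
    {D B β γ L η : ℝ} (hX : IsActionSet X D) (h : IsLossSequence X loss B β γ)
    (hL : IsBestLoss X loss L) (hβ : 0 < β) (hγ : 0 ≤ γ) (hBT : 2 ≤ B * T) (hη : 0 < η)
    (hη1 : η ≤ 1) {M : Fin T → ℝ} (hM : ∀ t, ∀ x ∈ X, loss t x ≤ M t)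
    {Ω : Type*} [MeasurableSpace Ω] {P : Measure Ω} [IsProbabilityMeasure P]
    {b x : Fin T → Ω → Vec d}
    (hrun : IsObjPertRun P X loss γ (η / 108) (gaussianNoise d (η / 108) (1 / (B * T)) β) b x) :
    expectedRegret P loss x L ≤ η * L +
      864 * ((γ * D ^ 2 + D * √(d * (β ^ 2 * Real.log (B * T) + 1))) / η) +
      η * ((B * T)⁻¹ * ∑ t, M t) := by
  have hD := hX.nonneg
  have hBT0 : 0 < B * T := by linarith
  set ε := η / 108 with hε
  have hε0 : 0 < ε := by positivity
  have hε1 : 108 * ε ≤ 1 := by rw [hε]; linarith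
  set Λ := Real.log (2 / (1 / (B * T))) with hΛ
  have hΛ' : Λ = Real.log 2 + Real.log (B * T) := by
    rw [hΛ, ← Real.log_mul two_ne_zero hBT0.ne']
    congr 1
    field_simp
  have hlog : Real.log 2 ≤ Real.log (B * T) := Real.log_le_log two_pos hBT
  have hlog2 := Real.log_two_gt_d9
  have hΛ1 : 1 ≤ Λ := by linarith
  set v := (β ^ 2 * Λ + 4 * ε) / ε ^ 2 with hv
  have hv0 : 0 < v := by positivity
  have hM0 : 0 ≤ ∑ t, M t := by
    obtain ⟨z, hz⟩ := hX.nonempty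
    exact Finset.sum_nonneg fun t _ => (h.nonneg t z hz).trans (hM t z hz)
  have hmain := expectedRegret_isoGaussian_le hX h hL hγ hv0 hε0 hε1 hΛ1 (by
    rw [hv, mul_div_cancel₀ _ (by positivity)]
    linarith) hM hrun
  have hroot : √(d * v) ≤ 2 * √(d * (β ^ 2 * Real.log (B * T) + 1)) / ε := by
    have e : d * v = (d * (β ^ 2 * Λ + 4 * ε)) / ε ^ 2 := by rw [hv]; ring
    rw [e, Real.sqrt_div' _ (by positivity), Real.sqrt_sq hε0.le]
    gcongr
    have h2 : (2 : ℝ) = √(2 ^ 2) := by rw [Real.sqrt_sq zero_le_two]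
    rw [h2, ← Real.sqrt_mul (by positivity), ← mul_assoc, mul_comm (2 ^ 2 : ℝ), mul_assoc]
    gcongr
    have h3 : β ^ 2 * Λ ≤ β ^ 2 * (2 * Real.log (B * T)) := by gcongr; linarith
    have h4 : 0 ≤ β ^ 2 * Real.log (B * T) := mul_nonneg (sq_nonneg _) (by linarith)
    linarith
  set Q := √(d * (β ^ 2 * Real.log (B * T) + 1))
  have htail : Real.exp (-(4 * Λ)) ≤ (B * T)⁻¹ := by
    rw [← Real.exp_log hBT0, ← Real.exp_neg]
    exact Real.exp_le_exp.2 (by linarith)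
  have h1 : γ / ε * D ^ 2 + 2 * D * √(d * v) ≤ 4 * ((γ * D ^ 2 + D * Q) / ε) := by
    have h2 : 2 * D * √(d * v) ≤ 2 * D * (2 * Q / ε) := by gcongr
    have h3 : 0 ≤ γ / ε * D ^ 2 := by positivity
    have e : 4 * ((γ * D ^ 2 + D * Q) / ε) = 4 * (γ / ε * D ^ 2) + 2 * D * (2 * Q / ε) := by ring
    linarith
  have h4 : 8 * ε * (Real.exp (-(4 * Λ)) * ∑ t, M t) ≤ η * ((B * T)⁻¹ * ∑ t, M t) := by
    gcongr
    rw [hε]; linarith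
  have h5 : 2 * (4 * ((γ * D ^ 2 + D * Q) / ε)) = 864 * ((γ * D ^ 2 + D * Q) / η) := by
    rw [hε]; field_simp; ring
  have h6 : 108 * ε * L = η * L := by rw [hε]; ring
  linarith

/-- First-order regret under the Gaussian perturbation. -/
lemma regret_gaussianNoise : ∃ C : ℝ, 0 < C ∧ ∀ (d T : ℕ) (D B β γ L : ℝ), 0 < β → 0 ≤ γ →
      2 ≤ B * T → ∃ ε : ℝ, 0 < ε ∧
        ∀ (X : Set (Vec d)) (loss : Fin T → Vec d → ℝ),
          IsActionSet X D → IsLossSequence X loss B β γ → IsBestLoss X loss L →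
          ∀ (Ω : Type*) [MeasurableSpace Ω] (P : MeasureTheory.Measure Ω)
            [MeasureTheory.IsProbabilityMeasure P] (b x : Fin T → Ω → Vec d),
            IsObjPertRun P X loss γ ε (gaussianNoise d ε (1 / (B * T)) β) b x →
            (expectedRegret P loss x L
                ≤ C * (√(L * (γ * D ^ 2 + D * √(d * (β ^ 2 * Real.log (B * T) + 1))))
                    + (γ * D ^ 2 + D * √(d * (β ^ 2 * Real.log (B * T) + 1))) + 1)) ∧
            (1 ≤ β → 1 ≤ B → γ * D ^ 2 + D * √(d * (β ^ 2 * Real.log (B * T))) ≤ L →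
              expectedRegret P loss x L
                ≤ C * √(L * (γ * D ^ 2 + D * √(d * (β ^ 2 * Real.log (B * T)))))) := by
  refine ⟨1800, by norm_num, fun d T D B β γ L hβ hγ hBT => ?_⟩
  set Q := √(d * (β ^ 2 * Real.log (B * T) + 1)) with hQ
  set Q' := √(d * (β ^ 2 * Real.log (B * T))) with hQ'
  set A := γ * D ^ 2 + D * Q with hA
  set A' := γ * D ^ 2 + D * Q' with hA'
  set η := balancedParameter A L with hη
  have hη0 : 0 < η := balancedParameter_pos A L
  have hη1 : η ≤ 1 := balancedParameter_le_one A L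
  refine ⟨η / 108, by positivity, ?_⟩
  intro X loss hX h hL Ω _ P _ b x hrun
  have hD := hX.nonneg
  have hL0 := hL.nonneg h
  have hBT0 : 0 < B * T := by linarith
  have hlog : 1 / 2 ≤ Real.log (B * T) := by
    have h1 : Real.log 2 ≤ Real.log (B * T) := Real.log_le_log two_pos hBT
    have h2 := Real.log_two_gt_d9
    linarith
  have hQ0 : 0 ≤ Q := Real.sqrt_nonneg _
  have hQ'0 : 0 ≤ Q' := Real.sqrt_nonneg _
  have hA0 : 0 ≤ A := by positivity
  have hA'0 : 0 ≤ A' := by positivity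
  by_cases hdeg : d = 0 ∨ D = 0
  · rw [expectedRegret_eq_zero (hX.subsingleton hdeg) hL hrun]
    exact ⟨by positivity, fun _ _ _ => by positivity⟩
  push Not at hdeg
  have hd : (1 : ℝ) ≤ d := by exact_mod_cast Nat.one_le_iff_ne_zero.2 hdeg.1
  have hDpos : 0 < D := lt_of_le_of_ne hD (Ne.symm hdeg.2)
  have hApos : 0 < A := by
    have : 0 < Q := Real.sqrt_pos.2 (by positivity)
    positivity
  -- The balanced parameter makes the main terms small in both regimes.
  have hbal : ∀ {k : ℝ}, 0 ≤ k → η * L + k * (A / η) ≤ (1 + k) * (√(L * A) + A) ∧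
      (A ≤ L → η * L + k * (A / η) ≤ (1 + k) * √(L * A)) := by
    intro k hk
    have hbig : A ≤ L → η * L + k * (A / η) ≤ (1 + k) * √(L * A) := fun hAL =>
      (balancedParameter_mul_add_le hApos hAL).le
    refine ⟨?_, hbig⟩
    have hs := Real.sqrt_nonneg (L * A)
    rcases le_or_gt A L with hAL | hAL
    · refine (hbig hAL).trans ?_
      gcongr
      linarith
    · rw [hη, balancedParameter, if_neg (fun h => hAL.not_ge h.2), one_mul, div_one]
      have : 0 ≤ (1 + k) * √(L * A) := by positivity
      linarith
  constructor
  · have hreg := expectedRegret_gaussianNoise_le hX h hL hβ hγ hBT hη0 hη1 (M := fun _ => B)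
      (fun t y hy => h.le_bound t y hy) hrun
    have e : (B * T)⁻¹ * ∑ _t : Fin T, B = 1 := by
      rw [Finset.sum_const, Finset.card_univ, Fintype.card_fin, nsmul_eq_mul, mul_comm (T : ℝ)]
      exact inv_mul_cancel₀ hBT0.ne'
    rw [e] at hreg
    have h1 := (hbal (k := 864) (by norm_num)).1
    have := Real.sqrt_nonneg (L * A)
    linarith
  · intro hβ1 hB1 hAL
    obtain ⟨z, hz, hzL⟩ := hL.1
    -- A loss exceeds its value at the best action by at most `2 β D`.
    have hreg := expectedRegret_gaussianNoise_le hX h hL hβ hγ hBT hη0 hη1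
      (M := fun t => loss t z + 2 * (β * D)) (fun t y hy => by
        have h1 := (h.convexOn t).add_inner_gradient_le hy hz
          (h.differentiableAt t hy).hasGradientAt
        have h2 : |(inner ℝ (gradient (loss t) y) (z - y) : ℝ)| ≤ β * (D + D) :=
          (abs_real_inner_le_norm _ _).trans (mul_le_mul (h.norm_gradient_le t y hy)
            ((norm_sub_le _ _).trans (add_le_add (hX.norm_le z hz) (hX.norm_le y hy)))
            (norm_nonneg _) hβ.le)
        linarith [(abs_le.1 h2).1]) hrun
    have hT : (T : ℝ) ≤ B * T := le_mul_of_one_le_left (Nat.cast_nonneg T) hB1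
    have htail : (B * T)⁻¹ * ∑ t, (loss t z + 2 * (β * D)) ≤ L + 2 * (β * D) := by
      simp only at hzL
      rw [Finset.sum_add_distrib, hzL, Finset.sum_const, Finset.card_univ, Fintype.card_fin,
        nsmul_eq_mul, inv_mul_le_iff₀ hBT0]
      have h1 : L ≤ B * T * L := le_mul_of_one_le_left hL0 (by linarith)
      have h2 : T * (2 * (β * D)) ≤ B * T * (2 * (β * D)) := by gcongr
      linarith
    have hlow : β * D ≤ 2 * A' := by
      have h1 : β / 2 ≤ Q' := by
        refine Real.le_sqrt_of_sq_le ?_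
        have h2 : β ^ 2 * (1 / 2) ≤ β ^ 2 * Real.log (B * T) := by gcongr
        have h3 : 1 * (β ^ 2 * Real.log (B * T)) ≤ d * (β ^ 2 * Real.log (B * T)) := by
          have : 0 ≤ β ^ 2 * Real.log (B * T) := mul_nonneg (sq_nonneg _) (by linarith)
          gcongr
        nlinarith [sq_nonneg β]
      have h2 : D * (β / 2) ≤ D * Q' := by gcongr
      have h3 : 0 ≤ γ * D ^ 2 := by positivity
      linarith
    have hAA : A ≤ 2 * A' := by
      have h1 : Q ≤ 2 * Q' := by
        have h2 : (2 : ℝ) = √(2 ^ 2) := by rw [Real.sqrt_sq zero_le_two]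
        rw [hQ, hQ', h2, ← Real.sqrt_mul (by positivity), ← mul_assoc, mul_comm (2 ^ 2 : ℝ),
          mul_assoc]
        gcongr
        have : 1 * (1 / 2) ≤ β ^ 2 * Real.log (B * T) := by
          gcongr
          exact one_le_pow₀ hβ1
        linarith
      have h2 : D * Q ≤ D * (2 * Q') := by gcongr
      have h3 : 0 ≤ γ * D ^ 2 := by positivity
      linarith
    have hηt := mul_le_mul_of_nonneg_left htail hη0.le
    have hηD : η * (2 * (β * D)) ≤ 1 * (2 * (β * D)) := by gcongr
    have hA'L : A' ≤ √(L * A') := Real.le_sqrt_of_sq_le (by nlinarith)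
    have hmain : η * L + 432 * (A / η) ≤ 433 * (2 * √(L * A')) := by
      have h1 : √(L * A) ≤ 2 * √(L * A') := by
        have h2 : (2 : ℝ) = √(2 ^ 2) := by rw [Real.sqrt_sq zero_le_two]
        rw [h2, ← Real.sqrt_mul (by positivity)]
        refine Real.sqrt_le_sqrt ?_
        nlinarith [mul_le_mul_of_nonneg_left hAA hL0, mul_nonneg hL0 hA'0]
      rcases le_or_gt A L with hAL' | hAL'
      · have := (hbal (k := 432) (by norm_num)).2 hAL'
        linarith
      · rw [hη, balancedParameter, if_neg (fun h => hAL'.not_ge h.2), one_mul, div_one]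
        linarith
    linarith

theorem theorem1 :
    -- Gamma perturbation
    (∃ C : ℝ, 0 < C ∧ ∀ (d : ℕ) (D β γ L : ℝ), 0 < β → 0 ≤ γ →
      ∃ ε : ℝ, 0 < ε ∧
        ∀ (T : ℕ) (B : ℝ) (X : Set (Vec d)) (loss : Fin T → Vec d → ℝ),
          IsActionSet X D → IsLossSequence X loss B β γ → IsBestLoss X loss L →
          ∀ (Ω : Type*) [MeasurableSpace Ω] (P : MeasureTheory.Measure Ω)
            [MeasureTheory.IsProbabilityMeasure P] (b x : Fin T → Ω → Vec d),
            IsObjPertRun P X loss γ ε (gammaNoise d ε β) b x →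
            (expectedRegret P loss x L
                ≤ C * (√(L * (γ * D ^ 2 + β * d * D)) + (γ * D ^ 2 + β * d * D))) ∧
            (γ * D ^ 2 + β * d * D ≤ L →
              expectedRegret P loss x L ≤ C * √(L * (γ * D ^ 2 + β * d * D)))) ∧
    -- Gaussian perturbation, with `δ = 1 / (B T)`
    (∃ C : ℝ, 0 < C ∧ ∀ (d T : ℕ) (D B β γ L : ℝ), 0 < β → 0 ≤ γ → 2 ≤ B * T →
      ∃ ε : ℝ, 0 < ε ∧
        ∀ (X : Set (Vec d)) (loss : Fin T → Vec d → ℝ),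
          IsActionSet X D → IsLossSequence X loss B β γ → IsBestLoss X loss L →
          ∀ (Ω : Type*) [MeasurableSpace Ω] (P : MeasureTheory.Measure Ω)
            [MeasureTheory.IsProbabilityMeasure P] (b x : Fin T → Ω → Vec d),
            IsObjPertRun P X loss γ ε (gaussianNoise d ε (1 / (B * T)) β) b x →
            (expectedRegret P loss x L
                ≤ C * (√(L * (γ * D ^ 2 + D * √(d * (β ^ 2 * Real.log (B * T) + 1))))
                    + (γ * D ^ 2 + D * √(d * (β ^ 2 * Real.log (B * T) + 1))) + 1)) ∧
            (1 ≤ β → 1 ≤ B → γ * D ^ 2 + D * √(d * (β ^ 2 * Real.log (B * T))) ≤ L →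
              expectedRegret P loss x L
                ≤ C * √(L * (γ * D ^ 2 + D * √(d * (β ^ 2 * Real.log (B * T))))))) := by
  exact ⟨regret_gammaNoise, regret_gaussianNoise⟩
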